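/- **Setting.** Vertices of the $M\times N$ grid are pairs $(i,j)$ (row, column), $1\le i\le M$, $1\le j\le N$, rows numbered from top to bottom and columns from left to right; neighbours are at distance 1. A configuration is a set $R$ of $n$ occupied vertices; it is *asymmetric* if no rotation by $90^\circ$, $180^\circ$ or $270^\circ$ maps the grid with its robots to itself. The $n$ robots are anonymous, oblivious and fully synchronous: in each Look-Compute-Move cycle every robot applies the same deterministic algorithm to its snapshot (the grid, the set $R$ and its own position, in a local coordinate system which may be rotated, differently for each robot and each cycle, but is not reflected: chirality) and stays or moves along one edge. Two robots are mutually visible if some shortest path of the grid between them contains no other robot. *GMV*$_{area}$ is solved if all robots are pairwise mutually visible and the area of their minimum bounding rectangle (mbr) is minimum among all such placements of $n$ robots on the grid. Put $k=\lceil n/2\rceil$ and $a\dot-b=\max(a-b,0)$. **Pattern.** $F$ consists of the $(i,j)\in[1,k]^2$ with $i+j\in\{k-1,k+3\}$ and of $(1,k-1),(2,k),(k-1,1),(k,2)$; if $n$ is odd, $(k,2)$ is removed. **View.** Read the mbr row by row, each row from left to right, as a 0/1 string, after each of the four rotations of the configuration (only after the two that make the mbr at least as high as wide, if it is not a square). The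 position of a robot in the lexicographically smallest string is its view (if strings are equal, compare next the top row number of the mbr, then its left column number, then the number of rows of the grid, all after the rotation). **Algorithm $\mathcal A_{asym}$.** The first applicable rule is used; robots that are not mentioned stay. 1. $R$ is a rotated and translated copy of $F$: nobody moves. 2. Exactly one corner is occupied. Its robot is the guard; rotate so that it is at $(1,N)$, and embed $F$ by $(i,j)\mapsto(i,j+N-k)$. Let $n_l,t_l$ be the numbers of robots and of targets in row $l$, let $B_l$ ($A_l$) be (number of robots) $\dot-$ (number of targets) in the rows $\le l$ ($\ge l$), $RD_l=n_l-(n_l\dot-B_l)$, $RU_l=n_l-(n_l\dot-A_l)$. (a) *Final guard move.* If all robots but the guard occupy all targets but $(1,N-1)$, the guard moves to $(1,N-1)$. (b) *Row-wise placement.* Otherwise, if $A_l=B_l=0$ for all $l$: in each row the rightmost robot moves one step towards the rightmost target and the leftmost robot towards the leftmost target, except for the guard. (c) *Row balancing.* Otherwise, in each row $l$, consider the robots other than the guard and, if $M=k$, not on the first or last column; $D_l$ is the set of the first $RD_l$ of them from the left, $U_l$ that of the first $RU_l$ of them from the right (all of them if there are fewer), but $U_2:=\emptyset$ if it would be $\{(2,1)\}$.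 A robot $r$ at $(l,c)$ has the target: $(l+1,c)$ if $r\in D_l$; $(l-1,c)$ if $r\in U_l$; if $U_{l+1}=\{(l+1,c)\}$ or $D_{l-1}=\{(l-1,c)\}$, then $(l,c-1)$ if $2c\ge N+1$ and $(l,c+1)$ otherwise; $(2,2)$ if $RU_2=1$ and $r$ is at $(2,1)$ and is the only robot of row 2; its own position otherwise (the first applicable case is used). All robots move to their targets, except that, if two robots have the same target, the robots in $U_l$ and the robots $(l,c)$ with $U_{l+1}=\{(l+1,c)\}$ stay. 3. More than one corner is occupied (*guard placement*). The special path of the corner $(1,1)$ consists of $\lfloor\min(M,N)/2\rfloor$ traits: $(1,1),\dots,(1,N-1)$, then $(2,N-1),\dots,(2,3)$, then $(3,3),\dots,(3,N-3)$, and so on; those of the other corners are defined by rotation. Its special subpath is the longest fully occupied initial part. If at most one special path is fully occupied, keep this one or, if there is none, that of the occupied corner whose robot has minimum view; on all other special paths the robots of the special subpath advance by one vertex. If exactly two special paths are fully occupied, a robot on a corner with an empty neighbour moves to it. 4. Some robot is on a side of the grid, none on a corner (*guard placement*). Among the robots on the sides, the one closest to a corner (of minimum view in case of ties) moves one step towards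 its closest corner (chosen by its local coordinates if there are two). 5. No robot is on a side (*guard placement*). The robot $r$ with maximum sum of distances to the others (of minimum view in case of ties) moves one step in the direction in which this sum grows most, in case of ties towards the closest side of the grid. **Theorem.** There is a constant $K$ such that for all $n\ge7$ and $M,N\ge\lceil n/2\rceil$, every asymmetric configuration $C$ of $n$ robots on distinct vertices of the $M\times N$ grid, and every choice of the local coordinate systems, the execution of $\mathcal A_{asym}$ from $C$ never has a collision (two robots on one vertex), every robot stays or moves along one edge in each cycle, and after some number $T$ of cycles $GMV_{area}$ is solved and no robot moves any more, where $T\le K\cdot L$ and $L$ is the side of the smallest square that contains both $C$ and the final configuration. This is time-optimal: there is a constant $c$ such that for all such $n,M,N$ there is an asymmetric configuration from which every algorithm needs at least $\max(M,N)/c$ cycles to solve $GMV_{area}$ without collisions (whereas always $L<\max(M,N)$). -/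

import Mathlib

noncomputable section

namespace GridRobots

/-! ### The finite grid -/

/-- A vertex, written as (row, column); rows are numbered from `1` from top to bottom, columns
from `1` from left to right. -/
abbrev Cell := ℤ × ℤ

/-- The vertices of the grid with `M` rows and `N` columns. -/
def cells (M N : ℕ) : Finset Cell := Finset.Icc 1 (M : ℤ) ×ˢ Finset.Icc 1 (N : ℤ)

def cellDist (u v : Cell) : ℤ := |u.1 - v.1| + |u.2 - v.2|

/-- The `M × N` grid graph (pairs of integers outside the grid are isolated). -/
def gridGraph (M N : ℕ) : SimpleGraph Cell where
  Adj u v := u ∈ cells M N ∧ v ∈ cells M N ∧ cellDist u v = 1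
  symm := ⟨by
    rintro u v ⟨hu, hv, h⟩
    refine ⟨hv, hu, ?_⟩
    rw [cellDist, abs_sub_comm v.1, abs_sub_comm v.2]
    exact h⟩
  loopless := ⟨by
    rintro u ⟨_, _, h⟩
    simp [cellDist] at h⟩

/-! ### The problem -/

/-- `u` and `v` see each other: on some shortest path between them there is no robot except at
its two ends. -/
def MutuallyVisible (G : SimpleGraph Cell) (R : Finset Cell) (u v : Cell) : Prop :=
  ∃ w : G.Walk u v, w.length = G.dist u v ∧ ∀ x ∈ w.support, x ∈ R → x = u ∨ x = v

/-- All robots are in pairwise geodesic mutual visibility. -/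
def GeodesicMutualVisibility (M N : ℕ) (R : Finset Cell) : Prop :=
  ∀ u ∈ R, ∀ v ∈ R, MutuallyVisible (gridGraph M N) R u v

/-- The height of the minimum bounding rectangle. -/
def rowSpan (R : Finset Cell) : ℕ := R.sup fun u => R.sup fun v => (u.1 - v.1).natAbs

/-- The width of the minimum bounding rectangle. -/
def colSpan (R : Finset Cell) : ℕ := R.sup fun u => R.sup fun v => (u.2 - v.2).natAbs

def mbrArea (R : Finset Cell) : ℕ := rowSpan R * colSpan R

/-- The placement `R` is in geodesic mutual visibility, and its minimum bounding rectangle has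
the smallest area among all such placements of as many robots on the same grid. -/
def SolvesGMVArea (M N : ℕ) (R : Finset Cell) : Prop :=
  GeodesicMutualVisibility M N R ∧
    ∀ S ⊆ cells M N, S.card = R.card → GeodesicMutualVisibility M N S → mbrArea R ≤ mbrArea S

/-- The side of the smallest square that contains both placements. -/
def squareSide (R S : Finset Cell) : ℕ := max (rowSpan (R ∪ S)) (colSpan (R ∪ S))

/-! ### Rotations -/

/-- `q` clockwise quarter turns of the `M × N` grid. -/
def rotCell (M N : ℕ) (q : Fin 4) (v : Cell) : Cell :=
  match q with
  | 0 => v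
  | 1 => (v.2, M + 1 - v.1)
  | 2 => (M + 1 - v.1, N + 1 - v.2)
  | 3 => (N + 1 - v.2, v.1)

/-- The number of rows after `q` quarter turns. -/
def rotRows (M N : ℕ) (q : Fin 4) : ℕ := if q = 0 ∨ q = 2 then M else N

/-- The number of columns after `q` quarter turns. -/
def rotCols (M N : ℕ) (q : Fin 4) : ℕ := if q = 0 ∨ q = 2 then N else M

def rotate (M N : ℕ) (q : Fin 4) (R : Finset Cell) : Finset Cell := R.image (rotCell M N q)

/-- No rotation by 90, 180 or 270 degrees maps the grid with its robots to itself. -/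
def Asymmetric (M N : ℕ) (R : Finset Cell) : Prop :=
  ∀ q : Fin 4, q ≠ 0 → ¬ (rotRows M N q = M ∧ rotCols M N q = N ∧ rotate M N q R = R)

/-! ### Fully synchronous oblivious robots with chirality -/

/-- A deterministic algorithm: from the snapshot (number of rows, number of columns, occupied
vertices, own vertex, all in the local coordinate system of the robot) it computes a
destination. It has no memory, no identifiers and no access to the global coordinates. -/
abbrev Algorithm := ℕ → ℕ → Finset Cell → Cell → Cell

/-- Apply a rule in the coordinate system that is turned by `q` quarter turns. -/
def inFrame (M N : ℕ) (q : Fin 4) (A : Algorithm) (R : Finset Cell) (v : Cell) : Cell :=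
  rotCell (rotRows M N q) (rotCols M N q) (-q)
    (A (rotRows M N q) (rotCols M N q) (rotate M N q R) (rotCell M N q v))

def occupied {n : ℕ} (x : Fin n → Cell) : Finset Cell := Finset.univ.image x

/-- The execution of `A` from `p`: in every cycle all `n` robots look, compute and move. In cycle
`t` the local coordinate system of robot `i` is turned by `o t i` quarter turns with respect to
the global one (by chirality it is never reflected). -/
def run {n : ℕ} (A : Algorithm) (M N : ℕ) (o : ℕ → Fin n → Fin 4) (p : Fin n → Cell) :
    ℕ → Fin n → Cell
  | 0 => p
  | t + 1 => fun i => inFrame M N (o t i) A (occupied (run A M N o p t)) (run A M N o p t i)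

/-- No two robots are ever on the same vertex, and in each cycle every robot stays where it is or
moves along one edge. -/
def ValidRun {n : ℕ} (M N : ℕ) (x : ℕ → Fin n → Cell) : Prop :=
  (∀ t, Function.Injective (x t)) ∧
    ∀ t i, x (t + 1) i = x t i ∨ (gridGraph M N).Adj (x t i) (x (t + 1) i)

/-! ### Corners, sides, and the view of the robots -/

def corners (M N : ℕ) : Finset Cell := {(1, 1), (1, (N : ℤ)), ((M : ℤ), 1), ((M : ℤ), (N : ℤ))}

def occupiedCorners (M N : ℕ) (R : Finset Cell) : Finset Cell :=
  (corners M N).filter fun c => c ∈ R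

abbrev OnSide (M N : ℕ) (v : Cell) : Prop := v.1 = 1 ∨ v.1 = M ∨ v.2 = 1 ∨ v.2 = N

def minRow (R : Finset Cell) : ℤ := (R.image Prod.fst).min.untopD 0

def minCol (R : Finset Cell) : ℤ := (R.image Prod.snd).min.untopD 0

/-- The binary string of the minimum bounding rectangle, read row by row from its upper left
corner. -/
def mbrString (R : Finset Cell) : List ℤ :=
  (List.range (rowSpan R + 1)).flatMap fun a => (List.range (colSpan R + 1)).map fun b =>
    if (minRow R + a, minCol R + b) ∈ R then 1 else 0

/-- The string read from the corner that `q` quarter turns bring to the upper left. The entries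
after the string give the place of the rectangle in the grid; they only matter if two of the
strings are equal. -/
def viewKey (M N : ℕ) (R : Finset Cell) (q : Fin 4) : List ℤ :=
  mbrString (rotate M N q R) ++
    [minRow (rotate M N q R), minCol (rotate M N q R), (rotRows M N q : ℤ)]

/-- The orientation that gives the lexicographically smallest string, among the four orientations
(or the two along the shorter sides, if the rectangle is not a square). -/
def viewFrame (M N : ℕ) (R : Finset Cell) : Fin 4 :=
  (List.argmin (viewKey M N R) ((List.finRange 4).filter fun q =>
    colSpan (rotate M N q R) ≤ rowSpan (rotate M N q R))).getD 0

/-- The position of a vertex in the lexicographically smallest string. -/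
def viewPos (M N : ℕ) (R : Finset Cell) (v : Cell) : ℤ ×ₗ ℤ :=
  toLex (rotCell M N (viewFrame M N R) v)

/-- The elements of `S` of minimum view. -/
def minView (M N : ℕ) (R S : Finset Cell) : Finset Cell :=
  S.filter fun v => ∀ s ∈ S, viewPos M N R v ≤ viewPos M N R s

/-! ### Guard placement -/

/-- The sum of the distances from `v` to the robots. -/
def sumDist (R : Finset Cell) (v : Cell) : ℤ := ∑ s ∈ R, cellDist v s

/-- Up, right, down, left. -/
def directions : List Cell := [(-1, 0), (0, 1), (1, 0), (0, -1)]

/-- The distance from `v` to the side of the grid in direction `d`. -/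
def sideDist (M N : ℕ) (v d : Cell) : ℤ :=
  if d = (-1, 0) then v.1 - 1
  else if d = (0, 1) then N - v.2
  else if d = (1, 0) then M - v.1
  else v.2 - 1

/-- The direction in which the sum of the distances to the other robots grows most; in case of
ties, the one with the closest side of the grid. -/
def outward (M N : ℕ) (R : Finset Cell) (v : Cell) : Cell :=
  (List.argmin (fun d : Cell => toLex (-sumDist (R.erase v) (v + d), sideDist M N v d))
    directions).getD 0

/-- No robot on a side: the guard is a robot with the largest sum of distances, of minimum view
in case of ties, and moves outward. -/
def moveToSide : Algorithm := fun M N R v =>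
  if v ∈ minView M N R (R.filter fun u => ∀ s ∈ R, sumDist R s ≤ sumDist R u) then
    v + outward M N R v
  else v

/-- The distance from `v` to the closest corner. -/
def cornerDist (M N : ℕ) (v : Cell) : ℤ :=
  min (v.1 - 1) (M - v.1) + min (v.2 - 1) (N - v.2)

/-- Robots on the sides but not on the corners: the guard is a robot on a side closest to a
corner, of minimum view in case of ties, and moves towards its closest corner. -/
def moveToCorner : Algorithm := fun M N R v =>
  if v ∈ minView M N R (R.filter fun u => OnSide M N u ∧
      ∀ s ∈ R, OnSide M N s → cornerDist M N u ≤ cornerDist M N s) then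
    if v.1 = 1 ∨ v.1 = M then
      if v.2 - 1 < N - v.2 then v + (0, -1) else v + (0, 1)
    else if v.1 - 1 < M - v.1 then v + (-1, 0) else v + (1, 0)
  else v

/-- The special path that starts at the upper left corner: `(1,1), …, (1,N-1)`, then
`(2,N-1), …, (2,3)`, then `(3,3), …, (3,N-3)`, and so on, `⌊min M N / 2⌋` traits in total. -/
def specialPath (M N : ℕ) : List Cell :=
  (List.range (min M N / 2)).flatMap fun s => (List.range (N - 2 * s - 1)).map fun c =>
    if Even s then ((s : ℤ) + 1, (s : ℤ) + 1 + c) else ((s : ℤ) + 1, (N : ℤ) - s - c)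

/-- The fully occupied part of the special path of the upper left corner that starts at this
corner. -/
def specialSubpath (M N : ℕ) (R : Finset Cell) : List Cell :=
  (specialPath M N).takeWhile fun u => u ∈ R

/-- The robots on this special subpath move to the next vertex of the special path. -/
def advance : Algorithm := fun M N R v =>
  if v ∈ specialSubpath M N R then
    (specialPath M N).getD ((specialPath M N).idxOf v + 1) v
  else v

/-- The special path of the corner that `q` quarter turns bring to the upper left is fully
occupied. -/
abbrev FullPath (M N : ℕ) (R : Finset Cell) (q : Fin 4) : Prop :=
  ∀ u ∈ specialPath (rotRows M N q) (rotCols M N q), u ∈ rotate M N q R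

/-- The corner that `q` quarter turns bring to the upper left. -/
def pathCorner (M N : ℕ) (q : Fin 4) : Cell :=
  rotCell (rotRows M N q) (rotCols M N q) (-q) (1, 1)

/-- The corner whose special path stays still: the one of the fully occupied special path, if
there is one, and otherwise the one that carries the corner robot of minimum view. -/
abbrev KeptPath (M N : ℕ) (R : Finset Cell) (q : Fin 4) : Prop :=
  if ∃ q', FullPath M N R q' then FullPath M N R q
  else pathCorner M N q ∈ minView M N R (occupiedCorners M N R)

/-- Several robots on corners: with at most one fully occupied special path, all special subpaths
but one advance by one vertex; with two fully occupied special paths, the robot on a corner that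
has an empty neighbour moves to it. -/
def clearCorners : Algorithm := fun M N R v =>
  let p := (Finset.univ.filter fun q : Fin 4 => FullPath M N R q).card
  if p ≤ 1 then
    match (List.finRange 4).find? fun q =>
        rotCell M N q v ∈ specialSubpath (rotRows M N q) (rotCols M N q) (rotate M N q R) with
    | some q => if KeptPath M N R q then v else inFrame M N q advance R v
    | none => v
  else if p = 2 ∧ v ∈ corners M N then
    match directions.find? fun d => v + d ∈ cells M N ∧ v + d ∉ R with
    | some d => v + d
    | none => v
  else v

/-! ### The target pattern -/

/-- The pattern for `n` robots in the square `[1, k] × [1, k]`, where `k = ⌈n / 2⌉`: two robots in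
every row and column, none on the corners, and one at `(1, k - 1)`. For odd `n` one robot of the
last row is left out. -/
def pattern (n : ℕ) : Finset Cell :=
  let k : ℤ := ((n + 1) / 2 : ℕ)
  let full := (Finset.Icc 1 k ×ˢ Finset.Icc 1 k).filter fun v : Cell =>
    v.1 + v.2 = k - 1 ∨ v.1 + v.2 = k + 3 ∨
      v = (1, k - 1) ∨ v = (2, k) ∨ v = (k - 1, 1) ∨ v = (k, 2)
  if Even n then full else full.erase (k, 2)

/-- The pattern embedded in a grid with `N` columns at the upper right corner. -/
def target (n N : ℕ) : Finset Cell :=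
  (pattern n).image fun v => (v.1, v.2 + N - ((n + 1) / 2 : ℕ))

/-- Translate to the upper left corner of the coordinate system. -/
def normalize (R : Finset Cell) : Finset Cell :=
  R.image fun v => (v.1 - minRow R + 1, v.2 - minCol R + 1)

/-- The robots form the pattern, up to rotation and translation. -/
abbrev PatternFormed (M N : ℕ) (R : Finset Cell) : Prop :=
  ∃ q : Fin 4, normalize (rotate M N q R) = pattern R.card

/-! ### Row balancing

From here on, the only robot on a corner is the guard, and it is on the upper right corner. -/

/-- The number of elements of `S` in row `l`. -/
def inRow (S : Finset Cell) (l : ℤ) : ℕ := (S.filter fun v => v.1 = l).card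

/-- The number of exceeding robots above `l`, `l` included. -/
def excessAbove (N : ℕ) (R : Finset Cell) (l : ℤ) : ℕ :=
  (R.filter fun v => v.1 ≤ l).card - ((target R.card N).filter fun v => v.1 ≤ l).card

/-- The number of exceeding robots below `l`, `l` included. -/
def excessBelow (N : ℕ) (R : Finset Cell) (l : ℤ) : ℕ :=
  (R.filter fun v => l ≤ v.1).card - ((target R.card N).filter fun v => l ≤ v.1).card

/-- The number of robots that must move downward from row `l`. -/
def numDown (N : ℕ) (R : Finset Cell) (l : ℤ) : ℕ :=
  inRow R l - (inRow R l - excessAbove N R l)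

/-- The number of robots that must move upward from row `l`. -/
def numUp (N : ℕ) (R : Finset Cell) (l : ℤ) : ℕ :=
  inRow R l - (inRow R l - excessBelow N R l)

/-- The robots in row `l` that may be selected: not the guard and, if the grid has no spare row,
not on the first or the last column. -/
def eligible (M N : ℕ) (R : Finset Cell) (l : ℤ) : Finset Cell :=
  R.filter fun v => v.1 = l ∧ v ≠ (1, (N : ℤ)) ∧
    ((R.card + 1) / 2 < M ∨ (v.2 ≠ 1 ∧ v.2 ≠ N))

/-- The robots selected to move downward from row `l`, starting from the left. -/
def downSet (M N : ℕ) (R : Finset Cell) (l : ℤ) : Finset Cell :=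
  (eligible M N R l).filter fun v =>
    ((eligible M N R l).filter fun s => s.2 < v.2).card < numDown N R l

/-- The robots selected to move upward from row `l`, starting from the right; a single robot on
`(2, 1)` is not selected. -/
def upSet (M N : ℕ) (R : Finset Cell) (l : ℤ) : Finset Cell :=
  let S := (eligible M N R l).filter fun v =>
    ((eligible M N R l).filter fun s => v.2 < s.2).card < numUp N R l
  if l = 2 ∧ S = {(2, 1)} then ∅ else S

/-- Exactly one robot is selected in the row below `v`, and it is to move up onto `v`. -/
abbrev AlignedUp (M N : ℕ) (R : Finset Cell) (v : Cell) : Prop :=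
  upSet M N R (v.1 + 1) = {(v.1 + 1, v.2)}

/-- Exactly one robot is selected in the row above `v`, and it is to move down onto `v`. -/
abbrev AlignedDown (M N : ℕ) (R : Finset Cell) (v : Cell) : Prop :=
  downSet M N R (v.1 - 1) = {(v.1 - 1, v.2)}

def balanceTarget (M N : ℕ) (R : Finset Cell) (v : Cell) : Cell :=
  if v ∈ downSet M N R v.1 then (v.1 + 1, v.2)
  else if v ∈ upSet M N R v.1 then (v.1 - 1, v.2)
  else if AlignedUp M N R v ∨ AlignedDown M N R v then
    if (N : ℤ) + 1 ≤ 2 * v.2 then (v.1, v.2 - 1) else (v.1, v.2 + 1)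
  else if numUp N R 2 = 1 ∧ v = (2, 1) ∧ inRow R 2 = 1 then (2, 2)
  else v

/-- All robots move to their targets. If two targets coincide, then the upward moves, and the side
moves that make room for an upward move, are skipped in this cycle. -/
def balanceRows : Algorithm := fun M N R v =>
  if (∃ a ∈ R, ∃ b ∈ R, a ≠ b ∧ balanceTarget M N R a = balanceTarget M N R b) ∧
      (v ∈ upSet M N R v.1 ∨ AlignedUp M N R v) then v
  else balanceTarget M N R v

/-! ### Row-wise placement and final guard move -/

/-- In each row the rightmost robot moves towards the rightmost target and the leftmost one towards
the leftmost target; the guard stays. -/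
def placeInRows : Algorithm := fun _ N R v =>
  let cols := ((target R.card N).filter fun u => u.1 = v.1).image Prod.snd
  let c := if ∀ u ∈ R, u.1 = v.1 → u.2 ≤ v.2 then cols.max.unbotD v.2 else cols.min.untopD v.2
  if v = (1, (N : ℤ)) then v else (v.1, v.2 + Int.sign (c - v.2))

/-- The guard moves to its target, next to the corner in the first row. -/
def moveGuard : Algorithm := fun _ N _ v =>
  if v = (1, (N : ℤ)) then (1, (N : ℤ) - 1) else v

/-- All robots except the guard are on their targets. -/
abbrev AllButGuardPlaced (N : ℕ) (R : Finset Cell) : Prop :=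
  R.erase (1, (N : ℤ)) = (target R.card N).erase (1, (N : ℤ) - 1)

/-- No row has an excess of robots. -/
abbrev RowsBalanced (M N : ℕ) (R : Finset Cell) : Prop :=
  ∀ l ∈ Finset.Icc 1 (M : ℤ), excessAbove N R l = 0 ∧ excessBelow N R l = 0

/-- The tasks that are performed when the guard is on the upper right corner. -/
def guardedMove : Algorithm := fun M N R v =>
  if AllButGuardPlaced N R then moveGuard M N R v
  else if RowsBalanced M N R then placeInRows M N R v
  else balanceRows M N R v

/-- The turn that brings the only robot on a corner to the upper right. -/
def guardFrame (M N : ℕ) (R : Finset Cell) : Fin 4 :=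
  if (1, (N : ℤ)) ∈ R then 0 else if (1, 1) ∈ R then 1 else if ((M : ℤ), 1) ∈ R then 2 else 3

/-- The algorithm for asymmetric configurations. -/
def algoAsym : Algorithm := fun M N R v =>
  if PatternFormed M N R then v
  else if (occupiedCorners M N R).card = 1 then inFrame M N (guardFrame M N R) guardedMove R v
  else if 1 < (occupiedCorners M N R).card then clearCorners M N R v
  else if ∃ u ∈ R, OnSide M N u then moveToCorner M N R v
  else moveToSide M N R v

end GridRobots

end

open GridRobots

/-!
The local coordinate systems do not matter. Every rule commutes with the rotations of the grid, the
only delicate ingredient being the view: for an asymmetric configuration, two orientations with the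
same string would differ by a symmetry, so all robots select the same robot (`minView_rotate`). Once
a robot is singled out by distances alone or is the only one on a corner, asymmetry is no longer
needed.

*Guard placement* (`guard_placement`). If several corners are occupied, one cycle leaves exactly one
of them occupied: the four special paths are disjoint and the robots of a special subpath follow
each other, so nobody collides. Two special paths can be full only in the `4 × 4` grid, which is
settled by evaluation. If no corner is occupied, a single robot walks. Away from the sides it has
the largest sum of distances to the others, and some step increases this sum by `2`, since otherwise
the robot would be a median of the others in both coordinates (`exists_growth`). Then it is the only
farthest robot afterwards, and by convexity of the sum its direction is the only best one, so it
walks straight to a side and from there along the side to a corner. The time is the distance that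
this robot covers.

*From the guard to the pattern* (`Guarded.reachIn_target`). In the frame with the guard on the upper
right, everything is deterministic. Row balancing is governed by the signed `surplus` in the rows
above each line of the grid. The lines with surplus at most `0` grow from the top by one per
cycle (`surplus_nonpos_step`), until no robot moves down. From then on the lines with surplus
`0` grow from the bottom (`surplus_zero_step`), except in cycles where two targets coincide. This
happens at most once, for a robot below the upper left corner, because afterwards the robot has
made room (`Unstuck.of_conflict`). With balanced rows, every robot walks within its row to its
target, the order in the rows being kept; the guard comes last. No pattern is formed too early,
because the pattern leaves the corners of its bounding rectangle free.

*The pattern solves the problem* (`solvesGMVArea_of_patternFormed`). The antidiagonal of the pattern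
is free, and two robots are joined by a monotone path that leaves towards it and follows it. The
area is minimal, because mutual visibility allows at most two robots per row and per column.

*Time.* The guard ends next to a target, so all distances are bounded by the side of the square
around the initial and the final configuration. For the lower bound (`exists_slow_placement`), the
robots start in three rows and one pair is as far apart as the grid allows: the pair has to come
together, and the robots have to spread over as many rows as the pattern has.
-/

namespace GridRobots

/-! ### Rotations of the grid -/

theorem mem_cells {M N : ℕ} {v : Cell} :
    v ∈ cells M N ↔ (1 ≤ v.1 ∧ v.1 ≤ M) ∧ 1 ≤ v.2 ∧ v.2 ≤ N := by
  simp [cells]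

theorem cellDist_comm (u v : Cell) : cellDist u v = cellDist v u := by
  simp only [cellDist, abs_sub_comm]

theorem cellDist_triangle (u v w : Cell) : cellDist u w ≤ cellDist u v + cellDist v w := by
  have h1 := abs_sub_le u.1 v.1 w.1
  have h2 := abs_sub_le u.2 v.2 w.2
  unfold cellDist; linarith

@[simp] theorem cellDist_self (u : Cell) : cellDist u u = 0 := by simp [cellDist]

@[simp] theorem rotCell_zero (M N : ℕ) (v : Cell) : rotCell M N 0 v = v := rfl

@[simp] theorem rotRows_zero (M N : ℕ) : rotRows M N 0 = M := rfl

@[simp] theorem rotCols_zero (M N : ℕ) : rotCols M N 0 = N := rfl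

theorem rotCell_rotCell (M N : ℕ) (q r : Fin 4) (v : Cell) :
    rotCell (rotRows M N q) (rotCols M N q) r (rotCell M N q v) = rotCell M N (q + r) v := by
  fin_cases q <;> fin_cases r <;> simp [rotCell, rotRows, rotCols]

theorem rotRows_rotRows (M N : ℕ) (q r : Fin 4) :
    rotRows (rotRows M N q) (rotCols M N q) r = rotRows M N (q + r) := by
  fin_cases q <;> fin_cases r <;> simp [rotRows, rotCols]

theorem rotCols_rotCols (M N : ℕ) (q r : Fin 4) :
    rotCols (rotRows M N q) (rotCols M N q) r = rotCols M N (q + r) := by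
  fin_cases q <;> fin_cases r <;> simp [rotRows, rotCols]

@[simp] theorem rotCell_neg_rotCell (M N : ℕ) (q : Fin 4) (v : Cell) :
    rotCell (rotRows M N q) (rotCols M N q) (-q) (rotCell M N q v) = v := by
  rw [rotCell_rotCell]; simp

@[simp] theorem rotCell_rotCell_neg (M N : ℕ) (q : Fin 4) (v : Cell) :
    rotCell M N q (rotCell (rotRows M N q) (rotCols M N q) (-q) v) = v := by
  have h := rotCell_rotCell (rotRows M N q) (rotCols M N q) (-q) q v
  rw [rotRows_rotRows, rotCols_rotCols] at h
  simpa using h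

theorem rotCell_injective (M N : ℕ) (q : Fin 4) : Function.Injective (rotCell M N q) :=
  Function.LeftInverse.injective (rotCell_neg_rotCell M N q)

theorem rotCell_inj {M N : ℕ} {q : Fin 4} {u v : Cell} :
    rotCell M N q u = rotCell M N q v ↔ u = v := (rotCell_injective M N q).eq_iff

theorem rotate_rotate (M N : ℕ) (q r : Fin 4) (R : Finset Cell) :
    rotate (rotRows M N q) (rotCols M N q) r (rotate M N q R) = rotate M N (q + r) R := by
  simp only [rotate, Finset.image_image]
  exact Finset.image_congr fun v _ => rotCell_rotCell M N q r v

@[simp] theorem rotate_zero (M N : ℕ) (R : Finset Cell) : rotate M N 0 R = R := by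
  ext v; simp [rotate]

@[simp] theorem card_rotate (M N : ℕ) (q : Fin 4) (R : Finset Cell) :
    (rotate M N q R).card = R.card :=
  Finset.card_image_of_injective _ (rotCell_injective M N q)

@[simp] theorem rotCell_mem_rotate {M N : ℕ} {q : Fin 4} {v : Cell} {R : Finset Cell} :
    rotCell M N q v ∈ rotate M N q R ↔ v ∈ R :=
  (rotCell_injective M N q).mem_finset_image

theorem mem_rotate {M N : ℕ} {q : Fin 4} {v : Cell} {R : Finset Cell} :
    v ∈ rotate M N q R ↔ rotCell (rotRows M N q) (rotCols M N q) (-q) v ∈ R := by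
  conv_lhs => rw [← rotCell_rotCell_neg M N q v]
  exact rotCell_mem_rotate

theorem rotate_injective (M N : ℕ) (q : Fin 4) : Function.Injective (rotate M N q) :=
  Finset.image_injective (rotCell_injective M N q)

theorem forall_mem_rotate {M N : ℕ} {q : Fin 4} {R : Finset Cell} {P : Cell → Prop} :
    (∀ s ∈ rotate M N q R, P s) ↔ ∀ s ∈ R, P (rotCell M N q s) :=
  Finset.forall_mem_image

theorem exists_mem_rotate {M N : ℕ} {q : Fin 4} {R : Finset Cell} {P : Cell → Prop} :
    (∃ s ∈ rotate M N q R, P s) ↔ ∃ s ∈ R, P (rotCell M N q s) :=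
  Finset.exists_mem_image

theorem rotate_filter (M N : ℕ) (q : Fin 4) (R : Finset Cell) {P P' : Cell → Prop}
    [DecidablePred P] [DecidablePred P'] (h : ∀ v ∈ R, (P' (rotCell M N q v) ↔ P v)) :
    rotate M N q (R.filter P) = (rotate M N q R).filter P' := by
  ext v
  rw [← rotCell_rotCell_neg M N q v]
  simp only [rotCell_mem_rotate, Finset.mem_filter]
  exact and_congr_right fun hv => (h _ hv).symm

theorem rotate_erase (M N : ℕ) (q : Fin 4) (R : Finset Cell) (v : Cell) :
    rotate M N q (R.erase v) = (rotate M N q R).erase (rotCell M N q v) :=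
  Finset.image_erase (rotCell_injective M N q) R v

theorem rotate_union (M N : ℕ) (q : Fin 4) (R S : Finset Cell) :
    rotate M N q (R ∪ S) = rotate M N q R ∪ rotate M N q S := Finset.image_union _ _

@[simp] theorem rotCell_mem_cells {M N : ℕ} {q : Fin 4} {v : Cell} :
    rotCell M N q v ∈ cells (rotRows M N q) (rotCols M N q) ↔ v ∈ cells M N := by
  fin_cases q <;> simp only [mem_cells] <;> simp [rotCell, rotRows, rotCols] <;> omega

theorem rotate_subset_cells {M N : ℕ} {q : Fin 4} {R : Finset Cell} :
    rotate M N q R ⊆ cells (rotRows M N q) (rotCols M N q) ↔ R ⊆ cells M N := by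
  constructor
  · intro h v hv
    exact rotCell_mem_cells.1 (h (rotCell_mem_rotate (q := q).2 hv))
  · intro h v hv
    obtain ⟨w, hw, rfl⟩ := Finset.mem_image.1 hv
    exact rotCell_mem_cells.2 (h hw)

@[simp] theorem cellDist_rotCell (M N : ℕ) (q : Fin 4) (u v : Cell) :
    cellDist (rotCell M N q u) (rotCell M N q v) = cellDist u v := by
  fin_cases q <;> simp [cellDist, rotCell] <;>
    simp only [abs_sub_comm, add_comm]

theorem gridGraph_adj_rotCell {M N : ℕ} {q : Fin 4} {u v : Cell} :
    (gridGraph (rotRows M N q) (rotCols M N q)).Adj (rotCell M N q u) (rotCell M N q v) ↔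
      (gridGraph M N).Adj u v := by
  simp [gridGraph]

theorem rotCell_inFrame (M N : ℕ) (q : Fin 4) (A : Algorithm) (R : Finset Cell) (v : Cell) :
    rotCell M N q (inFrame M N q A R v) =
      A (rotRows M N q) (rotCols M N q) (rotate M N q R) (rotCell M N q v) := by
  simp [inFrame]

theorem rotCell_neg_inFrame (M N : ℕ) (q r : Fin 4) (A : Algorithm) (R : Finset Cell) (v : Cell) :
    rotCell (rotRows M N q) (rotCols M N q) (-q)
        (inFrame (rotRows M N q) (rotCols M N q) r A (rotate M N q R) (rotCell M N q v)) =
      inFrame M N (q + r) A R v := by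
  apply rotCell_injective M N (q + r)
  rw [rotCell_inFrame, ← rotCell_rotCell, rotCell_rotCell_neg, rotCell_inFrame]
  simp only [rotRows_rotRows, rotCols_rotCols, rotate_rotate, rotCell_rotCell]

theorem rotRows_le {a M N : ℕ} (q : Fin 4) (hM : a ≤ M) (hN : a ≤ N) : a ≤ rotRows M N q := by
  unfold rotRows; split_ifs <;> assumption

theorem rotCols_le {a M N : ℕ} (q : Fin 4) (hM : a ≤ M) (hN : a ≤ N) : a ≤ rotCols M N q := by
  unfold rotCols; split_ifs <;> assumption

theorem rotCell_mem_corners {M N : ℕ} {q : Fin 4} {v : Cell} :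
    rotCell M N q v ∈ corners (rotRows M N q) (rotCols M N q) ↔ v ∈ corners M N := by
  obtain ⟨a, b⟩ := v
  fin_cases q <;> simp [corners, rotCell, rotRows, rotCols] <;> omega

theorem rotate_corners (M N : ℕ) (q : Fin 4) :
    rotate M N q (corners M N) = corners (rotRows M N q) (rotCols M N q) := by
  ext v
  rw [← rotCell_rotCell_neg M N q v, rotCell_mem_rotate, rotCell_mem_corners]

theorem occupiedCorners_rotate (M N : ℕ) (q : Fin 4) (R : Finset Cell) :
    occupiedCorners (rotRows M N q) (rotCols M N q) (rotate M N q R) =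
      rotate M N q (occupiedCorners M N R) := by
  rw [occupiedCorners, occupiedCorners, ← rotate_corners]
  exact (rotate_filter M N q _ fun v _ => rotCell_mem_rotate).symm

theorem onSide_rotCell {M N : ℕ} {q : Fin 4} {v : Cell} :
    OnSide (rotRows M N q) (rotCols M N q) (rotCell M N q v) ↔ OnSide M N v := by
  obtain ⟨a, b⟩ := v
  fin_cases q <;> simp [OnSide, rotCell, rotRows, rotCols] <;> omega

theorem cornerDist_rotCell (M N : ℕ) (q : Fin 4) (v : Cell) :
    cornerDist (rotRows M N q) (rotCols M N q) (rotCell M N q v) = cornerDist M N v := by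
  obtain ⟨a, b⟩ := v
  fin_cases q <;> simp [cornerDist, rotCell, rotRows, rotCols] <;> omega

theorem sumDist_rotate (M N : ℕ) (q : Fin 4) (R : Finset Cell) (v : Cell) :
    sumDist (rotate M N q R) (rotCell M N q v) = sumDist R v := by
  unfold sumDist rotate
  rw [Finset.sum_image fun a _ b _ h => rotCell_injective M N q h]
  simp

theorem asymmetric_rotate {M N : ℕ} {R : Finset Cell} (h : Asymmetric M N R) (q : Fin 4) :
    Asymmetric (rotRows M N q) (rotCols M N q) (rotate M N q R) := by
  rintro r hr ⟨h1, h2, h3⟩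
  rw [rotRows_rotRows] at h1
  rw [rotCols_rotCols] at h2
  rw [rotate_rotate, add_comm] at h3
  apply h r hr
  have key : rotRows M N r = M ∧ rotCols M N r = N := by
    revert h1 h2 hr
    clear h3 h
    fin_cases q <;> fin_cases r <;> simp [rotRows, rotCols] <;> omega
  refine ⟨key.1, key.2, ?_⟩
  have h4 := rotate_rotate M N r q R
  rw [key.1, key.2] at h4
  exact rotate_injective M N q (h4.trans h3)

theorem asymmetric_of_card_occupiedCorners {M N : ℕ} {R : Finset Cell} (hM : 2 ≤ M)
    (h : (occupiedCorners M N R).card = 1) : Asymmetric M N R := by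
  obtain ⟨c, hc⟩ := Finset.card_eq_one.1 h
  rintro q hq ⟨h1, h2, h3⟩
  have h4 := occupiedCorners_rotate M N q R
  rw [h1, h2, h3, hc] at h4
  have hcc : c ∈ corners M N :=
    (Finset.mem_filter.1 (show c ∈ occupiedCorners M N R by rw [hc]; simp)).1
  have h5 : rotCell M N q c = c := by
    have : rotCell M N q c ∈ rotate M N q {c} := by simp
    rw [← h4] at this
    simpa using this
  obtain ⟨a, b⟩ := c
  revert h5 hcc hq h1 h2
  clear h3 h4 h hc
  fin_cases q <;> simp [corners, rotCell, rotRows, rotCols] <;> omega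

/-! ### Bounding rectangles -/

theorem abs_row_le_rowSpan {R : Finset Cell} {u v : Cell} (hu : u ∈ R) (hv : v ∈ R) :
    |u.1 - v.1| ≤ rowSpan R := by
  have h1 : (u.1 - v.1).natAbs ≤ R.sup fun v => (u.1 - v.1).natAbs :=
    Finset.le_sup (f := fun v : Cell => (u.1 - v.1).natAbs) hv
  have h2 : (R.sup fun v => (u.1 - v.1).natAbs) ≤ rowSpan R :=
    Finset.le_sup (f := fun u : Cell => R.sup fun v => (u.1 - v.1).natAbs) hu
  rw [Int.abs_eq_natAbs]
  omega

theorem abs_col_le_colSpan {R : Finset Cell} {u v : Cell} (hu : u ∈ R) (hv : v ∈ R) :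
    |u.2 - v.2| ≤ colSpan R := by
  have h1 : (u.2 - v.2).natAbs ≤ R.sup fun v => (u.2 - v.2).natAbs :=
    Finset.le_sup (f := fun v : Cell => (u.2 - v.2).natAbs) hv
  have h2 : (R.sup fun v => (u.2 - v.2).natAbs) ≤ colSpan R :=
    Finset.le_sup (f := fun u : Cell => R.sup fun v => (u.2 - v.2).natAbs) hu
  rw [Int.abs_eq_natAbs]
  omega

theorem rowSpan_le_iff {R : Finset Cell} {a : ℕ} :
    rowSpan R ≤ a ↔ ∀ u ∈ R, ∀ v ∈ R, u.1 - v.1 ≤ a := by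
  simp only [rowSpan, Finset.sup_le_iff]
  constructor
  · intro h u hu v hv
    have := h u hu v hv
    omega
  · intro h u hu v hv
    have := h u hu v hv
    have := h v hv u hu
    omega

theorem colSpan_le_iff {R : Finset Cell} {a : ℕ} :
    colSpan R ≤ a ↔ ∀ u ∈ R, ∀ v ∈ R, u.2 - v.2 ≤ a := by
  simp only [colSpan, Finset.sup_le_iff]
  constructor
  · intro h u hu v hv
    have := h u hu v hv
    omega
  · intro h u hu v hv
    have := h u hu v hv
    have := h v hv u hu
    omega

theorem exists_rowSpan {R : Finset Cell} (h : R.Nonempty) :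
    ∃ u ∈ R, ∃ v ∈ R, u.1 - v.1 = rowSpan R := by
  obtain ⟨u, hu, hu'⟩ := Finset.exists_max_image R Prod.fst h
  obtain ⟨v, hv, hv'⟩ := Finset.exists_min_image R Prod.fst h
  refine ⟨u, hu, v, hv, le_antisymm ((le_abs_self _).trans (abs_row_le_rowSpan hu hv)) ?_⟩
  have := hu' v hv
  have h1 : rowSpan R ≤ (u.1 - v.1).toNat := rowSpan_le_iff.2 fun a ha b hb => by
    have := hu' a ha
    have := hv' b hb
    omega
  omega

theorem exists_colSpan {R : Finset Cell} (h : R.Nonempty) :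
    ∃ u ∈ R, ∃ v ∈ R, u.2 - v.2 = colSpan R := by
  obtain ⟨u, hu, hu'⟩ := Finset.exists_max_image R Prod.snd h
  obtain ⟨v, hv, hv'⟩ := Finset.exists_min_image R Prod.snd h
  refine ⟨u, hu, v, hv, le_antisymm ((le_abs_self _).trans (abs_col_le_colSpan hu hv)) ?_⟩
  have := hu' v hv
  have h1 : colSpan R ≤ (u.2 - v.2).toNat := colSpan_le_iff.2 fun a ha b hb => by
    have := hu' a ha
    have := hv' b hb
    omega
  omega

theorem minRow_spec {R : Finset Cell} (h : R.Nonempty) :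
    (∃ v ∈ R, v.1 = minRow R) ∧ ∀ v ∈ R, minRow R ≤ v.1 := by
  have h' : (R.image Prod.fst).Nonempty := h.image _
  have e : minRow R = (R.image Prod.fst).min' h' := by
    rw [minRow, ← Finset.coe_min' h']; rfl
  rw [e]
  constructor
  · obtain ⟨v, hv, hv'⟩ := Finset.mem_image.1 (Finset.min'_mem _ h')
    exact ⟨v, hv, hv'⟩
  · exact fun v hv => Finset.min'_le _ _ (Finset.mem_image_of_mem _ hv)

theorem minCol_spec {R : Finset Cell} (h : R.Nonempty) :
    (∃ v ∈ R, v.2 = minCol R) ∧ ∀ v ∈ R, minCol R ≤ v.2 := by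
  have h' : (R.image Prod.snd).Nonempty := h.image _
  have e : minCol R = (R.image Prod.snd).min' h' := by
    rw [minCol, ← Finset.coe_min' h']; rfl
  rw [e]
  constructor
  · obtain ⟨v, hv, hv'⟩ := Finset.mem_image.1 (Finset.min'_mem _ h')
    exact ⟨v, hv, hv'⟩
  · exact fun v hv => Finset.min'_le _ _ (Finset.mem_image_of_mem _ hv)

theorem minRow_eq {R : Finset Cell} {a : ℤ} (h : ∃ v ∈ R, v.1 = a) (h' : ∀ v ∈ R, a ≤ v.1) :
    minRow R = a := by
  obtain ⟨v, hv, rfl⟩ := h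
  obtain ⟨⟨w, hw, hw'⟩, h2⟩ := minRow_spec ⟨v, hv⟩
  exact le_antisymm (h2 v hv) (hw' ▸ h' w hw)

theorem minCol_eq {R : Finset Cell} {a : ℤ} (h : ∃ v ∈ R, v.2 = a) (h' : ∀ v ∈ R, a ≤ v.2) :
    minCol R = a := by
  obtain ⟨v, hv, rfl⟩ := h
  obtain ⟨⟨w, hw, hw'⟩, h2⟩ := minCol_spec ⟨v, hv⟩
  exact le_antisymm (h2 v hv) (hw' ▸ h' w hw)

theorem spans_rotate (M N : ℕ) (q : Fin 4) (R : Finset Cell) :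
    (rowSpan (rotate M N q R) = rowSpan R ∧ colSpan (rotate M N q R) = colSpan R) ∨
      (rowSpan (rotate M N q R) = colSpan R ∧ colSpan (rotate M N q R) = rowSpan R) := by
  have e : ∀ a b : ℕ, (∀ c, a ≤ c ↔ b ≤ c) → a = b := fun a b h =>
    le_antisymm ((h b).2 le_rfl) ((h a).1 le_rfl)
  have h : ∀ c : ℕ, ∀ d : ℤ, ∀ f : Cell → ℤ, (∀ u ∈ R, ∀ v ∈ R, (d - f u) - (d - f v) ≤ c) ↔
      ∀ u ∈ R, ∀ v ∈ R, f u - f v ≤ c := fun c d f =>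
    ⟨fun h u hu v hv => by have := h v hv u hu; omega,
      fun h u hu v hv => by have := h v hv u hu; omega⟩
  fin_cases q
  · left; simp
  · right
    constructor <;> refine e _ _ fun c => ?_ <;>
      simp only [rowSpan_le_iff, colSpan_le_iff, forall_mem_rotate]
    · exact Iff.rfl
    · exact h c _ Prod.fst
  · left
    constructor <;> refine e _ _ fun c => ?_ <;>
      simp only [rowSpan_le_iff, colSpan_le_iff, forall_mem_rotate]
    · exact h c _ Prod.fst
    · exact h c _ Prod.snd
  · right
    constructor <;> refine e _ _ fun c => ?_ <;>
      simp only [rowSpan_le_iff, colSpan_le_iff, forall_mem_rotate]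
    · exact h c _ Prod.snd
    · exact Iff.rfl

theorem squareSide_rotate (M N : ℕ) (q : Fin 4) (R S : Finset Cell) :
    squareSide (rotate M N q R) (rotate M N q S) = squareSide R S := by
  unfold squareSide
  rw [← rotate_union]
  rcases spans_rotate M N q (R ∪ S) with ⟨h1, h2⟩ | ⟨h1, h2⟩ <;> rw [h1, h2]
  exact max_comm _ _

theorem abs_le_squareSide {R S : Finset Cell} {u v : Cell} (hu : u ∈ R ∪ S) (hv : v ∈ R ∪ S) :
    |u.1 - v.1| ≤ squareSide R S ∧ |u.2 - v.2| ≤ squareSide R S := by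
  have h1 := abs_row_le_rowSpan hu hv
  have h2 := abs_col_le_colSpan hu hv
  unfold squareSide
  omega

/-! ### The view of the robots -/

theorem eq_of_flatMap_eq {α β : Type*} {f g : α → List β} :
    ∀ {l : List α}, (∀ x ∈ l, (f x).length = (g x).length) → l.flatMap f = l.flatMap g →
      ∀ x ∈ l, f x = g x
  | [], _, _, _, hx => by simp at hx
  | a :: l, hl, h, x, hx => by
    rw [List.flatMap_cons, List.flatMap_cons] at h
    obtain ⟨h1, h2⟩ := List.append_inj h (hl a (by simp))
    rcases List.mem_cons.1 hx with rfl | hx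
    · exact h1
    · exact eq_of_flatMap_eq (fun y hy => hl y (List.mem_cons_of_mem _ hy)) h2 x hx

theorem eq_of_mbrString_eq {R S : Finset Cell} (hR : R.Nonempty) (hS : S.Nonempty)
    (h1 : rowSpan R = rowSpan S) (h2 : colSpan R = colSpan S) (h3 : minRow R = minRow S)
    (h4 : minCol R = minCol S) (h : mbrString R = mbrString S) : R = S := by
  have key : ∀ a ∈ List.range (rowSpan R + 1), ∀ b ∈ List.range (colSpan R + 1),
      ((minRow R + (a : ℤ), minCol R + (b : ℤ)) ∈ R ↔
        (minRow R + (a : ℤ), minCol R + (b : ℤ)) ∈ S) := by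
    intro a ha b hb
    unfold mbrString at h
    rw [← h1, ← h2, ← h3, ← h4] at h
    have h5 := eq_of_flatMap_eq (by simp) h (a : ℤ) (by simpa using ha)
    have h6 := List.map_inj_left.1 h5 (b : ℤ) (by simpa using hb)
    split_ifs at h6 with h7 h8 h8
    · simp [h7, h8]
    · simp at h6
    · simp at h6
    · simp [h7, h8]
  have key' : ∀ v : Cell, minRow R ≤ v.1 → v.1 ≤ minRow R + rowSpan R → minCol R ≤ v.2 →
      v.2 ≤ minCol R + colSpan R → (v ∈ R ↔ v ∈ S) := by
    intro v ha hb hc hd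
    have := key (v.1 - minRow R).toNat (by rw [List.mem_range]; omega)
      (v.2 - minCol R).toNat (by rw [List.mem_range]; omega)
    have e : ((minRow R + ((v.1 - minRow R).toNat : ℤ), minCol R + ((v.2 - minCol R).toNat : ℤ)) :
        Cell) = v := by
      ext
      · simp only []; omega
      · simp only []; omega
    rwa [e] at this
  have bounds : ∀ {T : Finset Cell}, T.Nonempty → ∀ v ∈ T, minRow T ≤ v.1 ∧
      v.1 ≤ minRow T + rowSpan T ∧ minCol T ≤ v.2 ∧ v.2 ≤ minCol T + colSpan T := by
    intro T hT v hv
    obtain ⟨⟨u, hu, hu'⟩, h5⟩ := minRow_spec hT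
    obtain ⟨⟨w, hw, hw'⟩, h6⟩ := minCol_spec hT
    have h7 := (le_abs_self _).trans (abs_row_le_rowSpan hv hu)
    have h8 := (le_abs_self _).trans (abs_col_le_colSpan hv hw)
    exact ⟨h5 v hv, by omega, h6 v hv, by omega⟩
  ext v
  constructor
  · intro hv
    obtain ⟨a, b, c, d⟩ := bounds hR v hv
    exact (key' v a b c d).1 hv
  · intro hv
    obtain ⟨a, b, c, d⟩ := bounds hS v hv
    exact (key' v (by omega) (by omega) (by omega) (by omega)).2 hv

/-- The orientations that are compared for the view. -/
def viewCandidates (M N : ℕ) (R : Finset Cell) : List (Fin 4) :=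
  (List.finRange 4).filter fun q => colSpan (rotate M N q R) ≤ rowSpan (rotate M N q R)

theorem mem_viewCandidates {M N : ℕ} {R : Finset Cell} {q : Fin 4} :
    q ∈ viewCandidates M N R ↔ colSpan (rotate M N q R) ≤ rowSpan (rotate M N q R) := by
  simp [viewCandidates]

theorem viewFrame_spec (M N : ℕ) (R : Finset Cell) :
    viewFrame M N R ∈ viewCandidates M N R ∧
      ∀ q ∈ viewCandidates M N R, viewKey M N R (viewFrame M N R) ≤ viewKey M N R q := by
  have hne : viewCandidates M N R ≠ [] := by
    intro h
    have h0 : (0 : Fin 4) ∉ viewCandidates M N R := by simp [h]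
    have h1 : (1 : Fin 4) ∉ viewCandidates M N R := by simp [h]
    rw [mem_viewCandidates, rotate_zero] at h0
    rw [mem_viewCandidates] at h1
    have ha : rowSpan (rotate M N 1 R) = colSpan R := by
      apply le_antisymm <;> simp only [rowSpan_le_iff, colSpan_le_iff, forall_mem_rotate] <;>
        intro u hu v hv
      · exact (le_abs_self _).trans (abs_col_le_colSpan hu hv)
      · exact (le_abs_self _).trans (abs_row_le_rowSpan
          (rotCell_mem_rotate (M := M) (N := N) (q := 1).2 hu)
          (rotCell_mem_rotate (M := M) (N := N) (q := 1).2 hv))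
    rcases spans_rotate M N 1 R with ⟨h2, h3⟩ | ⟨h2, h3⟩ <;> omega
  obtain ⟨m, hm⟩ := Option.ne_none_iff_exists'.1
    (fun h => hne (List.argmin_eq_none.1 h) : (viewCandidates M N R).argmin (viewKey M N R) ≠ none)
  have e : viewFrame M N R = m := by
    unfold viewFrame
    rw [show List.argmin (viewKey M N R) ((List.finRange 4).filter fun q =>
      colSpan (rotate M N q R) ≤ rowSpan (rotate M N q R)) = some m from hm]
    rfl
  rw [e]
  exact ⟨List.argmin_mem hm, fun q hq => not_lt.1 (List.not_lt_of_mem_argmin hq hm)⟩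

theorem viewKey_rotate (M N : ℕ) (q r : Fin 4) (R : Finset Cell) :
    viewKey (rotRows M N q) (rotCols M N q) (rotate M N q R) r = viewKey M N R (q + r) := by
  simp only [viewKey, rotate_rotate, rotRows_rotRows]

/-- Two orientations with the same key differ by a symmetry of the configuration. -/
theorem viewKey_injective {M N : ℕ} {R : Finset Cell} (hR : R.Nonempty) (hA : Asymmetric M N R)
    {q r : Fin 4} (hq : q ∈ viewCandidates M N R) (hr : r ∈ viewCandidates M N R)
    (h : viewKey M N R q = viewKey M N R r) : q = r := by
  rw [mem_viewCandidates] at hq hr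
  obtain ⟨h1, h2⟩ := List.append_inj' h (by simp)
  simp only [List.cons.injEq, and_true, Nat.cast_inj] at h2
  obtain ⟨h2, h3, h4⟩ := h2
  have hs : rowSpan (rotate M N q R) = rowSpan (rotate M N r R) ∧
      colSpan (rotate M N q R) = colSpan (rotate M N r R) := by
    rcases spans_rotate M N q R with ⟨h5, h6⟩ | ⟨h5, h6⟩ <;>
    rcases spans_rotate M N r R with ⟨h7, h8⟩ | ⟨h7, h8⟩ <;> omega
  have h5 := eq_of_mbrString_eq (hR.image _) (hR.image _) hs.1 hs.2 h2 h3 h1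
  by_contra hne
  have hB := asymmetric_rotate hA q
  refine hB (r - q) (by rwa [Ne, sub_eq_zero, eq_comm]) ⟨?_, ?_, ?_⟩
  · rw [rotRows_rotRows, add_sub_cancel, h4]
  · rw [rotCols_rotCols, add_sub_cancel]
    revert h4
    clear h h1 h2 h3 hs h5 hB hA hq hr hne
    fin_cases q <;> fin_cases r <;> simp [rotRows, rotCols]
  · rw [rotate_rotate, add_sub_cancel]
    exact h5.symm

theorem viewFrame_rotate {M N : ℕ} {R : Finset Cell} (hR : R.Nonempty) (hA : Asymmetric M N R)
    (q : Fin 4) :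
    q + viewFrame (rotRows M N q) (rotCols M N q) (rotate M N q R) = viewFrame M N R := by
  have hc : ∀ r, r ∈ viewCandidates (rotRows M N q) (rotCols M N q) (rotate M N q R) ↔
      q + r ∈ viewCandidates M N R := by
    intro r
    simp only [mem_viewCandidates, rotate_rotate]
  obtain ⟨h1, h2⟩ := viewFrame_spec (rotRows M N q) (rotCols M N q) (rotate M N q R)
  obtain ⟨h3, h4⟩ := viewFrame_spec M N R
  rw [hc] at h1
  refine viewKey_injective hR hA h1 h3 (le_antisymm ?_ (h4 _ h1))
  have := h2 (viewFrame M N R - q) ((hc _).2 (by simpa using h3))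
  rw [viewKey_rotate, viewKey_rotate] at this
  simpa using this

theorem viewPos_injective (M N : ℕ) (R : Finset Cell) : Function.Injective (viewPos M N R) :=
  fun _ _ h => rotCell_injective M N _ (toLex.injective h)

theorem minView_singleton (M N : ℕ) (R : Finset Cell) (v : Cell) : minView M N R {v} = {v} := by
  ext w
  simp only [minView, Finset.mem_filter, Finset.mem_singleton, forall_eq, and_iff_left_iff_imp]
  rintro rfl
  exact le_rfl

theorem exists_minView_eq (M N : ℕ) (R : Finset Cell) {S : Finset Cell} (hS : S.Nonempty) :
    ∃ g ∈ S, minView M N R S = {g} := by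
  obtain ⟨g, hg, hg'⟩ := Finset.exists_min_image S (viewPos M N R) hS
  refine ⟨g, hg, ?_⟩
  ext w
  simp only [minView, Finset.mem_filter, Finset.mem_singleton]
  constructor
  · rintro ⟨hw, h⟩
    exact viewPos_injective M N R (le_antisymm (h g hg) (hg' w hw))
  · rintro rfl
    exact ⟨hg, hg'⟩

/-- All robots agree on the robot of minimum view, whatever their coordinate systems, if the
configuration is asymmetric or if there is nothing to choose. -/
theorem minView_rotate {M N : ℕ} {R S : Finset Cell} (hR : R.Nonempty)
    (h : Asymmetric M N R ∨ ∃ g, S = {g}) (q : Fin 4) :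
    minView (rotRows M N q) (rotCols M N q) (rotate M N q R) (rotate M N q S) =
      rotate M N q (minView M N R S) := by
  rcases h with hA | ⟨g, rfl⟩
  · have hv : ∀ v, viewPos (rotRows M N q) (rotCols M N q) (rotate M N q R) (rotCell M N q v) =
        viewPos M N R v := by
      intro v
      rw [viewPos, rotCell_rotCell, viewFrame_rotate hR hA, viewPos]
    refine (rotate_filter M N q S fun v _ => ?_).symm
    rw [forall_mem_rotate]
    simp only [hv]
  · have e : ∀ w, rotate M N q {w} = {rotCell M N q w} := fun w => Finset.image_singleton _ _
    rw [minView_singleton, e, minView_singleton]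

/-! ### Shortest paths without obstacles -/

/-- There is a shortest path from `u` to `v` whose inner vertices are not in `R`. Each step
decreases the distance to `v`, so the path stays in the rectangle spanned by `u` and `v` and hence
in every grid that contains both. -/
inductive ClearPath (R : Finset Cell) : Cell → Cell → Prop
  | refl (u : Cell) : ClearPath R u u
  | step {u w v : Cell} : cellDist u w = 1 → cellDist w v + 1 = cellDist u v →
      (w ∈ R → w = v) → ClearPath R w v → ClearPath R u v

theorem eq_of_cellDist_eq_zero {u v : Cell} (h : cellDist u v = 0) : u = v := by
  unfold cellDist at h
  have h1 := abs_nonneg (u.1 - v.1)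
  have h2 := abs_nonneg (u.2 - v.2)
  have h3 : |u.1 - v.1| = 0 := by omega
  have h4 : |u.2 - v.2| = 0 := by omega
  rw [abs_eq_zero, sub_eq_zero] at h3 h4
  exact Prod.ext h3 h4

namespace ClearPath

variable {R S : Finset Cell} {u v w : Cell}

theorem mono (h : S ⊆ R) (p : ClearPath R u v) : ClearPath S u v := by
  induction p with
  | refl u => exact refl u
  | step h1 h2 h3 _ ih => exact step h1 h2 (fun hw => h3 (h hw)) ih

theorem trans (p : ClearPath R u w) (p' : ClearPath R w v)
    (hd : cellDist u w + cellDist w v = cellDist u v) (hw : w ∈ R → w = v) :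
    ClearPath R u v := by
  induction p with
  | refl u => exact p'
  | @step u x w h1 h2 h3 _ ih =>
    have h4 := cellDist_triangle x w v
    have h5 := cellDist_triangle u x v
    exact step h1 (by omega) (fun hx => by
      have := h3 hx
      subst this
      exact hw hx) (ih p' (by omega) hw)

theorem symm (p : ClearPath R u v) : ClearPath R v u := by
  induction p with
  | refl u => exact refl u
  | @step u w v h1 h2 h3 _ ih =>
    have h4 : ClearPath R w u := step (by rw [cellDist_comm, h1])
      (by rw [cellDist_comm w u, h1, cellDist_self]; rfl) (fun _ => rfl) (refl u)
    by_cases hwv : w = v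
    · subst hwv
      exact h4
    · refine trans ih h4 ?_ fun hw => absurd (h3 hw) hwv
      rw [cellDist_comm v w, cellDist_comm w u, cellDist_comm v u]
      omega

theorem image {f : Cell → Cell} (hf : ∀ a b, cellDist (f a) (f b) = cellDist a b)
    (p : ClearPath R u v) : ClearPath (R.image f) (f u) (f v) := by
  have hi : Function.Injective f := fun a b h => eq_of_cellDist_eq_zero (by
    rw [← hf, h, cellDist_self])
  induction p with
  | refl u => exact refl _
  | step h1 h2 h3 _ ih =>
    refine step (by rw [hf, h1]) (by rw [hf, hf, h2]) (fun hw => ?_) ih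
    rw [h3 (hi.mem_finset_image.1 hw)]

/-- Concatenation at a free vertex of the rectangle spanned by the ends. -/
theorem trans_of_between (p : ClearPath R u w) (p' : ClearPath R w v) (hw : w ∈ R → w = v)
    (h1 : (u.1 ≤ w.1 ∧ w.1 ≤ v.1) ∨ (v.1 ≤ w.1 ∧ w.1 ≤ u.1))
    (h2 : (u.2 ≤ w.2 ∧ w.2 ≤ v.2) ∨ (v.2 ≤ w.2 ∧ w.2 ≤ u.2)) : ClearPath R u v := by
  refine trans p p' ?_ hw
  unfold cellDist
  have key : ∀ a b c : ℤ, (a ≤ b ∧ b ≤ c) ∨ (c ≤ b ∧ b ≤ a) → |a - b| + |b - c| = |a - c| := by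
    intro a b c h
    simp only [Int.abs_eq_natAbs]
    omega
  have := key _ _ _ h1
  have := key _ _ _ h2
  omega

theorem adj {a b c d : ℤ} (h : (a = c ∧ (b = d + 1 ∨ d = b + 1)) ∨
    (b = d ∧ (a = c + 1 ∨ c = a + 1))) : ClearPath R (a, b) (c, d) := by
  have h1 : cellDist (a, b) (c, d) = 1 := by
    simp only [cellDist, Int.abs_eq_natAbs]
    omega
  exact step h1 (by rw [h1, cellDist_self]; rfl) (fun _ => rfl) (refl _)

theorem horizontal {a b : ℤ} (m : ℕ) (h : ∀ c, b < c → c < b + m → (a, c) ∉ R) :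
    ClearPath R (a, b) (a, b + m) := by
  induction m with
  | zero => simpa using refl _
  | succ m ih =>
    rcases Nat.eq_zero_or_pos m with rfl | hm
    · exact adj (by left; simp)
    · refine trans_of_between (w := (a, b + m)) (ih fun c h1 h2 => h c h1 (by push_cast; omega))
        (adj (by left; push_cast; omega)) (fun hw => absurd hw (h _ (by omega) (by push_cast; omega)))
        ?_ ?_
      · simp
      · left; simp only []; push_cast; omega

theorem horizontal' {a b c : ℤ} (hbc : b ≤ c) (h : ∀ d, b < d → d < c → (a, d) ∉ R) :
    ClearPath R (a, b) (a, c) := by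
  have := horizontal (R := R) (a := a) (b := b) (c - b).toNat (fun d h1 h2 => h d h1 (by omega))
  rwa [show b + ((c - b).toNat : ℤ) = c by omega] at this

theorem vertical {a b c : ℤ} (hbc : b ≤ c) (h : ∀ d, b < d → d < c → (d, a) ∉ R) :
    ClearPath R (b, a) (c, a) := by
  have h1 : ClearPath (R.image Prod.swap) (a, b) (a, c) := horizontal' hbc fun d h1 h2 h3 => by
    rw [Finset.mem_image] at h3
    obtain ⟨⟨x, y⟩, h3, h4⟩ := h3
    simp only [Prod.swap, Prod.mk.injEq] at h4
    exact h d h1 h2 (by rw [← h4.1, ← h4.2]; exact h3)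
  have h2 := image (f := Prod.swap) (fun a b => by simp [cellDist, add_comm]) h1
  rw [Finset.image_image] at h2
  simpa using h2

/-- A staircase that goes down and left alternately. -/
theorem staircase {s a : ℤ} (m : ℕ) (h1 : ∀ c, a < c → c < a + m → (c, s - c) ∉ R)
    (h2 : ∀ c, a ≤ c → c < a + m → (c + 1, s - c) ∉ R) :
    ClearPath R (a, s - a) (a + m, s - (a + m)) := by
  induction m with
  | zero => simpa using refl _
  | succ m ih =>
    have h3 : ClearPath R (a + m, s - (a + m)) (a + (m + 1 : ℕ), s - (a + (m + 1 : ℕ))) := by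
      refine trans_of_between (w := (a + m + 1, s - (a + m))) (adj (by right; omega))
        (adj (by left; push_cast; omega))
        (fun hw => absurd hw (h2 _ (by omega) (by push_cast; omega))) ?_ ?_ <;>
      simp only [] <;> push_cast <;> omega
    rcases Nat.eq_zero_or_pos m with rfl | hm
    · simpa using h3
    · refine trans_of_between (w := (a + m, s - (a + m)))
        (ih (fun c h4 h5 => h1 c h4 (by push_cast; omega))
          fun c h4 h5 => h2 c h4 (by push_cast; omega)) h3
        (fun hw => absurd hw (h1 _ (by omega) (by push_cast; omega))) ?_ ?_ <;>
      simp only [] <;> push_cast <;> omega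

end ClearPath

theorem between_of_cellDist {u w v : Cell} (h : cellDist u w + cellDist w v = cellDist u v) :
    ((u.1 ≤ w.1 ∧ w.1 ≤ v.1) ∨ (v.1 ≤ w.1 ∧ w.1 ≤ u.1)) ∧
      ((u.2 ≤ w.2 ∧ w.2 ≤ v.2) ∨ (v.2 ≤ w.2 ∧ w.2 ≤ u.2)) := by
  simp only [cellDist, Int.abs_eq_natAbs] at h
  omega

theorem cellDist_le_length {M N : ℕ} {u v : Cell} (p : (gridGraph M N).Walk u v) :
    cellDist u v ≤ p.length := by
  induction p with
  | nil => simp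
  | @cons u w v h p ih =>
    have h1 := cellDist_triangle u w v
    have h2 : cellDist u w = 1 := h.2.2
    rw [SimpleGraph.Walk.length_cons]
    push_cast
    omega

theorem ClearPath.exists_walk {M N : ℕ} {R : Finset Cell} {u v : Cell} (p : ClearPath R u v)
    (hu : u ∈ cells M N) (hv : v ∈ cells M N) :
    ∃ w : (gridGraph M N).Walk u v, (w.length : ℤ) = cellDist u v ∧
      ∀ x ∈ w.support, x ∈ R → x = u ∨ x = v := by
  induction p with
  | refl u => exact ⟨SimpleGraph.Walk.nil, by simp, by simp⟩
  | @step u w v h1 h2 h3 _ ih =>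
    obtain ⟨b1, b2⟩ := between_of_cellDist (u := u) (w := w) (v := v) (by omega)
    have hw : w ∈ cells M N := by
      rw [mem_cells] at hu hv ⊢
      omega
    obtain ⟨p, hp, hp'⟩ := ih hw hv
    have hadj : (gridGraph M N).Adj u w := ⟨hu, hw, h1⟩
    refine ⟨SimpleGraph.Walk.cons hadj p, by
      rw [SimpleGraph.Walk.length_cons]; push_cast; omega, ?_⟩
    intro x hx hxR
    rw [SimpleGraph.Walk.support_cons, List.mem_cons] at hx
    rcases hx with rfl | hx
    · exact Or.inl rfl
    · rcases hp' x hx hxR with rfl | rfl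
      · exact Or.inr (h3 hxR)
      · exact Or.inr rfl

theorem clearPath_empty (u v : Cell) : ClearPath ∅ u v := by
  have h : ∀ a b c d : ℤ, b ≤ d → ClearPath ∅ (a, b) (c, d) := by
    intro a b c d hbd
    have h1 : ClearPath ∅ (a, b) (a, d) := ClearPath.horizontal' hbd (by simp)
    have h2 : ClearPath ∅ (a, d) (c, d) := by
      rcases le_total a c with h | h
      · exact ClearPath.vertical h (by simp)
      · exact (ClearPath.vertical h (by simp)).symm
    exact ClearPath.trans_of_between h1 h2 (by simp) (by simp only []; omega)
      (by simp only []; omega)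
  rcases le_total u.2 v.2 with h1 | h1
  · exact h _ _ _ _ h1
  · exact (h _ _ _ _ h1).symm

theorem dist_gridGraph {M N : ℕ} {u v : Cell} (hu : u ∈ cells M N) (hv : v ∈ cells M N) :
    ((gridGraph M N).dist u v : ℤ) = cellDist u v := by
  obtain ⟨w, hw, -⟩ := (clearPath_empty u v).exists_walk hu hv
  obtain ⟨p, hp⟩ := w.reachable.exists_walk_length_eq_dist
  have h1 := SimpleGraph.dist_le w
  have h2 := cellDist_le_length p
  omega

theorem ClearPath.mutuallyVisible {M N : ℕ} {R : Finset Cell} {u v : Cell}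
    (p : ClearPath R u v) (hu : u ∈ cells M N) (hv : v ∈ cells M N) :
    MutuallyVisible (gridGraph M N) R u v := by
  obtain ⟨w, hw, hw'⟩ := p.exists_walk hu hv
  exact ⟨w, by have := dist_gridGraph hu hv; omega, hw'⟩

/-! ### A lower bound for the area -/

theorem exists_mem_support_eq {M N : ℕ} {f : Cell → ℤ}
    (hf : ∀ x y, |f x - f y| ≤ cellDist x y) {u v : Cell} (p : (gridGraph M N).Walk u v) {b : ℤ}
    (hu : f u ≤ b) (hv : b ≤ f v) : ∃ x ∈ p.support, f x = b := by
  induction p with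
  | @nil u => exact ⟨u, by simp, le_antisymm hu hv⟩
  | @cons u w v h p ih =>
    by_cases hub : f u = b
    · exact ⟨u, by simp, hub⟩
    · have h1 := hf w u
      rw [cellDist_comm, show cellDist u w = 1 from h.2.2, abs_le] at h1
      obtain ⟨x, hx, hx'⟩ := ih (by omega) hv
      exact ⟨x, by rw [SimpleGraph.Walk.support_cons]; exact List.mem_cons_of_mem _ hx, hx'⟩

/-- In a line of the grid, a robot hides the robots on its two sides from each other. -/
theorem card_line_le_two {M N : ℕ} {S : Finset Cell} (hS : S ⊆ cells M N)
    (hG : GeodesicMutualVisibility M N S) {f g : Cell → ℤ}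
    (hfg : ∀ x y, cellDist x y = |f x - f y| + |g x - g y|) (a : ℤ) :
    (S.filter fun v => g v = a).card ≤ 2 := by
  have hinj : ∀ x y, f x = f y → g x = g y → x = y := fun x y h1 h2 =>
    eq_of_cellDist_eq_zero (by rw [hfg, h1, h2]; simp)
  by_contra! hc
  set F := S.filter fun v => g v = a with hF
  have hne : F.Nonempty := Finset.card_pos.1 (by omega)
  obtain ⟨u, hu, hu'⟩ := Finset.exists_min_image F f hne
  obtain ⟨v, hv, hv'⟩ := Finset.exists_max_image F f hne
  obtain ⟨b, hb, hb'⟩ : ∃ b ∈ F, b ∉ ({u, v} : Finset Cell) := by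
    by_contra! h
    have := Finset.card_le_card (show F ⊆ {u, v} from h)
    have := Finset.card_le_two (a := u) (b := v)
    omega
  simp only [Finset.mem_insert, Finset.mem_singleton, not_or] at hb'
  obtain ⟨huS, hua⟩ := Finset.mem_filter.1 hu
  obtain ⟨hvS, hva⟩ := Finset.mem_filter.1 hv
  obtain ⟨hbS, hba⟩ := Finset.mem_filter.1 hb
  obtain ⟨p, hp, hp'⟩ := hG u huS v hvS
  obtain ⟨x, hx, hxb⟩ := exists_mem_support_eq (f := f)
    (fun x y => by rw [hfg]; have := abs_nonneg (g x - g y); omega) p (hu' b hb) (hv' b hb)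
  have h1 := cellDist_le_length (p.takeUntil x hx)
  have h2 := cellDist_le_length (p.dropUntil x hx)
  have h3 := congrArg SimpleGraph.Walk.length (p.take_spec hx)
  rw [SimpleGraph.Walk.length_append] at h3
  have h4 := dist_gridGraph (hS huS) (hS hvS)
  have hub := hu' b hb
  have hbv := hv' b hb
  rw [hfg] at h1 h2 h4
  simp only [Int.abs_eq_natAbs] at h1 h2 h4
  have hgx : g x = a := by omega
  have hxb' : x = b := hinj _ _ hxb (hgx.trans hba.symm)
  subst hxb'
  rcases hp' x hx hbS with h | h
  · exact hb'.1 h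
  · exact hb'.2 h

theorem card_le_two_mul_rowSpan {M N : ℕ} {S : Finset Cell} (hS : S ⊆ cells M N)
    (hG : GeodesicMutualVisibility M N S) (hne : S.Nonempty) :
    S.card ≤ 2 * (rowSpan S + 1) ∧ S.card ≤ 2 * (colSpan S + 1) := by
  constructor
  · have h1 := Finset.card_le_mul_card_image (f := Prod.fst) S 2 fun b _ =>
      card_line_le_two hS hG (f := Prod.snd) (g := Prod.fst)
        (fun x y => by rw [cellDist, add_comm]) b
    have h2 : S.image Prod.fst ⊆ Finset.Icc (minRow S) (minRow S + rowSpan S) := by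
      intro x hx
      obtain ⟨v, hv, rfl⟩ := Finset.mem_image.1 hx
      obtain ⟨⟨w, hw, hw'⟩, h3⟩ := minRow_spec hne
      have := (le_abs_self _).trans (abs_row_le_rowSpan hv hw)
      rw [Finset.mem_Icc]
      exact ⟨h3 v hv, by omega⟩
    have h3 := Finset.card_le_card h2
    rw [Int.card_Icc] at h3
    exact h1.trans (Nat.mul_le_mul_left 2 (h3.trans (by omega)))
  · have h1 := Finset.card_le_mul_card_image (f := Prod.snd) S 2 fun b _ =>
      card_line_le_two hS hG (f := Prod.fst) (g := Prod.snd) (fun x y => rfl) b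
    have h2 : S.image Prod.snd ⊆ Finset.Icc (minCol S) (minCol S + colSpan S) := by
      intro x hx
      obtain ⟨v, hv, rfl⟩ := Finset.mem_image.1 hx
      obtain ⟨⟨w, hw, hw'⟩, h3⟩ := minCol_spec hne
      have := (le_abs_self _).trans (abs_col_le_colSpan hv hw)
      rw [Finset.mem_Icc]
      exact ⟨h3 v hv, by omega⟩
    have h3 := Finset.card_le_card h2
    rw [Int.card_Icc] at h3
    exact h1.trans (Nat.mul_le_mul_left 2 (h3.trans (by omega)))

/-! ### The pattern -/

/-- The pattern with two robots in every row and column of `[1, k] × [1, k]`. -/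
noncomputable def fullPattern (k : ℤ) : Finset Cell :=
  (Finset.Icc 1 k ×ˢ Finset.Icc 1 k).filter fun v : Cell =>
    v.1 + v.2 = k - 1 ∨ v.1 + v.2 = k + 3 ∨
      v = (1, k - 1) ∨ v = (2, k) ∨ v = (k - 1, 1) ∨ v = (k, 2)

theorem pattern_eq (n : ℕ) : pattern n = if Even n then fullPattern ((n + 1) / 2 : ℕ) else
    (fullPattern ((n + 1) / 2 : ℕ)).erase (((n + 1) / 2 : ℕ), 2) := rfl

theorem mem_fullPattern {k a b : ℤ} : (a, b) ∈ fullPattern k ↔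
    (1 ≤ a ∧ a ≤ k ∧ 1 ≤ b ∧ b ≤ k) ∧ (a + b = k - 1 ∨ a + b = k + 3 ∨
      (a = 1 ∧ b = k - 1) ∨ (a = 2 ∧ b = k) ∨ (a = k - 1 ∧ b = 1) ∨ (a = k ∧ b = 2)) := by
  simp [fullPattern, and_assoc]

theorem pattern_subset (n : ℕ) : pattern n ⊆ fullPattern ((n + 1) / 2 : ℕ) := by
  rw [pattern_eq]
  split_ifs
  · exact subset_rfl
  · exact Finset.erase_subset _ _

/-- The column of the left robot in row `l` of the pattern. -/
def leftCol (k l : ℤ) : ℤ := if l ≤ k - 2 then k - 1 - l else l - k + 2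

/-- The column of the right robot in row `l` of the pattern. -/
def rightCol (k l : ℤ) : ℤ := if l ≤ 2 then k - 2 + l else k + 3 - l

theorem mem_fullPattern_iff_cols {k a b : ℤ} (hk : 4 ≤ k) : (a, b) ∈ fullPattern k ↔
    (1 ≤ a ∧ a ≤ k) ∧ (b = leftCol k a ∨ b = rightCol k a) := by
  rw [mem_fullPattern]
  unfold leftCol rightCol
  split_ifs <;> omega

theorem leftCol_lt_rightCol {k l : ℤ} (hk : 4 ≤ k) (h1 : 1 ≤ l) (h2 : l ≤ k) :
    leftCol k l < rightCol k l := by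
  unfold leftCol rightCol
  split_ifs <;> omega

theorem cols_bounds {k l : ℤ} (hk : 4 ≤ k) (h1 : 1 ≤ l) (h2 : l ≤ k) :
    1 ≤ leftCol k l ∧ rightCol k l ≤ k := by
  unfold leftCol rightCol
  split_ifs <;> omega

theorem mem_pattern_iff_cols {n : ℕ} (hn : 7 ≤ n) {k a b : ℤ} (hk : k = ((n + 1) / 2 : ℕ)) :
    (a, b) ∈ pattern n ↔
      (1 ≤ a ∧ a ≤ k) ∧ ((b = leftCol k a ∧ (a = k → Even n)) ∨ b = rightCol k a) := by
  have hk4 : 4 ≤ k := by omega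
  have h2 : leftCol k k = 2 := by unfold leftCol; split_ifs <;> omega
  have h3 : rightCol k k = 3 := by unfold rightCol; split_ifs <;> omega
  rw [pattern_eq, ← hk]
  split_ifs with hn2
  · rw [mem_fullPattern_iff_cols hk4]
    simp [hn2]
  · rw [Finset.mem_erase, mem_fullPattern_iff_cols hk4]
    simp only [ne_eq, Prod.mk.injEq, hn2, imp_false]
    constructor
    · rintro ⟨h4, h5, h6⟩
      refine ⟨h5, ?_⟩
      by_cases ha : a = k
      · subst ha
        omega
      · omega
    · rintro ⟨h5, h6⟩
      refine ⟨?_, h5, by tauto⟩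
      rintro ⟨rfl, rfl⟩
      omega

theorem pattern_bounds {n : ℕ} {v : Cell} (hv : v ∈ pattern n) :
    (1 ≤ v.1 ∧ v.1 ≤ ((n + 1) / 2 : ℕ)) ∧ 1 ≤ v.2 ∧ v.2 ≤ ((n + 1) / 2 : ℕ) := by
  have := (mem_fullPattern (a := v.1) (b := v.2)).1 (pattern_subset n hv)
  omega

theorem card_pattern_row {n : ℕ} (hn : 7 ≤ n) (l : ℤ) :
    ((pattern n).filter fun v => v.1 = l).card =
      if 1 ≤ l ∧ l ≤ ((n + 1) / 2 : ℕ) then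
        if l = ((n + 1) / 2 : ℕ) ∧ ¬ Even n then 1 else 2 else 0 := by
  obtain ⟨k, hk⟩ : ∃ k : ℤ, k = ((n + 1) / 2 : ℕ) := ⟨_, rfl⟩
  rw [← hk]
  split_ifs with h1 h2
  · rw [Finset.card_eq_one]
    refine ⟨(l, rightCol k l), ?_⟩
    ext ⟨a, b⟩
    simp only [Finset.mem_filter, mem_pattern_iff_cols hn hk, Finset.mem_singleton, Prod.mk.injEq]
    constructor
    · rintro ⟨⟨-, h4 | h4⟩, rfl⟩
      · exact absurd (h4.2 h2.1) h2.2
      · exact ⟨rfl, h4⟩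
    · rintro ⟨rfl, h⟩
      exact ⟨⟨h1, Or.inr h⟩, rfl⟩
  · have hlt := leftCol_lt_rightCol (by omega) h1.1 h1.2
    rw [Finset.card_eq_two]
    refine ⟨(l, leftCol k l), (l, rightCol k l), by simp [hlt.ne], ?_⟩
    ext ⟨a, b⟩
    simp only [Finset.mem_filter, mem_pattern_iff_cols hn hk, Finset.mem_singleton,
      Finset.mem_insert, Prod.mk.injEq]
    constructor
    · rintro ⟨⟨-, h4 | h4⟩, rfl⟩
      · exact Or.inl ⟨rfl, h4.1⟩
      · exact Or.inr ⟨rfl, h4⟩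
    · rintro (⟨rfl, h⟩ | ⟨rfl, h⟩)
      · exact ⟨⟨h1, Or.inl ⟨h, fun h5 => by
          by_contra h6
          exact h2 ⟨h5, h6⟩⟩⟩, rfl⟩
      · exact ⟨⟨h1, Or.inr h⟩, rfl⟩
  · rw [Finset.card_eq_zero, Finset.filter_eq_empty_iff]
    rintro ⟨a, b⟩ hv rfl
    exact h1 ((mem_pattern_iff_cols hn hk).1 hv).1

theorem card_pattern {n : ℕ} (hn : 7 ≤ n) : (pattern n).card = n := by
  rw [Finset.card_eq_sum_card_fiberwise (f := Prod.fst)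
    (t := Finset.Icc (1 : ℤ) ((n + 1) / 2 : ℕ)) fun v hv => by
      rw [Finset.mem_coe, Finset.mem_Icc]
      exact (pattern_bounds hv).1]
  rw [Finset.sum_congr rfl fun l _ => card_pattern_row hn l]
  have h1 : ∀ l ∈ Finset.Icc (1 : ℤ) ((n + 1) / 2 : ℕ),
      (if 1 ≤ l ∧ l ≤ ((n + 1) / 2 : ℕ) then
        if l = ((n + 1) / 2 : ℕ) ∧ ¬ Even n then 1 else 2 else 0) + 
      (if l = ((n + 1) / 2 : ℕ) then (if Even n then 0 else 1) else 0) = 2 := by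
    intro l hl
    rw [Finset.mem_Icc] at hl
    rw [if_pos hl]
    by_cases h3 : Even n <;> simp only [h3, not_true, not_false_eq_true, and_false, and_true] <;>
      split_ifs <;> first | rfl | contradiction
  have h2 := Finset.sum_congr (rfl : Finset.Icc (1 : ℤ) ((n + 1) / 2 : ℕ) = _) h1
  rw [Finset.sum_add_distrib, Finset.sum_ite_eq', if_pos (by rw [Finset.mem_Icc]; omega),
    Finset.sum_const, Int.card_Icc] at h2
  simp only [smul_eq_mul] at h2
  by_cases h3 : Even n
  · rw [if_pos h3] at h2
    rw [Nat.even_iff] at h3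
    omega
  · rw [if_neg h3] at h2
    rw [Nat.even_iff] at h3
    omega

/-! ### Visibility in the pattern -/

section Visibility

open ClearPath

variable {k : ℤ}

theorem fullPattern_image_swap : (fullPattern k).image Prod.swap = fullPattern k := by
  have h : ∀ v ∈ fullPattern k, v.swap ∈ fullPattern k := by
    rintro ⟨a, b⟩ h
    simp only [Prod.swap, mem_fullPattern] at h ⊢
    omega
  ext v
  rw [Finset.mem_image]
  exact ⟨fun ⟨w, hw, e⟩ => e ▸ h w hw, fun hv => ⟨v.swap, h v hv, by simp⟩⟩

theorem fullPattern_image_turn :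
    (fullPattern k).image (fun v => (k + 1 - v.1, k + 1 - v.2)) = fullPattern k := by
  have h : ∀ v ∈ fullPattern k, (k + 1 - v.1, k + 1 - v.2) ∈ fullPattern k := by
    rintro ⟨a, b⟩ h
    simp only [mem_fullPattern] at h ⊢
    omega
  ext v
  rw [Finset.mem_image]
  exact ⟨fun ⟨w, hw, e⟩ => e ▸ h w hw, fun hv => ⟨_, h v hv, by simp⟩⟩

theorem clearPath_swap {a b c d : ℤ} (h : ClearPath (fullPattern k) (a, b) (c, d)) :
    ClearPath (fullPattern k) (b, a) (d, c) := by
  have := h.image (f := Prod.swap) fun a b => by simp [cellDist, add_comm]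
  rwa [fullPattern_image_swap] at this

theorem clearPath_turn {a b c d : ℤ} (h : ClearPath (fullPattern k) (a, b) (c, d)) :
    ClearPath (fullPattern k) (k + 1 - a, k + 1 - b) (k + 1 - c, k + 1 - d) := by
  have := h.image (f := fun v : Cell => (k + 1 - v.1, k + 1 - v.2)) fun a b => by
    simp [cellDist, abs_sub_comm]
  rwa [fullPattern_image_turn] at this

/-- The antidiagonal `i + j = k + 1` and the cells below it are free, except near its ends. -/
theorem clearPath_antidiagonal {a b : ℤ} (ha : 2 ≤ a) (hab : a ≤ b) (hb : b ≤ k - 1) :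
    ClearPath (fullPattern k) (a, k + 1 - a) (b, k + 1 - b) := by
  have := ClearPath.staircase (R := fullPattern k) (s := k + 1) (a := a) (b - a).toNat
    (fun c h1 h2 => by rw [mem_fullPattern]; omega) fun c h1 h2 => by rw [mem_fullPattern]; omega
  rwa [show a + ((b - a).toNat : ℤ) = b by omega] at this

/-- A path that leaves towards the antidiagonal, follows it, and leaves it again. -/
theorem clearPath_via {u v : Cell} {a b : ℤ} (ha : 2 ≤ a) (hab : a ≤ b) (hb : b ≤ k - 1)
    (h1 : ClearPath (fullPattern k) u (a, k + 1 - a))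
    (h2 : ClearPath (fullPattern k) (b, k + 1 - b) v)
    (h3 : u.1 ≤ a ∧ b ≤ v.1 ∧ k + 1 - a ≤ u.2 ∧ v.2 ≤ k + 1 - b) :
    ClearPath (fullPattern k) u v := by
  refine trans_of_between h1 (trans_of_between (clearPath_antidiagonal ha hab hb) h2 ?_ ?_ ?_)
    ?_ ?_ ?_
  · intro h; rw [mem_fullPattern] at h; omega
  · simp only []; omega
  · simp only []; omega
  · intro h; rw [mem_fullPattern] at h; omega
  · simp only []; omega
  · simp only []; omega

theorem clearPath_lower {i j : ℤ} (hij : i ≤ j) (hj : j ≤ k - 2) :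
    ClearPath (fullPattern k) (i, k - 1 - i) (j, k - 1 - j) := by
  rcases hij.eq_or_lt with rfl | hij
  · exact refl _
  · refine trans_of_between (w := (i, k - 1 - j)) (horizontal' (by omega) fun c h1 h2 => ?_).symm
      (vertical hij.le fun c h1 h2 => ?_) ?_ ?_ ?_
    · rw [mem_fullPattern]; omega
    · rw [mem_fullPattern]; omega
    · rw [mem_fullPattern]; intro h; exfalso; omega
    · simp only []; omega
    · simp only []; omega

/-- From the lower to the upper diagonal. The path is straight or has few bends if the ends are
close; otherwise it follows the antidiagonal. -/
theorem clearPath_lower_upper (hk : 4 ≤ k) {i j : ℤ} (hi : 1 ≤ i) (hi' : i ≤ k - 2) (hj : 3 ≤ j) (hj' : j ≤ k) :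
    ClearPath (fullPattern k) (i, k - 1 - i) (j, k + 3 - j) := by
  rcases lt_or_ge j i with h | h
  · refine (clearPath_via (a := j) (b := i) (by omega) (by omega) (by omega) ?_ ?_ ?_).symm
    · exact (horizontal' (by omega) fun c h1 h2 => by rw [mem_fullPattern]; omega).symm
    · exact (horizontal' (by omega) fun c h1 h2 => by rw [mem_fullPattern]; omega).symm
    · simp only []; omega
  rcases lt_or_ge (i + 4) j with h' | h'
  · refine clearPath_via (a := i + 2) (b := j - 2) (by omega) (by omega) (by omega) ?_ ?_ ?_
    · rw [show k + 1 - (i + 2) = k - 1 - i by ring]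
      exact vertical (by omega) fun c h1 h2 => by rw [mem_fullPattern]; omega
    · rw [show k + 1 - (j - 2) = k + 3 - j by ring]
      exact vertical (by omega) fun c h1 h2 => by rw [mem_fullPattern]; omega
    · simp only []; omega
  have hcases : j = i ∨ j = i + 1 ∨ j = i + 2 ∨ j = i + 3 ∨ j = i + 4 := by omega
  rcases hcases with rfl | rfl | rfl | rfl | rfl
  · exact horizontal' (by omega) fun c h1 h2 => by rw [mem_fullPattern]; omega
  · refine trans_of_between (w := (i, k + 1 - i)) (horizontal' (by omega) fun c h1 h2 => by
      rw [mem_fullPattern]; omega)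
      (trans_of_between (w := (i + 1, k + 1 - i)) (adj (by omega)) (adj (by omega)) ?_ ?_ ?_)
      ?_ ?_ ?_
    · rw [mem_fullPattern]; intro h; exfalso; omega
    · simp only []; omega
    · simp only []; omega
    · rw [mem_fullPattern]; intro h; exfalso; omega
    · simp only []; omega
    · simp only []; omega
  · have h1 : ClearPath (fullPattern k) (i, k - 1 - i) (i + 1, k - i) := by
      by_cases h3 : i = 1
      · refine trans_of_between (w := (i + 1, k - 1 - i)) (adj (by omega)) (adj (by omega)) ?_ ?_ ?_
        · rw [mem_fullPattern]; intro h; exfalso; omega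
        · simp only []; omega
        · simp only []; omega
      · refine trans_of_between (w := (i, k - i)) (adj (by omega)) (adj (by omega)) ?_ ?_ ?_
        · rw [mem_fullPattern]; intro h; exfalso; omega
        · simp only []; omega
        · simp only []; omega
    have h2 : ClearPath (fullPattern k) (i + 1, k - i) (i + 2, k + 3 - (i + 2)) := by
      by_cases h3 : i = 1
      · refine trans_of_between (w := (i + 2, k - i)) (adj (by omega)) (adj (by omega)) ?_ ?_ ?_
        · rw [mem_fullPattern]; intro h; exfalso; omega
        · simp only []; omega
        · simp only []; omega
      · refine trans_of_between (w := (i + 1, k + 1 - i)) (adj (by omega)) (adj (by omega)) ?_ ?_ ?_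
        · rw [mem_fullPattern]; intro h; exfalso; omega
        · simp only []; omega
        · simp only []; omega
    refine trans_of_between h1 h2 ?_ ?_ ?_
    · rw [mem_fullPattern]; intro h; exfalso; omega
    · simp only []; omega
    · simp only []; omega
  · refine trans_of_between (w := (i + 2, k - 1 - i)) (vertical (by omega) fun c h1 h2 => by
      rw [mem_fullPattern]; omega)
      (trans_of_between (w := (i + 2, k - i)) (adj (by omega)) (adj (by omega)) ?_ ?_ ?_)
      ?_ ?_ ?_
    · rw [mem_fullPattern]; intro h; exfalso; omega
    · simp only []; omega
    · simp only []; omega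
    · rw [mem_fullPattern]; intro h; exfalso; omega
    · simp only []; omega
    · simp only []; omega
  · rw [show k + 3 - (i + 4) = k - 1 - i by ring]
    exact vertical (by omega) fun c h1 h2 => by rw [mem_fullPattern]; omega

/-- Near the end of the antidiagonal, the robot at `(1, k - 1)` sees all others. -/
theorem clearPath_first (hk : 4 ≤ k) {a b : ℤ} (h : (a, b) ∈ fullPattern k) :
    ClearPath (fullPattern k) (1, k - 1) (a, b) := by
  have h0 : ClearPath (fullPattern k) (1, k - 1) (2, k + 1 - 2) := by
    rw [show k + 1 - 2 = k - 1 by ring]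
    exact adj (by omega)
  obtain ⟨h1, h2 | h2 | ⟨h2, h3⟩ | ⟨h2, h3⟩ | ⟨h2, h3⟩ | ⟨h2, h3⟩⟩ := mem_fullPattern.1 h
  · rcases eq_or_ne a 1 with rfl | ha
    · exact adj (by omega)
    · refine clearPath_via (a := 2) (b := a) (by omega) (by omega) (by omega) h0 ?_ ?_
      · exact (horizontal' (by omega) fun c h1 h2 => by rw [mem_fullPattern]; omega).symm
      · simp only []; omega
  · rcases eq_or_ne a 3 with rfl | ha
    · obtain rfl : b = k := by omega
      refine trans_of_between (w := (3, b - 1)) (vertical (by omega) fun c h1 h2 => by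
        rw [mem_fullPattern]; omega) (adj (by omega)) ?_ ?_ ?_
      · rw [mem_fullPattern]; intro h; exfalso; omega
      · simp only []; omega
      · simp only []; omega
    · refine clearPath_via (a := 2) (b := a - 2) (by omega) (by omega) (by omega) h0 ?_ ?_
      · rw [show k + 1 - (a - 2) = b by omega]
        exact vertical (by omega) fun c h1 h2 => by rw [mem_fullPattern]; omega
      · simp only []; omega
  · subst a b
    exact refl _
  · subst a b
    refine trans_of_between (w := (2, k - 1)) (adj (by omega)) (adj (by omega)) ?_ ?_ ?_
    · rw [mem_fullPattern]; intro h; exfalso; omega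
    · simp only []; omega
    · simp only []; omega
  · subst a b
    refine clearPath_via (a := 2) (b := k - 1) (by omega) (by omega) (by omega) h0 ?_ ?_
    · exact adj (by omega)
    · simp only []; omega
  · subst a b
    refine clearPath_via (a := 2) (b := k - 1) (by omega) (by omega) (by omega) h0 ?_ ?_
    · exact adj (by omega)
    · simp only []; omega

theorem clearPath_fullPattern (hk : 4 ≤ k) {a b c d : ℤ} (hu : (a, b) ∈ fullPattern k)
    (hv : (c, d) ∈ fullPattern k) : ClearPath (fullPattern k) (a, b) (c, d) := by
  have hswap : ∀ {a b : ℤ}, (a, b) ∈ fullPattern k → (b, a) ∈ fullPattern k := by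
    intro a b h; rw [mem_fullPattern] at h ⊢; omega
  have hturn : ∀ {a b : ℤ}, (a, b) ∈ fullPattern k → (k + 1 - a, k + 1 - b) ∈ fullPattern k := by
    intro a b h; rw [mem_fullPattern] at h ⊢; omega
  -- By symmetry, each of the four robots off the two diagonals sees all others.
  have hP : ∀ {a b c d : ℤ}, (a, b) ∈ fullPattern k → (c, d) ∈ fullPattern k →
      ((a = 1 ∧ b = k - 1) ∨ (a = 2 ∧ b = k) ∨ (a = k - 1 ∧ b = 1) ∨ (a = k ∧ b = 2)) →
      ClearPath (fullPattern k) (a, b) (c, d) := by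
    rintro a b c d hu hv (⟨h1, h2⟩ | ⟨h1, h2⟩ | ⟨h1, h2⟩ | ⟨h1, h2⟩) <;> subst a b
    · exact clearPath_first hk hv
    · have := clearPath_turn (clearPath_swap (clearPath_first hk (hswap (hturn hv))))
      convert this using 2 <;> ring
    · exact clearPath_swap (clearPath_first hk (hswap hv))
    · have := clearPath_turn (clearPath_first hk (hturn hv))
      convert this using 2 <;> ring
  have hlow : ∀ {a b c d : ℤ}, (a, b) ∈ fullPattern k → (c, d) ∈ fullPattern k →
      a + b = k - 1 → c + d = k - 1 → ClearPath (fullPattern k) (a, b) (c, d) := by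
    intro a b c d hu hv h1 h2
    rw [mem_fullPattern] at hu hv
    obtain rfl : b = k - 1 - a := by omega
    obtain rfl : d = k - 1 - c := by omega
    rcases le_total a c with h | h
    · exact clearPath_lower h (by omega)
    · exact (clearPath_lower h (by omega)).symm
  have hlu : ∀ {a b c d : ℤ}, (a, b) ∈ fullPattern k → (c, d) ∈ fullPattern k →
      a + b = k - 1 → c + d = k + 3 → ClearPath (fullPattern k) (a, b) (c, d) := by
    intro a b c d hu hv h1 h2
    rw [mem_fullPattern] at hu hv
    obtain rfl : b = k - 1 - a := by omega
    obtain rfl : d = k + 3 - c := by omega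
    exact clearPath_lower_upper hk (by omega) (by omega) (by omega) (by omega)
  obtain ⟨-, h1 | h1 | h1⟩ := mem_fullPattern.1 hu
  · obtain ⟨-, h2 | h2 | h2⟩ := mem_fullPattern.1 hv
    · exact hlow hu hv h1 h2
    · exact hlu hu hv h1 h2
    · exact (hP hv hu h2).symm
  · obtain ⟨-, h2 | h2 | h2⟩ := mem_fullPattern.1 hv
    · exact (hlu hv hu h2 h1).symm
    · have := clearPath_turn (hlow (hturn hu) (hturn hv) (by omega) (by omega))
      convert this using 2 <;> ring
    · exact (hP hv hu h2).symm
  · exact hP hu hv h1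

theorem clearPath_pattern {n : ℕ} (hn : 7 ≤ n) {u v : Cell} (hu : u ∈ pattern n)
    (hv : v ∈ pattern n) : ClearPath (pattern n) u v :=
  (clearPath_fullPattern (by omega) (pattern_subset n hu) (pattern_subset n hv)).mono
    (pattern_subset n)

end Visibility

/-! ### The pattern solves the problem -/

theorem pattern_spans {n : ℕ} (hn : 7 ≤ n) :
    rowSpan (pattern n) = (n + 1) / 2 - 1 ∧ colSpan (pattern n) = (n + 1) / 2 - 1 := by
  obtain ⟨k, hk⟩ : ∃ k : ℤ, k = ((n + 1) / 2 : ℕ) := ⟨_, rfl⟩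
  have m1 : (1, k - 1) ∈ pattern n := by
    rw [mem_pattern_iff_cols hn hk]; unfold leftCol rightCol; split_ifs <;> omega
  have m2 : (2, k) ∈ pattern n := by
    rw [mem_pattern_iff_cols hn hk]; unfold leftCol rightCol; split_ifs <;> omega
  have m3 : (k - 1, 1) ∈ pattern n := by
    rw [mem_pattern_iff_cols hn hk]; unfold leftCol rightCol; split_ifs <;> omega
  have m4 : (k, 3) ∈ pattern n := by
    rw [mem_pattern_iff_cols hn hk]; unfold leftCol rightCol; split_ifs <;> omega
  have h1 := (le_abs_self _).trans (abs_row_le_rowSpan m4 m1)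
  have h2 := (le_abs_self _).trans (abs_col_le_colSpan m2 m3)
  simp only [] at h1 h2
  have h3 : rowSpan (pattern n) ≤ (n + 1) / 2 - 1 := rowSpan_le_iff.2 fun u hu v hv => by
    have := pattern_bounds hu
    have := pattern_bounds hv
    omega
  have h4 : colSpan (pattern n) ≤ (n + 1) / 2 - 1 := colSpan_le_iff.2 fun u hu v hv => by
    have := pattern_bounds hu
    have := pattern_bounds hv
    omega
  omega

theorem spans_normalize (R : Finset Cell) :
    rowSpan (normalize R) = rowSpan R ∧ colSpan (normalize R) = colSpan R := by
  have e : ∀ a b : ℕ, (∀ c, a ≤ c ↔ b ≤ c) → a = b := fun a b h =>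
    le_antisymm ((h b).2 le_rfl) ((h a).1 le_rfl)
  constructor <;> refine e _ _ fun c => ?_ <;>
    simp only [rowSpan_le_iff, colSpan_le_iff, normalize, Finset.forall_mem_image] <;>
    simp

theorem patternFormed_spans {M N : ℕ} {R : Finset Cell} (hn : 7 ≤ R.card)
    (h : PatternFormed M N R) :
    rowSpan R = (R.card + 1) / 2 - 1 ∧ colSpan R = (R.card + 1) / 2 - 1 := by
  obtain ⟨q, hq⟩ := h
  obtain ⟨h1, h2⟩ := spans_normalize (rotate M N q R)
  obtain ⟨h3, h4⟩ := pattern_spans hn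
  rw [hq] at h1 h2
  rcases spans_rotate M N q R with ⟨h5, h6⟩ | ⟨h5, h6⟩ <;> omega

theorem solvesGMVArea_of_patternFormed {M N : ℕ} {R : Finset Cell} (hR : R ⊆ cells M N)
    (hn : 7 ≤ R.card) (h : PatternFormed M N R) : SolvesGMVArea M N R := by
  constructor
  · obtain ⟨q, hq⟩ := h
    intro u hu v hv
    set S := rotate M N q R with hS
    -- The isometry that maps the pattern onto `R`.
    set f : Cell → Cell := fun w => rotCell (rotRows M N q) (rotCols M N q) (-q)
      (w.1 + minRow S - 1, w.2 + minCol S - 1) with hf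
    have hfd : ∀ a b, cellDist (f a) (f b) = cellDist a b := by
      intro a b
      rw [hf]
      simp only [cellDist_rotCell]
      simp [cellDist]
    have hfu : ∀ w, f ((rotCell M N q w).1 - minRow S + 1, (rotCell M N q w).2 - minCol S + 1) =
        w := by
      intro w
      simp only [hf]
      convert rotCell_neg_rotCell M N q w using 2
      ext <;> simp only [] <;> ring
    have hmem : ∀ w ∈ R, ((rotCell M N q w).1 - minRow S + 1,
        (rotCell M N q w).2 - minCol S + 1) ∈ pattern R.card := by
      intro w hw
      rw [← hq]
      exact Finset.mem_image_of_mem (fun v : Cell => (v.1 - minRow S + 1, v.2 - minCol S + 1))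
        (rotCell_mem_rotate.2 hw)
    have himage : (pattern R.card).image f = R := by
      ext w
      rw [Finset.mem_image]
      constructor
      · rintro ⟨x, hx, rfl⟩
        rw [← hq] at hx
        obtain ⟨y, hy, rfl⟩ := Finset.mem_image.1 hx
        obtain ⟨z, hz, rfl⟩ := Finset.mem_image.1 hy
        rw [hfu]
        exact hz
      · intro hw
        exact ⟨_, hmem w hw, hfu w⟩
    have hp := (clearPath_pattern hn (hmem u hu) (hmem v hv)).image hfd
    rw [himage, hfu, hfu] at hp
    exact hp.mutuallyVisible (hR hu) (hR hv)
  · intro S hS hc hG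
    obtain ⟨h1, h2⟩ := card_le_two_mul_rowSpan hS hG (Finset.card_pos.1 (by omega))
    obtain ⟨h3, h4⟩ := patternFormed_spans hn h
    rw [mbrArea, mbrArea, h3, h4]
    exact Nat.mul_le_mul (by omega) (by omega)

theorem patternFormed_rotate {M N : ℕ} {q : Fin 4} {R : Finset Cell} :
    PatternFormed (rotRows M N q) (rotCols M N q) (rotate M N q R) ↔ PatternFormed M N R := by
  unfold PatternFormed
  simp only [rotate_rotate, card_rotate]
  constructor
  · rintro ⟨r, hr⟩
    exact ⟨_, hr⟩
  · rintro ⟨r, hr⟩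
    exact ⟨r - q, by rwa [add_sub_cancel]⟩

/-- The pattern leaves the corners of its bounding rectangle free, so it cannot contain a corner
of the grid. -/
theorem not_patternFormed_of_corner {M N : ℕ} {R : Finset Cell} (hn : 7 ≤ R.card)
    (hR : R ⊆ cells M N) {c : Cell} (hc : c ∈ corners M N) (hcR : c ∈ R) :
    ¬ PatternFormed M N R := by
  rintro ⟨q, hq⟩
  have hR' := rotate_subset_cells (q := q).2 hR
  have hc' := rotCell_mem_corners (q := q).2 hc
  have hcR' := rotCell_mem_rotate (M := M) (N := N) (q := q).2 hcR
  set S := rotate M N q R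
  set w := rotCell M N q c
  set M' := rotRows M N q
  set N' := rotCols M N q
  have himg : ∀ v ∈ S, (v.1 - minRow S + 1, v.2 - minCol S + 1) ∈ pattern R.card := by
    intro v hv
    rw [← hq]
    exact Finset.mem_image_of_mem (fun v : Cell => (v.1 - minRow S + 1, v.2 - minCol S + 1)) hv
  have hne : S.Nonempty := ⟨w, hcR'⟩
  obtain ⟨k, hk⟩ : ∃ k : ℤ, k = ((R.card + 1) / 2 : ℕ) := ⟨_, rfl⟩
  obtain ⟨h1, h2⟩ := spans_normalize S
  obtain ⟨h3, h4⟩ := pattern_spans hn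
  rw [hq] at h1 h2
  have hw : (w.1 = 1 ∨ w.1 = M') ∧ (w.2 = 1 ∨ w.2 = N') := by
    simp only [corners, Finset.mem_insert, Finset.mem_singleton, Prod.ext_iff] at hc'
    omega
  have p := mem_fullPattern.1 (pattern_subset _ (himg w hcR'))
  rw [← hk] at p
  have k1 : w.1 - minRow S + 1 = 1 ∨ w.1 - minRow S + 1 = k := by
    obtain ⟨u, hu, v, hv, e⟩ := exists_rowSpan hne
    have b1 := (minRow_spec hne).2 v hv
    have b2 := (minRow_spec hne).2 w hcR'
    have p1 := (pattern_bounds (himg u hu)).1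
    have p2 := (pattern_bounds (himg w hcR')).1
    have c1 := (mem_cells.1 (hR' hu)).1
    have c2 := (mem_cells.1 (hR' hv)).1
    simp only [] at p1 p2
    clear p hc hc'
    omega
  have k2 : w.2 - minCol S + 1 = 1 ∨ w.2 - minCol S + 1 = k := by
    obtain ⟨u, hu, v, hv, e⟩ := exists_colSpan hne
    have b1 := (minCol_spec hne).2 v hv
    have b2 := (minCol_spec hne).2 w hcR'
    have p1 := (pattern_bounds (himg u hu)).2
    have p2 := (pattern_bounds (himg w hcR')).2
    have c1 := (mem_cells.1 (hR' hu)).2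
    have c2 := (mem_cells.1 (hR' hv)).2
    simp only [] at p1 p2
    clear p hc hc'
    omega
  clear hw hc hc'
  omega

/-! ### The rows of the target and the surplus of the rows -/

theorem mem_target {n N : ℕ} {v : Cell} :
    v ∈ target n N ↔ (v.1, v.2 - N + ((n + 1) / 2 : ℕ)) ∈ pattern n := by
  simp only [target, Finset.mem_image]
  constructor
  · rintro ⟨w, hw, rfl⟩
    convert hw using 1
    exact Prod.ext rfl (by simp only []; ring)
  · intro h
    exact ⟨_, h, Prod.ext rfl (by simp only []; ring)⟩

theorem card_target {n : ℕ} (hn : 7 ≤ n) (N : ℕ) : (target n N).card = n := by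
  rw [target, Finset.card_image_of_injective, card_pattern hn]
  intro a b h
  simp only [Prod.mk.injEq] at h
  exact Prod.ext h.1 (by omega)

theorem inRow_target {n : ℕ} (hn : 7 ≤ n) (N : ℕ) (l : ℤ) :
    inRow (target n N) l = if 1 ≤ l ∧ l ≤ ((n + 1) / 2 : ℕ) then
        if l = ((n + 1) / 2 : ℕ) ∧ ¬ Even n then 1 else 2 else 0 := by
  rw [← card_pattern_row hn, inRow, target, Finset.filter_image, Finset.card_image_of_injective]
  intro a b h
  simp only [Prod.mk.injEq] at h
  exact Prod.ext h.1 (by omega)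

/-- The number of robots minus the number of targets in the rows up to `l`. If it is positive, as
many robots have to cross from row `l` to row `l + 1`; if it is negative, in the other direction. -/
noncomputable def surplus (N : ℕ) (R : Finset Cell) (l : ℤ) : ℤ :=
  ((R.filter fun v => v.1 ≤ l).card : ℤ) - ((target R.card N).filter fun v => v.1 ≤ l).card

theorem card_filter_le_succ (S : Finset Cell) (l : ℤ) :
    (S.filter fun v => v.1 ≤ l).card = (S.filter fun v => v.1 ≤ l - 1).card + inRow S l := by
  rw [inRow, ← Finset.card_union_of_disjoint]
  · congr 1
    ext v
    simp only [Finset.mem_filter, Finset.mem_union]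
    by_cases hv : v ∈ S <;> simp [hv]
    omega
  · rw [Finset.disjoint_filter]
    intro v _ h
    omega

theorem card_filter_ge (S : Finset Cell) (l : ℤ) :
    (S.filter fun v => l ≤ v.1).card + (S.filter fun v => v.1 ≤ l - 1).card = S.card := by
  rw [← Finset.card_union_of_disjoint]
  · congr 1
    ext v
    simp only [Finset.mem_filter, Finset.mem_union]
    by_cases hv : v ∈ S <;> simp [hv]
    omega
  · rw [Finset.disjoint_filter]
    intro v _ h
    omega

theorem surplus_succ (N : ℕ) (R : Finset Cell) (l : ℤ) :
    surplus N R l = surplus N R (l - 1) + inRow R l - inRow (target R.card N) l := by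
  have h1 := card_filter_le_succ R l
  have h2 := card_filter_le_succ (target R.card N) l
  unfold surplus
  omega

theorem excessAbove_eq (N : ℕ) (R : Finset Cell) (l : ℤ) :
    excessAbove N R l = (surplus N R l).toNat := by
  unfold excessAbove surplus
  omega

theorem excessBelow_eq {R : Finset Cell} (hn : 7 ≤ R.card) (N : ℕ) (l : ℤ) :
    excessBelow N R l = (-surplus N R (l - 1)).toNat := by
  have h1 := card_filter_ge R l
  have h2 := card_filter_ge (target R.card N) l
  rw [card_target hn] at h2
  unfold excessBelow surplus
  omega

theorem numDown_eq (N : ℕ) (R : Finset Cell) (l : ℤ) :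
    numDown N R l = min (inRow R l) (surplus N R l).toNat := by
  rw [← excessAbove_eq]
  unfold numDown
  omega

theorem numUp_eq {R : Finset Cell} (hn : 7 ≤ R.card) (N : ℕ) (l : ℤ) :
    numUp N R l = min (inRow R l) (-surplus N R (l - 1)).toNat := by
  rw [← excessBelow_eq hn]
  unfold numUp
  omega

theorem inRow_pos {R : Finset Cell} {v : Cell} (hv : v ∈ R) : 0 < inRow R v.1 :=
  Finset.card_pos.2 ⟨v, Finset.mem_filter.2 ⟨hv, rfl⟩⟩

theorem eq_of_inRow_eq_one {R : Finset Cell} {u v : Cell} (h : inRow R v.1 = 1) (hu : u ∈ R)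
    (hv : v ∈ R) (huv : u.1 = v.1) : u = v :=
  Finset.card_le_one.1 h.le u (Finset.mem_filter.2 ⟨hu, huv⟩) v (Finset.mem_filter.2 ⟨hv, rfl⟩)

/-! ### Configurations with a guard -/

/-- The only robot on a corner is the guard, on the upper right corner. -/
structure Guarded (M N : ℕ) (R : Finset Cell) : Prop where
  subset : R ⊆ cells M N
  guard : (1, (N : ℤ)) ∈ R
  corner : ∀ c ∈ corners M N, c ∈ R → c = (1, (N : ℤ))
  card : 7 ≤ R.card
  rows : (R.card + 1) / 2 ≤ M
  cols : (R.card + 1) / 2 ≤ N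

theorem mem_eligible {M N : ℕ} {R : Finset Cell} {l : ℤ} {v : Cell} :
    v ∈ eligible M N R l ↔ v ∈ R ∧ v.1 = l ∧ v ≠ (1, (N : ℤ)) ∧
      ((R.card + 1) / 2 < M ∨ (v.2 ≠ 1 ∧ v.2 ≠ N)) := by
  simp [eligible]

theorem eligible_subset (M N : ℕ) (R : Finset Cell) (l : ℤ) :
    eligible M N R l ⊆ R.filter fun v => v.1 = l := fun v hv => by
  rw [mem_eligible] at hv
  exact Finset.mem_filter.2 ⟨hv.1, hv.2.1⟩

theorem card_eligible_le (M N : ℕ) (R : Finset Cell) (l : ℤ) :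
    (eligible M N R l).card ≤ inRow R l :=
  Finset.card_le_card (eligible_subset M N R l)

theorem inRow_le_card_eligible (M N : ℕ) (R : Finset Cell) (l : ℤ) :
    inRow R l ≤ (eligible M N R l).card + 2 := by
  have h1 : (R.filter fun v => v.1 = l) ⊆ eligible M N R l ∪ {(l, 1), (l, (N : ℤ))} := by
    rintro ⟨a, b⟩ hv
    rw [Finset.mem_filter] at hv
    obtain ⟨hv, rfl⟩ := hv
    by_cases he : (a, b) ∈ eligible M N R a
    · exact Finset.mem_union_left _ he
    · rw [mem_eligible] at he
      simp only [Finset.mem_union, Finset.mem_insert, Finset.mem_singleton, Prod.mk.injEq, true_and]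
      simp only [hv, true_and, ne_eq, Prod.mk.injEq] at he
      tauto
  have h2 := Finset.card_le_card h1
  have h3 := Finset.card_union_le (eligible M N R l) {(l, 1), (l, (N : ℤ))}
  have h4 := Finset.card_le_two (a := (l, (1 : ℤ))) (b := (l, (N : ℤ)))
  unfold inRow
  omega

/-- Among the elements of a finite set, those with fewer than `m` elements before them. -/
theorem card_filter_rank {E : Finset Cell} {f : Cell → ℤ} (hf : Set.InjOn f E) (m : ℕ) :
    (E.filter fun v => (E.filter fun s => f s < f v).card < m).card = min E.card m := by
  set rank : Cell → ℕ := fun v => (E.filter fun s => f s < f v).card with hrank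
  have hlt : ∀ u ∈ E, ∀ v ∈ E, f u < f v → rank u < rank v := by
    intro u hu v hv h
    apply Finset.card_lt_card
    rw [Finset.ssubset_iff_of_subset]
    · exact ⟨u, Finset.mem_filter.2 ⟨hu, h⟩, fun h' => lt_irrefl _ (Finset.mem_filter.1 h').2⟩
    · intro s hs
      rw [Finset.mem_filter] at hs ⊢
      exact ⟨hs.1, hs.2.trans h⟩
  have hinj : Set.InjOn rank E := by
    intro u hu v hv h
    apply hf hu hv
    rcases lt_trichotomy (f u) (f v) with h1 | h1 | h1
    · exact absurd h (hlt u hu v hv h1).ne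
    · exact h1
    · exact absurd h (hlt v hv u hu h1).ne'
  have himg : E.image rank = Finset.range E.card := by
    apply Finset.eq_of_subset_of_card_le
    · intro x hx
      obtain ⟨v, hv, rfl⟩ := Finset.mem_image.1 hx
      rw [Finset.mem_range]
      apply Finset.card_lt_card
      rw [Finset.ssubset_iff_of_subset (Finset.filter_subset _ _)]
      exact ⟨v, hv, fun h => lt_irrefl _ (Finset.mem_filter.1 h).2⟩
    · rw [Finset.card_image_of_injOn hinj, Finset.card_range]
  have h1 : (E.filter fun v => rank v < m).image rank = Finset.range (min E.card m) := by
    ext x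
    rw [Finset.mem_image, Finset.mem_range, lt_min_iff]
    constructor
    · rintro ⟨v, hv, rfl⟩
      rw [Finset.mem_filter] at hv
      exact ⟨Finset.mem_range.1 (himg ▸ Finset.mem_image_of_mem rank hv.1), hv.2⟩
    · rintro ⟨hx, hxm⟩
      obtain ⟨v, hv, rfl⟩ := Finset.mem_image.1 (himg ▸ Finset.mem_range.2 hx)
      exact ⟨v, Finset.mem_filter.2 ⟨hv, hxm⟩, rfl⟩
  rw [← Finset.card_range (min E.card m), ← h1, Finset.card_image_of_injOn]
  exact hinj.mono (Finset.filter_subset _ _)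

theorem eligible_injOn (M N : ℕ) (R : Finset Cell) (l : ℤ) :
    Set.InjOn (Prod.snd : Cell → ℤ) (eligible M N R l) := by
  intro u hu v hv h
  rw [Finset.mem_coe, mem_eligible] at hu hv
  exact Prod.ext (hu.2.1.trans hv.2.1.symm) h

theorem card_downSet (M N : ℕ) (R : Finset Cell) (l : ℤ) :
    (downSet M N R l).card = min (eligible M N R l).card (numDown N R l) :=
  card_filter_rank (eligible_injOn M N R l) _

/-- The robots selected to move upward, without the exception for a single robot on `(2, 1)`. -/
noncomputable def upCandidates (M N : ℕ) (R : Finset Cell) (l : ℤ) : Finset Cell :=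
  (eligible M N R l).filter fun v =>
    ((eligible M N R l).filter fun s => v.2 < s.2).card < numUp N R l

theorem card_upCandidates (M N : ℕ) (R : Finset Cell) (l : ℤ) :
    (upCandidates M N R l).card = min (eligible M N R l).card (numUp N R l) := by
  have h := card_filter_rank (E := eligible M N R l) (f := fun v => -v.2)
    (fun u hu v hv h => eligible_injOn M N R l hu hv (neg_injective h)) (numUp N R l)
  simp only [neg_lt_neg_iff] at h
  exact h

theorem upSet_eq (M N : ℕ) (R : Finset Cell) (l : ℤ) :
    upSet M N R l = if l = 2 ∧ upCandidates M N R l = {(2, 1)} then ∅ else upCandidates M N R l :=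
  rfl

theorem upSet_subset (M N : ℕ) (R : Finset Cell) (l : ℤ) :
    upSet M N R l ⊆ upCandidates M N R l := by
  rw [upSet_eq]
  split_ifs
  · exact Finset.empty_subset _
  · exact subset_rfl

theorem downSet_subset (M N : ℕ) (R : Finset Cell) (l : ℤ) :
    downSet M N R l ⊆ eligible M N R l := Finset.filter_subset _ _

theorem upCandidates_subset (M N : ℕ) (R : Finset Cell) (l : ℤ) :
    upCandidates M N R l ⊆ eligible M N R l := Finset.filter_subset _ _

theorem numDown_pos {M N : ℕ} {R : Finset Cell} {l : ℤ} {v : Cell} (h : v ∈ downSet M N R l) :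
    0 < numDown N R l :=
  (Nat.zero_le _).trans_lt (Finset.mem_filter.1 h).2

theorem surplus_pos_of_mem_downSet {M N : ℕ} {R : Finset Cell} {l : ℤ} {v : Cell}
    (h : v ∈ downSet M N R l) : 0 < surplus N R l := by
  have := numDown_pos h
  rw [numDown_eq] at this
  omega

theorem surplus_neg_of_mem_upCandidates {M N : ℕ} {R : Finset Cell} (hn : 7 ≤ R.card) {l : ℤ}
    {v : Cell} (h : v ∈ upCandidates M N R l) : surplus N R (l - 1) < 0 := by
  have : 0 < numUp N R l := (Nat.zero_le _).trans_lt (Finset.mem_filter.1 h).2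
  rw [numUp_eq hn] at this
  omega

theorem mem_of_mem_downSet {M N : ℕ} {R : Finset Cell} {l : ℤ} {v : Cell}
    (h : v ∈ downSet M N R l) : v ∈ R ∧ v.1 = l := by
  have := mem_eligible.1 (downSet_subset M N R l h)
  exact ⟨this.1, this.2.1⟩

theorem mem_of_mem_upSet {M N : ℕ} {R : Finset Cell} {l : ℤ} {v : Cell}
    (h : v ∈ upSet M N R l) : v ∈ R ∧ v.1 = l := by
  have := mem_eligible.1 (upCandidates_subset M N R l (upSet_subset M N R l h))
  exact ⟨this.1, this.2.1⟩

/-- Two robots have the same target. -/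
abbrev Conflict (M N : ℕ) (R : Finset Cell) : Prop :=
  ∃ a ∈ R, ∃ b ∈ R, a ≠ b ∧ balanceTarget M N R a = balanceTarget M N R b

/-- The situation in which a robot moves from `(2, 1)` to `(2, 2)`, so that it can move up without
entering a corner afterwards. -/
abbrev StuckBelowCorner (N : ℕ) (R : Finset Cell) : Prop :=
  numUp N R 2 = 1 ∧ (2, 1) ∈ R ∧ inRow R 2 = 1

/-- The column to which a robot steps aside in column `c`. -/
def asideCol (N : ℕ) (c : ℤ) : ℤ := if (N : ℤ) + 1 ≤ 2 * c then c - 1 else c + 1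

theorem asideCol_spec {N : ℕ} (hN : 4 ≤ N) {c : ℤ} (h1 : 1 ≤ c) (h2 : c ≤ N) :
    2 ≤ asideCol N c ∧ asideCol N c ≤ N - 1 ∧ (asideCol N c = c - 1 ∨ asideCol N c = c + 1) := by
  unfold asideCol
  split_ifs <;> omega

theorem balanceTarget_of_down {M N : ℕ} {R : Finset Cell} {v : Cell}
    (h : v ∈ downSet M N R v.1) : balanceTarget M N R v = (v.1 + 1, v.2) := if_pos h

theorem balanceTarget_of_up {M N : ℕ} {R : Finset Cell} {v : Cell}
    (h : v ∉ downSet M N R v.1) (h' : v ∈ upSet M N R v.1) :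
    balanceTarget M N R v = (v.1 - 1, v.2) := by
  rw [balanceTarget, if_neg h, if_pos h']

theorem balanceTarget_of_aligned {M N : ℕ} {R : Finset Cell} {v : Cell}
    (h : v ∉ downSet M N R v.1) (h' : v ∉ upSet M N R v.1)
    (h3 : AlignedUp M N R v ∨ AlignedDown M N R v) :
    balanceTarget M N R v = (v.1, asideCol N v.2) := by
  rw [balanceTarget, if_neg h, if_neg h', if_pos h3, asideCol]
  split_ifs <;> rfl

theorem balanceTarget_of_not_aligned {M N : ℕ} {R : Finset Cell} {v : Cell} (hv : v ∈ R)
    (h : v ∉ downSet M N R v.1) (h' : v ∉ upSet M N R v.1)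
    (h3 : ¬ (AlignedUp M N R v ∨ AlignedDown M N R v)) :
    (balanceTarget M N R v = (2, 2) ∧ v = (2, 1) ∧ StuckBelowCorner N R) ∨
      (balanceTarget M N R v = v ∧ ¬ (v = (2, 1) ∧ StuckBelowCorner N R)) := by
  rw [balanceTarget, if_neg h, if_neg h', if_neg h3]
  split_ifs with h4
  · obtain ⟨h4, rfl, h5⟩ := h4
    exact Or.inl ⟨rfl, rfl, h4, hv, h5⟩
  · exact Or.inr ⟨rfl, fun ⟨h5, h6⟩ => h4 ⟨h6.1, h5, h6.2.2⟩⟩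

theorem balanceRows_of_not_conflict {M N : ℕ} {R : Finset Cell} (h : ¬ Conflict M N R) (v : Cell) :
    balanceRows M N R v = balanceTarget M N R v := if_neg fun h' => h h'.1

theorem balanceRows_of_not_up {M N : ℕ} {R : Finset Cell} {v : Cell}
    (h : ¬ (v ∈ upSet M N R v.1 ∨ AlignedUp M N R v)) :
    balanceRows M N R v = balanceTarget M N R v := if_neg fun h' => h h'.2

theorem balanceRows_of_conflict {M N : ℕ} {R : Finset Cell} {v : Cell} (hc : Conflict M N R)
    (h : v ∈ upSet M N R v.1 ∨ AlignedUp M N R v) : balanceRows M N R v = v := if_pos ⟨hc, h⟩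

namespace Guarded

variable {M N : ℕ} {R : Finset Cell} {l : ℤ} {v : Cell}

theorem four_le (h : Guarded M N R) : 4 ≤ M ∧ 4 ≤ N := by
  have := h.card
  have := h.rows
  have := h.cols
  omega

theorem surplus_of_le_zero (h : Guarded M N R) (hl : l ≤ 0) : surplus N R l = 0 := by
  have h1 : (R.filter fun v => v.1 ≤ l) = ∅ := by
    rw [Finset.filter_eq_empty_iff]
    intro v hv
    have := mem_cells.1 (h.subset hv)
    omega
  have h2 : ((target R.card N).filter fun v => v.1 ≤ l) = ∅ := by
    rw [Finset.filter_eq_empty_iff]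
    intro v hv
    have := pattern_bounds (mem_target.1 hv)
    simp only [] at this
    omega
  rw [surplus, h1, h2]
  simp

theorem surplus_nonpos_of_ge (h : Guarded M N R) (hl : ((R.card + 1) / 2 : ℕ) ≤ l) :
    surplus N R l ≤ 0 := by
  have h2 : ((target R.card N).filter fun v => v.1 ≤ l) = target R.card N := by
    rw [Finset.filter_eq_self]
    intro v hv
    have := pattern_bounds (mem_target.1 hv)
    simp only [] at this
    omega
  rw [surplus, h2, card_target h.card]
  have := Finset.card_filter_le R fun v => v.1 ≤ l
  omega

theorem surplus_nonneg_of_forall_le (h : Guarded M N R) (hl : ∀ v ∈ R, v.1 ≤ l) :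
    0 ≤ surplus N R l := by
  have h1 : (R.filter fun v => v.1 ≤ l) = R := Finset.filter_eq_self.2 hl
  have h2 := Finset.card_filter_le (target R.card N) fun v => v.1 ≤ l
  rw [card_target h.card] at h2
  rw [surplus, h1]
  omega

theorem row_of_surplus_pos (h : Guarded M N R) (hl : 0 < surplus N R l) :
    1 ≤ l ∧ l < ((R.card + 1) / 2 : ℕ) := by
  constructor
  · by_contra h1
    have := h.surplus_of_le_zero (l := l) (by omega)
    omega
  · by_contra h1
    have := h.surplus_nonpos_of_ge (l := l) (by omega)
    omega

theorem row_of_surplus_neg (h : Guarded M N R) (hl : surplus N R l < 0) : 1 ≤ l := by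
  by_contra h1
  have := h.surplus_of_le_zero (l := l) (by omega)
  omega

theorem inRow_target_le (h : Guarded M N R) (l : ℤ) : inRow (target R.card N) l ≤ 2 := by
  rw [inRow_target h.card]
  split_ifs <;> omega

theorem inRow_target_eq (h : Guarded M N R) (h1 : 1 ≤ l) (h2 : l < ((R.card + 1) / 2 : ℕ)) :
    inRow (target R.card N) l = 2 := by
  rw [inRow_target h.card, if_pos ⟨h1, h2.le⟩, if_neg fun h3 => h2.ne h3.1]

theorem surplus_one (h : Guarded M N R) : surplus N R 1 = inRow R 1 - 2 := by
  have h1 := surplus_succ N R 1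
  rw [h.surplus_of_le_zero (l := 1 - 1) (by norm_num),
    h.inRow_target_eq le_rfl (by have := h.card; omega)] at h1
  simpa using h1

theorem one_le_inRow_one (h : Guarded M N R) : 1 ≤ inRow R 1 := inRow_pos h.guard

theorem mem_eligible_or (h : Guarded M N R) (hv : v ∈ R) (hl : 2 ≤ v.1) :
    v ∈ eligible M N R v.1 ∨ (M = (R.card + 1) / 2 ∧ (v.2 = 1 ∨ v.2 = N)) := by
  rw [mem_eligible]
  have hr := h.rows
  by_cases hM : (R.card + 1) / 2 < M
  · left
    exact ⟨hv, rfl, fun e => by rw [e] at hl; simp at hl, Or.inl hM⟩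
  · by_cases hc : v.2 = 1 ∨ v.2 = N
    · right
      exact ⟨by omega, hc⟩
    · left
      exact ⟨hv, rfl, fun e => by rw [e] at hl; simp at hl, Or.inr (by tauto)⟩

/-- Below the rows that send robots downward, at most one robot that may be selected stays. -/
theorem rest_down (h : Guarded M N R) (hl : 0 < surplus N R (l - 1))
    (hv : v ∈ eligible M N R l) (hv' : v ∉ downSet M N R l) :
    surplus N R (l - 1) = 1 ∧ ∀ w ∈ eligible M N R l, w ∉ downSet M N R l → w = v := by
  have h1 := Finset.card_sdiff_of_subset (downSet_subset M N R l)
  have h2 : v ∈ eligible M N R l \ downSet M N R l := Finset.mem_sdiff.2 ⟨hv, hv'⟩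
  have h3 : 0 < (eligible M N R l \ downSet M N R l).card := Finset.card_pos.2 ⟨v, h2⟩
  rw [card_downSet, numDown_eq] at h1
  have h4 := card_eligible_le M N R l
  have h5 := surplus_succ N R l
  have h6 := h.inRow_target_le l
  refine ⟨by omega, fun w hw hw' => ?_⟩
  exact Finset.card_le_one.1 (by omega) w (Finset.mem_sdiff.2 ⟨hw, hw'⟩) v h2

theorem rest_up (h : Guarded M N R) (hl : surplus N R l < 0)
    (hv : v ∈ eligible M N R l) (hv' : v ∉ upCandidates M N R l) :
    surplus N R l = -1 ∧ ∀ w ∈ eligible M N R l, w ∉ upCandidates M N R l → w = v := by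
  have h1 := Finset.card_sdiff_of_subset (upCandidates_subset M N R l)
  have h2 : v ∈ eligible M N R l \ upCandidates M N R l := Finset.mem_sdiff.2 ⟨hv, hv'⟩
  have h3 : 0 < (eligible M N R l \ upCandidates M N R l).card := Finset.card_pos.2 ⟨v, h2⟩
  rw [card_upCandidates, numUp_eq h.card] at h1
  have h4 := card_eligible_le M N R l
  have h5 := surplus_succ N R l
  have h6 := h.inRow_target_le l
  refine ⟨by omega, fun w hw hw' => ?_⟩
  exact Finset.card_le_one.1 (by omega) w (Finset.mem_sdiff.2 ⟨hw, hw'⟩) v h2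

theorem downSet_eq_singleton (hl : surplus N R l = 1) (hv : v ∈ downSet M N R l) :
    downSet M N R l = {v} := by
  have h1 := card_downSet M N R l
  rw [numDown_eq] at h1
  have h2 : (downSet M N R l).card ≤ 1 := by omega
  ext w
  rw [Finset.mem_singleton]
  exact ⟨fun hw => Finset.card_le_one.1 h2 w hw v hv, fun e => e ▸ hv⟩

theorem upSet_eq_singleton (h : Guarded M N R) (hl : surplus N R (l - 1) = -1)
    (hv : v ∈ upSet M N R l) : upSet M N R l = {v} := by
  have h1 := card_upCandidates M N R l
  rw [numUp_eq h.card] at h1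
  have h2 := Finset.card_le_card (upSet_subset M N R l)
  have h3 : (upSet M N R l).card ≤ 1 := by omega
  ext w
  rw [Finset.mem_singleton]
  exact ⟨fun hw => Finset.card_le_one.1 h3 w hw v hv, fun e => e ▸ hv⟩

/-- The exceptional case in the definition of `upSet`. -/
theorem of_upCandidates_eq (h : Guarded M N R) (hS : upCandidates M N R 2 = {(2, 1)}) :
    (2, 1) ∈ R ∧ surplus N R 1 = -1 ∧ inRow R 2 = 1 ∧ numUp N R 2 = 1 := by
  have hmem : (2, 1) ∈ upCandidates M N R 2 := by rw [hS]; simp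
  have hneg := surplus_neg_of_mem_upCandidates h.card hmem
  have h1 := h.surplus_one
  have h2 := h.one_le_inRow_one
  have hel := mem_eligible.1 (upCandidates_subset M N R 2 hmem)
  have hs : surplus N R 1 = -1 := by norm_num at hneg; omega
  have hpos := inRow_pos hel.1
  have hup : numUp N R 2 = 1 := by
    rw [numUp_eq h.card]
    norm_num
    simp only [] at hpos
    rw [hs]
    simp
    omega
  refine ⟨hel.1, hs, ?_, hup⟩
  -- no robot to the right of `(2, 1)` may be selected, and the grid has a spare row
  have hrank := (Finset.mem_filter.1 hmem).2
  rw [hup, Nat.lt_one_iff, Finset.card_eq_zero, Finset.filter_eq_empty_iff] at hrank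
  have hM : (R.card + 1) / 2 < M := by
    rcases hel.2.2.2 with h3 | h3
    · exact h3
    · exact absurd rfl h3.1
  rw [inRow, Finset.card_eq_one]
  refine ⟨(2, 1), ?_⟩
  ext w
  rw [Finset.mem_filter, Finset.mem_singleton]
  constructor
  · rintro ⟨hw, hw2⟩
    rcases h.mem_eligible_or hw (by omega) with h3 | h3
    · rw [hw2] at h3
      have := hrank h3
      have := mem_cells.1 (h.subset hw)
      exact Prod.ext hw2 (by simp only [] at *; omega)
    · omega
  · rintro rfl
    exact ⟨hel.1, rfl⟩

theorem not_up_of_down (h : Guarded M N R) (hv : v ∈ downSet M N R l) :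
    v ∉ upCandidates M N R l := by
  intro hu
  have h1 := (Finset.mem_filter.1 hv).2
  have h2 := (Finset.mem_filter.1 hu).2
  have hE := downSet_subset M N R l hv
  have hpos := surplus_pos_of_mem_downSet hv
  have hneg := surplus_neg_of_mem_upCandidates h.card hu
  obtain ⟨h3, h4⟩ := h.row_of_surplus_pos hpos
  have h5 := h.inRow_target_eq h3 h4
  have h6 := surplus_succ N R l
  have h7 := inRow_le_card_eligible M N R l
  rw [numDown_eq] at h1
  rw [numUp_eq h.card] at h2
  have h8 : (eligible M N R l).card = ((eligible M N R l).filter fun s => s.2 < v.2).card +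
      ((eligible M N R l).filter fun s => v.2 < s.2).card + 1 := by
    have e : eligible M N R l = ((eligible M N R l).filter fun s => s.2 < v.2) ∪
        ((eligible M N R l).filter fun s => v.2 < s.2) ∪ {v} := by
      ext w
      simp only [Finset.mem_union, Finset.mem_filter, Finset.mem_singleton]
      constructor
      · intro hw
        rcases lt_trichotomy w.2 v.2 with h9 | h9 | h9
        · exact Or.inl (Or.inl ⟨hw, h9⟩)
        · exact Or.inr (eligible_injOn M N R l hw hE h9)
        · exact Or.inl (Or.inr ⟨hw, h9⟩)
      · rintro ((hw | hw) | rfl)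
        · exact hw.1
        · exact hw.1
        · exact hE
    conv_lhs => rw [e]
    rw [Finset.card_union_of_disjoint, Finset.card_union_of_disjoint, Finset.card_singleton]
    · rw [Finset.disjoint_filter]
      intro w _ h9
      omega
    · rw [Finset.disjoint_singleton_right]
      simp
  omega

theorem not_alignedUp_of_surplus_nonneg (h : Guarded M N R) (hl : 0 ≤ surplus N R v.1) :
    ¬ AlignedUp M N R v := by
  intro hA
  have : (v.1 + 1, v.2) ∈ upSet M N R (v.1 + 1) := by rw [hA]; simp
  have := surplus_neg_of_mem_upCandidates h.card (upSet_subset _ _ _ _ this)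
  rw [add_sub_cancel_right] at this
  omega

theorem not_alignedDown_of_surplus_nonpos (hl : surplus N R (v.1 - 1) ≤ 0) :
    ¬ AlignedDown M N R v := by
  intro hA
  have : (v.1 - 1, v.2) ∈ downSet M N R (v.1 - 1) := by rw [hA]; simp
  have := surplus_pos_of_mem_downSet this
  omega

theorem not_up_of_surplus_nonneg (h : Guarded M N R) (hl : 0 ≤ surplus N R (l - 1)) :
    v ∉ upSet M N R l := fun hu => by
  have := surplus_neg_of_mem_upCandidates h.card (upSet_subset _ _ _ _ hu)
  omega

theorem balanceRows_of_down (h : Guarded M N R) (hv : v ∈ downSet M N R v.1) :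
    balanceRows M N R v = (v.1 + 1, v.2) := by
  rw [balanceRows_of_not_up, balanceTarget_of_down hv]
  rintro (h1 | h1)
  · exact h.not_up_of_down hv (upSet_subset _ _ _ _ h1)
  · exact h.not_alignedUp_of_surplus_nonneg (surplus_pos_of_mem_downSet hv).le h1

/-- In a row that receives robots from above, the robots that are not selected move only aside,
and then nobody else of the row does. -/
theorem below_down (h : Guarded M N R) (hpos : 0 < surplus N R (v.1 - 1)) (hv : v ∈ R)
    (hd : v ∉ downSet M N R v.1) :
    (AlignedDown M N R v ∧ balanceRows M N R v = (v.1, asideCol N v.2)) ∨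
      (¬ AlignedDown M N R v ∧ balanceRows M N R v = v) := by
  have h1 := inRow_pos hv
  have h2 := surplus_succ N R v.1
  have h3 := h.inRow_target_le v.1
  have hu : v ∉ upSet M N R v.1 := h.not_up_of_surplus_nonneg hpos.le
  have hau : ¬ AlignedUp M N R v := h.not_alignedUp_of_surplus_nonneg (by omega)
  rw [balanceRows_of_not_up (by tauto)]
  by_cases had : AlignedDown M N R v
  · exact Or.inl ⟨had, balanceTarget_of_aligned hd hu (Or.inr had)⟩
  · rcases balanceTarget_of_not_aligned hv hd hu (by tauto) with ⟨-, h4, h5⟩ | ⟨h4, -⟩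
    · subst h4
      have := h5.1
      rw [numUp_eq h.card] at this
      simp only [] at hpos
      omega
    · exact Or.inr ⟨had, h4⟩

/-- Whatever the configuration, the moves of the row balancing do not collide. -/
theorem balanceRows_injOn (h : Guarded M N R) : Set.InjOn (balanceRows M N R) R := by
  by_cases hC : Conflict M N R
  swap
  · intro a ha b hb hab
    by_contra hne
    rw [balanceRows_of_not_conflict hC, balanceRows_of_not_conflict hC] at hab
    exact hC ⟨a, ha, b, hb, hne, hab⟩
  obtain ⟨h4M, h4N⟩ := h.four_le
  -- In a cycle with a conflict, robots leave their rows only downward.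
  have hrow : ∀ v ∈ R, v ∉ downSet M N R v.1 → (balanceRows M N R v).1 = v.1 := by
    intro v hv hd
    by_cases hu : v ∈ upSet M N R v.1 ∨ AlignedUp M N R v
    · rw [balanceRows_of_conflict hC hu]
    · rw [balanceRows_of_not_up hu]
      by_cases had : AlignedDown M N R v
      · rw [balanceTarget_of_aligned hd (by tauto) (Or.inr had)]
      · rcases balanceTarget_of_not_aligned hv hd (by tauto) (by tauto) with ⟨h4, h5, -⟩ | ⟨h4, -⟩
        · rw [h4, h5]
        · rw [h4]
  -- A selected robot and a robot of the next row.
  have key1 : ∀ a ∈ R, ∀ b ∈ R, a ∈ downSet M N R a.1 → b ∉ downSet M N R b.1 →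
      balanceRows M N R a ≠ balanceRows M N R b := by
    intro a ha b hb hd hd' hab
    have hr := hrow b hb hd'
    rw [h.balanceRows_of_down hd] at hab
    rw [← hab] at hr
    simp only [] at hr
    have hrow' : b.1 - 1 = a.1 := by omega
    have hpos : 0 < surplus N R (b.1 - 1) := hrow' ▸ surplus_pos_of_mem_downSet hd
    have ha1 := (h.row_of_surplus_pos (surplus_pos_of_mem_downSet hd)).1
    rcases h.below_down hpos hb hd' with ⟨h1, h2⟩ | ⟨h1, h2⟩
    · rw [h2] at hab
      have h3 : a ∈ downSet M N R (b.1 - 1) := by rw [hrow']; exact hd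
      rw [h1, Finset.mem_singleton] at h3
      have hb' := mem_cells.1 (h.subset hb)
      have := asideCol_spec h4N hb'.2.1 hb'.2.2
      have e1 := congrArg Prod.snd hab
      have e2 := congrArg Prod.snd h3
      simp only [] at e1 e2
      omega
    · rw [h2] at hab
      have hb2 : b.2 = a.2 := by rw [← hab]
      have hel : b ∈ eligible M N R b.1 := by
        rcases h.mem_eligible_or hb (by omega) with h3 | ⟨h3, h4⟩
        · exact h3
        · have := (mem_eligible.1 (downSet_subset _ _ _ _ hd)).2.2.2
          rw [hb2] at h4
          omega
      obtain ⟨h3, -⟩ := h.rest_down hpos hel hd'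
      apply h1
      have := downSet_eq_singleton h3 (by rw [hrow']; exact hd : a ∈ downSet M N R (b.1 - 1))
      rw [AlignedDown, this]
      congr 1
      exact Prod.ext hrow'.symm hb2.symm
  -- A robot that steps aside, and another one that is not selected.
  have key2 : ∀ a ∈ R, ∀ b ∈ R, a ∉ downSet M N R a.1 → b ∉ downSet M N R b.1 → a ≠ b →
      balanceRows M N R a ≠ a → balanceRows M N R a ≠ balanceRows M N R b := by
    intro a ha b hb hda hdb hne hmove hab
    have hr : a.1 = b.1 := by rw [← hrow a ha hda, ← hrow b hb hdb, hab]
    have hua : ¬ (a ∈ upSet M N R a.1 ∨ AlignedUp M N R a) := fun hu =>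
      hmove (balanceRows_of_conflict hC hu)
    by_cases had : AlignedDown M N R a
    · have hmem : (a.1 - 1, a.2) ∈ downSet M N R (a.1 - 1) := by rw [had]; simp
      have hpos := surplus_pos_of_mem_downSet hmem
      have hrow1 := (h.row_of_surplus_pos hpos).1
      have hE := (mem_eligible.1 (downSet_subset _ _ _ _ hmem)).2.2.2
      simp only [] at hE
      have hel : a ∈ eligible M N R a.1 := by
        rcases h.mem_eligible_or ha (by omega) with h3 | ⟨h3, h4⟩
        · exact h3
        · omega
      obtain ⟨h3, h4⟩ := h.rest_down hpos hel hda
      have hbel : b ∉ eligible M N R b.1 := by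
        intro hbel
        rw [← hr] at hbel hdb
        exact hne (h4 b hbel hdb).symm
      have hbc : b.2 = 1 ∨ b.2 = N := by
        rcases h.mem_eligible_or hb (by omega) with h5 | ⟨h5, h6⟩
        · exact absurd h5 hbel
        · exact h6
      have ha' := mem_cells.1 (h.subset ha)
      have hb' := mem_cells.1 (h.subset hb)
      have hs := asideCol_spec h4N ha'.2.1 ha'.2.2
      rw [balanceRows_of_not_up hua, balanceTarget_of_aligned hda (by tauto) (Or.inr had)] at hab
      rcases h.below_down (hr ▸ hpos) hb hdb with ⟨h5, h6⟩ | ⟨h5, h6⟩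
      · have hmem' : (b.1 - 1, b.2) ∈ downSet M N R (b.1 - 1) := by rw [h5]; simp
        have hE' := (mem_eligible.1 (downSet_subset _ _ _ _ hmem')).2.2.2
        simp only [] at hE'
        rcases h.mem_eligible_or hb (by omega) with h7 | ⟨h7, h8⟩
        · exact hbel h7
        · omega
      · rw [h6] at hab
        have := congrArg Prod.snd hab
        simp only [] at this
        omega
    · rw [balanceRows_of_not_up hua] at hmove
      rcases balanceTarget_of_not_aligned ha hda (by tauto) (by tauto) with ⟨-, h5, h6⟩ | ⟨h4, -⟩
      · subst h5
        exact hne (eq_of_inRow_eq_one h6.2.2 hb ha hr.symm).symm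
      · exact hmove h4
  intro a ha b hb hab
  by_contra hne
  by_cases hda : a ∈ downSet M N R a.1 <;> by_cases hdb : b ∈ downSet M N R b.1
  · rw [h.balanceRows_of_down hda, h.balanceRows_of_down hdb, Prod.mk.injEq] at hab
    exact hne (Prod.ext (by omega) hab.2)
  · exact key1 a ha b hb hda hdb hab
  · exact key1 b hb a ha hdb hda hab.symm
  · by_cases hma : balanceRows M N R a = a
    · by_cases hmb : balanceRows M N R b = b
      · exact hne (hma ▸ hmb ▸ hab)
      · exact key2 b hb a ha hdb hda (Ne.symm hne) hmb hab.symm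
    · exact key2 a ha b hb hda hdb hne hma hab

end Guarded

/-! ### Row balancing -/

/-- The moves `f` of the robots in `R` are along edges and do not collide. -/
structure SafeMove (M N : ℕ) (R : Finset Cell) (f : Cell → Cell) : Prop where
  injOn : Set.InjOn f R
  adj : ∀ v ∈ R, f v = v ∨ (gridGraph M N).Adj v (f v)

theorem SafeMove.image_subset {M N : ℕ} {R : Finset Cell} {f : Cell → Cell}
    (h : SafeMove M N R f) (hR : R ⊆ cells M N) : R.image f ⊆ cells M N := by
  intro w hw
  obtain ⟨v, hv, rfl⟩ := Finset.mem_image.1 hw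
  rcases h.adj v hv with h1 | h1
  · rw [h1]; exact hR hv
  · exact h1.2.1

theorem SafeMove.card_image {M N : ℕ} {R : Finset Cell} {f : Cell → Cell}
    (h : SafeMove M N R f) : (R.image f).card = R.card := Finset.card_image_of_injOn h.injOn

theorem SafeMove.mono_cellDist {M N : ℕ} {R : Finset Cell} {f : Cell → Cell}
    (h : SafeMove M N R f) {v : Cell} (hv : v ∈ R) : cellDist v (f v) ≤ 1 := by
  rcases h.adj v hv with h1 | h1
  · rw [h1, cellDist_self]; norm_num
  · exact h1.2.2.le

theorem mem_corners {M N : ℕ} {v : Cell} :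
    v ∈ corners M N ↔ (v.1 = 1 ∨ v.1 = M) ∧ (v.2 = 1 ∨ v.2 = N) := by
  simp only [corners, Finset.mem_insert, Finset.mem_singleton, Prod.ext_iff]
  tauto

/-- The robots that move up from row `l`. -/
noncomputable def risingSet (M N : ℕ) (R : Finset Cell) (l : ℤ) : Finset Cell :=
  if Conflict M N R then ∅ else upSet M N R l

theorem risingSet_subset (M N : ℕ) (R : Finset Cell) (l : ℤ) :
    risingSet M N R l ⊆ upSet M N R l := by
  unfold risingSet
  split_ifs
  · exact Finset.empty_subset _
  · exact subset_rfl

namespace Guarded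

variable {M N : ℕ} {R : Finset Cell} {l : ℤ} {v : Cell}

theorem balanceRows_cases (h : Guarded M N R) (hv : v ∈ R) :
    (v ∈ downSet M N R v.1 ∧ balanceRows M N R v = (v.1 + 1, v.2)) ∨
    (v ∉ downSet M N R v.1 ∧ v ∈ risingSet M N R v.1 ∧ balanceRows M N R v = (v.1 - 1, v.2)) ∨
    (v ∉ downSet M N R v.1 ∧ v ∉ risingSet M N R v.1 ∧
      (balanceRows M N R v = (v.1, asideCol N v.2) ∨
        (v = (2, 1) ∧ balanceRows M N R v = (2, 2)) ∨ balanceRows M N R v = v)) := by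
  by_cases hd : v ∈ downSet M N R v.1
  · exact Or.inl ⟨hd, h.balanceRows_of_down hd⟩
  right
  by_cases hC : Conflict M N R
  · have hr : v ∉ risingSet M N R v.1 := by rw [risingSet, if_pos hC]; simp
    refine Or.inr ⟨hd, hr, ?_⟩
    by_cases hu : v ∈ upSet M N R v.1 ∨ AlignedUp M N R v
    · exact Or.inr (Or.inr (balanceRows_of_conflict hC hu))
    · rw [balanceRows_of_not_up hu]
      by_cases had : AlignedDown M N R v
      · exact Or.inl (balanceTarget_of_aligned hd (by tauto) (Or.inr had))
      · rcases balanceTarget_of_not_aligned hv hd (by tauto) (by tauto) with ⟨h4, h5, -⟩ | ⟨h4, -⟩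
        · exact Or.inr (Or.inl ⟨h5, h4⟩)
        · exact Or.inr (Or.inr h4)
  · rw [balanceRows_of_not_conflict hC, risingSet, if_neg hC]
    by_cases hu : v ∈ upSet M N R v.1
    · exact Or.inl ⟨hd, hu, balanceTarget_of_up hd hu⟩
    refine Or.inr ⟨hd, hu, ?_⟩
    by_cases ha : AlignedUp M N R v ∨ AlignedDown M N R v
    · exact Or.inl (balanceTarget_of_aligned hd hu ha)
    · rcases balanceTarget_of_not_aligned hv hd hu ha with ⟨h4, h5, -⟩ | ⟨h4, -⟩
      · exact Or.inr (Or.inl ⟨h5, h4⟩)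
      · exact Or.inr (Or.inr h4)

theorem not_mem_upSet_corner (h : Guarded M N R) : (2, 1) ∉ upSet M N R 2 := by
  intro hu
  have hc := upSet_subset _ _ _ _ hu
  have hneg := surplus_neg_of_mem_upCandidates h.card hc
  norm_num at hneg
  have h1 := h.surplus_one
  have h2 := h.one_le_inRow_one
  have h3 := card_upCandidates M N R 2
  rw [numUp_eq h.card] at h3
  norm_num at h3
  have h4 : upCandidates M N R 2 = {(2, 1)} := by
    ext w
    rw [Finset.mem_singleton]
    exact ⟨fun hw => Finset.card_le_one.1 (by omega) w hw _ hc, fun e => e ▸ hc⟩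
  rw [upSet_eq, if_pos ⟨rfl, h4⟩] at hu
  simp at hu

theorem balanceRows_mem (h : Guarded M N R) (hv : v ∈ R) :
    (balanceRows M N R v = v ∨ (gridGraph M N).Adj v (balanceRows M N R v)) ∧
      (balanceRows M N R v ∈ corners M N → balanceRows M N R v = (1, (N : ℤ))) := by
  obtain ⟨h4M, h4N⟩ := h.four_le
  have hvc := h.subset hv
  have hv' := mem_cells.1 hvc
  have hrows := h.rows
  rcases h.balanceRows_cases hv with ⟨hd, e⟩ | ⟨-, hu, e⟩ | ⟨-, -, e | ⟨rfl, e⟩ | e⟩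
  · have h1 := h.row_of_surplus_pos (surplus_pos_of_mem_downSet hd)
    have h2 := (mem_eligible.1 (downSet_subset _ _ _ _ hd)).2.2.2
    rw [e]
    refine ⟨Or.inr ⟨hvc, by rw [mem_cells]; simp only []; omega, by simp [cellDist]⟩, fun hc => ?_⟩
    rw [mem_corners] at hc
    simp only [] at hc
    omega
  · have hu' := risingSet_subset _ _ _ _ hu
    have hneg := surplus_neg_of_mem_upCandidates h.card (upSet_subset _ _ _ _ hu')
    have h1 := h.row_of_surplus_neg hneg
    rw [e]
    refine ⟨Or.inr ⟨hvc, by rw [mem_cells]; simp only []; omega, by simp [cellDist]⟩, fun hc => ?_⟩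
    rw [mem_corners] at hc
    simp only [] at hc
    have hv1 : v.1 = 2 := by omega
    rcases hc.2 with h2 | h2
    · exfalso
      rw [hv1, show v = (2, 1) from Prod.ext hv1 h2] at hu'
      exact h.not_mem_upSet_corner hu'
    · rw [h2, hv1]; rfl
  · have hs := asideCol_spec h4N hv'.2.1 hv'.2.2
    rw [e]
    refine ⟨Or.inr ⟨hvc, by rw [mem_cells]; simp only []; omega, ?_⟩, fun hc => ?_⟩
    · simp only [cellDist, Int.abs_eq_natAbs]; omega
    · rw [mem_corners] at hc
      simp only [] at hc
      omega
  · rw [e]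
    refine ⟨Or.inr ⟨hvc, by rw [mem_cells]; simp only []; omega, by simp [cellDist]⟩, fun hc => ?_⟩
    rw [mem_corners] at hc
    simp only [] at hc
    omega
  · rw [e]
    exact ⟨Or.inl rfl, fun hc => h.corner _ hc hv⟩

theorem balanceRows_safe (h : Guarded M N R) : SafeMove M N R (balanceRows M N R) :=
  ⟨h.balanceRows_injOn, fun _ hv => (h.balanceRows_mem hv).1⟩

/-- The guard stays on its corner, or a robot from below replaces it. -/
theorem guard_mem_balanceRows (h : Guarded M N R) :
    (1, (N : ℤ)) ∈ R.image (balanceRows M N R) := by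
  obtain ⟨h4M, h4N⟩ := h.four_le
  have hne : ∀ l, (1, (N : ℤ)) ∉ eligible M N R l := fun l hg => (mem_eligible.1 hg).2.2.1 rfl
  have hd : (1, (N : ℤ)) ∉ downSet M N R 1 := fun hg => hne _ (downSet_subset _ _ _ _ hg)
  have hu : (1, (N : ℤ)) ∉ upSet M N R 1 := fun hg =>
    hne _ (upCandidates_subset _ _ _ _ (upSet_subset _ _ _ _ hg))
  have had : ¬ AlignedDown M N R (1, (N : ℤ)) :=
    not_alignedDown_of_surplus_nonpos (h.surplus_of_le_zero (by norm_num)).le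
  have hstay : ∀ w, w = (1, (N : ℤ)) → balanceRows M N R (1, (N : ℤ)) = w →
      (1, (N : ℤ)) ∈ R.image (balanceRows M N R) := fun w hw e => by
    rw [hw] at e
    exact Finset.mem_image.2 ⟨_, h.guard, e⟩
  by_cases hau : AlignedUp M N R (1, (N : ℤ))
  · by_cases hC : Conflict M N R
    · exact hstay _ rfl (balanceRows_of_conflict hC (Or.inr hau))
    · have hmem : (2, (N : ℤ)) ∈ upSet M N R 2 := by
        have : (1 + 1, (N : ℤ)) ∈ upSet M N R (1 + 1) := by rw [show _ = _ from hau]; simp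
        exact this
      refine Finset.mem_image.2 ⟨(2, (N : ℤ)), (mem_of_mem_upSet hmem).1, ?_⟩
      rw [balanceRows_of_not_conflict hC]
      exact balanceTarget_of_up
        (fun hg => h.not_up_of_down hg (upSet_subset _ _ _ _ hmem)) hmem
  · have hs : balanceRows M N R (1, (N : ℤ)) = (1, (N : ℤ)) := by
      rw [balanceRows_of_not_up (by tauto)]
      rcases balanceTarget_of_not_aligned h.guard hd hu (by tauto) with ⟨-, h5, -⟩ | ⟨h4, -⟩
      · simp at h5
      · exact h4
    exact hstay _ rfl hs

theorem of_safeMove {f : Cell → Cell} (h : Guarded M N R) (hf : SafeMove M N R f)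
    (hg : (1, (N : ℤ)) ∈ R.image f)
    (hc : ∀ v ∈ R, f v ∈ corners M N → f v = (1, (N : ℤ))) : Guarded M N (R.image f) where
  subset := hf.image_subset h.subset
  guard := hg
  corner := by
    intro c hcc hcR
    obtain ⟨v, hv, rfl⟩ := Finset.mem_image.1 hcR
    exact hc v hv hcc
  card := by rw [hf.card_image]; exact h.card
  rows := by rw [hf.card_image]; exact h.rows
  cols := by rw [hf.card_image]; exact h.cols

theorem image_balanceRows (h : Guarded M N R) : Guarded M N (R.image (balanceRows M N R)) :=
  h.of_safeMove h.balanceRows_safe h.guard_mem_balanceRows fun _ hv => (h.balanceRows_mem hv).2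

/-- The flow of robots between row `l` and row `l + 1`. -/
theorem surplus_balanceRows (h : Guarded M N R) (l : ℤ) :
    surplus N (R.image (balanceRows M N R)) l =
      surplus N R l - (downSet M N R l).card + (risingSet M N R (l + 1)).card := by
  have hinj := h.balanceRows_injOn
  rw [surplus, surplus, h.balanceRows_safe.card_image]
  have h1 : ((R.image (balanceRows M N R)).filter fun v => v.1 ≤ l).card =
      (R.filter fun v => (balanceRows M N R v).1 ≤ l).card := by
    rw [Finset.filter_image, Finset.card_image_of_injOn (hinj.mono (Finset.filter_subset _ _))]
  have h2 : (R.filter fun v => (balanceRows M N R v).1 ≤ l) ∪ downSet M N R l =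
      (R.filter fun v => v.1 ≤ l) ∪ risingSet M N R (l + 1) := by
    ext v
    simp only [Finset.mem_union, Finset.mem_filter]
    have hD : v ∈ downSet M N R l → v ∈ R ∧ v.1 = l := mem_of_mem_downSet
    have hU : v ∈ risingSet M N R (l + 1) → v ∈ R ∧ v.1 = l + 1 := fun hu =>
      mem_of_mem_upSet (risingSet_subset _ _ _ _ hu)
    by_cases hv : v ∈ R
    · rcases h.balanceRows_cases hv with ⟨hd, e⟩ | ⟨hd, hu, e⟩ | ⟨hd, hu, e⟩
      · have hu : v ∉ risingSet M N R v.1 := fun hu =>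
          h.not_up_of_down hd (upSet_subset _ _ _ _ (risingSet_subset _ _ _ _ hu))
        rw [e]
        by_cases hl : v.1 = l
        · subst hl
          simp [hv, hd]
        · constructor
          · rintro (h3 | h3)
            · exact Or.inl ⟨hv, by simp only [] at h3; omega⟩
            · exact absurd (hD h3).2 hl
          · rintro (h3 | h3)
            · exact Or.inl ⟨hv, by simp only []; omega⟩
            · exact absurd (by rwa [← (hU h3).2] at h3) hu
      · rw [e]
        by_cases hl : v.1 = l + 1
        · rw [hl] at hu
          simp [hv, hu, hl]
        · constructor
          · rintro (h3 | h3)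
            · exact Or.inl ⟨hv, by simp only [] at h3; omega⟩
            · exact absurd (by rwa [← (hD h3).2] at h3) hd
          · rintro (h3 | h3)
            · exact Or.inl ⟨hv, by simp only []; omega⟩
            · exact absurd (hU h3).2 hl
      · have er : (balanceRows M N R v).1 = v.1 := by
          rcases e with e | ⟨e', e⟩ | e
          · rw [e]
          · rw [e, e']
          · rw [e]
        rw [er]
        constructor
        · rintro (h3 | h3)
          · exact Or.inl h3
          · exact absurd (by rwa [← (hD h3).2] at h3) hd
        · rintro (h3 | h3)
          · exact Or.inl h3
          · exact absurd (by rwa [← (hU h3).2] at h3) hu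
    · constructor
      · rintro (h3 | h3)
        · exact absurd h3.1 hv
        · exact absurd (hD h3).1 hv
      · rintro (h3 | h3)
        · exact absurd h3.1 hv
        · exact absurd (hU h3).1 hv
  have h3 := congrArg Finset.card h2
  rw [Finset.card_union_of_disjoint, Finset.card_union_of_disjoint] at h3
  · omega
  · rw [Finset.disjoint_left]
    intro v hv hu
    have := (mem_of_mem_upSet (risingSet_subset _ _ _ _ hu)).2
    have := (Finset.mem_filter.1 hv).2
    omega
  · rw [Finset.disjoint_left]
    intro v hv hd
    obtain ⟨hvR, hvl⟩ := mem_of_mem_downSet hd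
    have h4 := (Finset.mem_filter.1 hv).2
    rw [← hvl] at hd h4
    rw [h.balanceRows_of_down hd] at h4
    simp only [] at h4
    omega

theorem downSet_eq_empty (hl : surplus N R l ≤ 0) : downSet M N R l = ∅ := by
  by_contra hne
  obtain ⟨v, hv⟩ := Finset.nonempty_iff_ne_empty.2 hne
  have := surplus_pos_of_mem_downSet hv
  omega

theorem risingSet_eq_empty (h : Guarded M N R) (hl : 0 ≤ surplus N R (l - 1)) :
    risingSet M N R l = ∅ := by
  by_contra hne
  obtain ⟨v, hv⟩ := Finset.nonempty_iff_ne_empty.2 hne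
  exact h.not_up_of_surplus_nonneg hl (risingSet_subset _ _ _ _ hv)

theorem card_risingSet_le (h : Guarded M N R) (l : ℤ) :
    (risingSet M N R l).card ≤ (-surplus N R (l - 1)).toNat := by
  have h1 := Finset.card_le_card ((risingSet_subset M N R l).trans (upSet_subset M N R l))
  rw [card_upCandidates, numUp_eq h.card] at h1
  omega

/-- A row without surplus above it sends all its surplus downward in one cycle, so the rows that
have no more robots to send downward advance by one. -/
theorem surplus_nonpos_step (h : Guarded M N R) {j : ℤ} (hj : ∀ i ≤ j, surplus N R i ≤ 0) :
    ∀ i ≤ j + 1, surplus N (R.image (balanceRows M N R)) i ≤ 0 := by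
  intro i hi
  rw [h.surplus_balanceRows]
  have h1 := h.card_risingSet_le (i + 1)
  rw [add_sub_cancel_right] at h1
  rcases le_or_gt (surplus N R i) 0 with h2 | h2
  · omega
  · have h3 := h.row_of_surplus_pos h2
    have h4 := h.inRow_target_eq h3.1 h3.2
    have h5 := surplus_succ N R i
    have h6 := inRow_le_card_eligible M N R i
    have h7 := card_downSet M N R i
    have h8 := card_eligible_le M N R i
    have h9 := hj (i - 1) (by omega)
    rw [numDown_eq] at h7
    omega

/-- Without downward moves, two targets coincide only where a robot steps aside below the upper
left corner. -/
theorem stuck_of_conflict (h : Guarded M N R) (hP : ∀ i, surplus N R i ≤ 0)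
    (hC : Conflict M N R) : StuckBelowCorner N R ∧ ¬ AlignedUp M N R (2, 1) := by
  by_contra hS
  obtain ⟨h4M, h4N⟩ := h.four_le
  obtain ⟨a, ha, b, hb, hne, hab⟩ := hC
  have hD : ∀ v l, v ∉ downSet M N R l := fun v l hv => by
    rw [downSet_eq_empty (hP l)] at hv
    simp at hv
  have hAD : ∀ v, ¬ AlignedDown M N R v := fun v => not_alignedDown_of_surplus_nonpos (hP _)
  have hrow : ∀ v ∈ R, v ∉ upSet M N R v.1 → (AlignedUp M N R v ∧
      balanceTarget M N R v = (v.1, asideCol N v.2)) ∨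
      (¬ AlignedUp M N R v ∧ balanceTarget M N R v = v) := by
    intro v hv hu
    by_cases hau : AlignedUp M N R v
    · exact Or.inl ⟨hau, balanceTarget_of_aligned (hD _ _) hu (Or.inl hau)⟩
    · rcases balanceTarget_of_not_aligned hv (hD _ _) hu (by have := hAD v; tauto) with
        ⟨-, rfl, h6⟩ | ⟨h4, -⟩
      · exact absurd ⟨h6, hau⟩ hS
      · exact Or.inr ⟨hau, h4⟩
  have hUC : ∀ v, v ∉ upSet M N R v.1 →
      v ∉ upCandidates M N R v.1 ∨ (v = (2, 1) ∧ StuckBelowCorner N R) := by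
    intro v hv
    rw [upSet_eq] at hv
    split_ifs at hv with h1
    · have h2 := h.of_upCandidates_eq (h1.1 ▸ h1.2)
      by_cases h3 : v = (2, 1)
      · exact Or.inr ⟨h3, h2.2.2.2, h2.1, h2.2.2.1⟩
      · left
        rw [h1.2]
        simpa using h3
    · exact Or.inl hv
  -- a robot that moves up, and a robot of the next row
  have key1 : ∀ a ∈ R, ∀ b ∈ R, a ∈ upSet M N R a.1 → b ∉ upSet M N R b.1 →
      balanceTarget M N R a ≠ balanceTarget M N R b := by
    intro a ha b hb hu hu' hab
    rw [balanceTarget_of_up (hD _ _) hu] at hab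
    have hneg := surplus_neg_of_mem_upCandidates h.card (upSet_subset _ _ _ _ hu)
    have hrow1 := h.row_of_surplus_neg hneg
    have hb' := mem_cells.1 (h.subset hb)
    rcases hrow b hb hu' with ⟨h1, h2⟩ | ⟨h1, h2⟩
    · rw [h2, Prod.mk.injEq] at hab
      have h3 : a ∈ upSet M N R (b.1 + 1) := by rwa [← hab.1, sub_add_cancel]
      rw [h1, Finset.mem_singleton] at h3
      have e := congrArg Prod.snd h3
      simp only [] at e
      have := asideCol_spec h4N hb'.2.1 hb'.2.2
      omega
    · rw [h2] at hab
      have e1 : b.1 = a.1 - 1 := by rw [← hab]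
      have e2 : b.2 = a.2 := by rw [← hab]
      have ha1 : a.1 = b.1 + 1 := by omega
      have hs : surplus N R b.1 = -1 := by
        rcases eq_or_lt_of_le hb'.1.1 with h3 | h3
        · have h4 := h.surplus_one
          have h5 := h.one_le_inRow_one
          rw [← e1, ← h3] at hneg
          rw [← h3]
          omega
        · have hel : b ∈ eligible M N R b.1 := by
            rcases h.mem_eligible_or hb (by omega) with h4 | ⟨h4, h5⟩
            · exact h4
            · have := (mem_eligible.1 (upCandidates_subset _ _ _ _ (upSet_subset _ _ _ _ hu))).2.2.2
              rw [e2] at h5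
              omega
          rcases hUC b hu' with h4 | ⟨rfl, h4⟩
          · exact (h.rest_up (e1 ▸ hneg) hel h4).1
          · exact absurd ⟨h4, h1⟩ hS
      apply h1
      have h3 := h.upSet_eq_singleton (l := b.1 + 1) (by rwa [add_sub_cancel_right])
        (by rwa [← ha1] : a ∈ upSet M N R (b.1 + 1))
      rw [AlignedUp, h3]
      congr 1
      exact Prod.ext ha1 e2.symm
  -- a robot that steps aside, and another one of its row
  have key2 : ∀ a ∈ R, ∀ b ∈ R, a ∉ upSet M N R a.1 → b ∉ upSet M N R b.1 → a ≠ b →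
      AlignedUp M N R a → balanceTarget M N R a ≠ balanceTarget M N R b := by
    intro a ha b hb hua hub hne hA hab
    have hr : a.1 = b.1 := by
      have e1 : (balanceTarget M N R a).1 = a.1 := by
        rcases hrow a ha hua with ⟨-, h1⟩ | ⟨-, h1⟩ <;> rw [h1]
      have e2 : (balanceTarget M N R b).1 = b.1 := by
        rcases hrow b hb hub with ⟨-, h1⟩ | ⟨-, h1⟩ <;> rw [h1]
      rw [← e1, ← e2, hab]
    have hmem : (a.1 + 1, a.2) ∈ upSet M N R (a.1 + 1) := by rw [hA]; simp
    have hneg := surplus_neg_of_mem_upCandidates h.card (upSet_subset _ _ _ _ hmem)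
    rw [add_sub_cancel_right] at hneg
    have ha' := mem_cells.1 (h.subset ha)
    have hb' := mem_cells.1 (h.subset hb)
    rcases eq_or_lt_of_le ha'.1.1 with h3 | h3
    · have h4 := h.surplus_one
      have h5 := h.one_le_inRow_one
      rw [← h3] at hneg
      exact hne (eq_of_inRow_eq_one (by rw [← hr, ← h3]; omega) ha hb hr)
    · have hE := (mem_eligible.1 (upCandidates_subset _ _ _ _ (upSet_subset _ _ _ _ hmem))).2.2.2
      simp only [] at hE
      have hel : a ∈ eligible M N R a.1 := by
        rcases h.mem_eligible_or ha (by omega) with h4 | ⟨h4, h5⟩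
        · exact h4
        · omega
      have hua' : a ∉ upCandidates M N R a.1 := by
        rcases hUC a hua with h4 | ⟨rfl, h4⟩
        · exact h4
        · exact absurd (eq_of_inRow_eq_one h4.2.2 hb ha hr.symm).symm hne
      have hub' : b ∉ upCandidates M N R b.1 := by
        rcases hUC b hub with h4 | ⟨rfl, h4⟩
        · exact h4
        · exact absurd (eq_of_inRow_eq_one h4.2.2 ha hb hr) hne
      have h6 := (h.rest_up hneg hel hua').2
      have hbel : b ∉ eligible M N R b.1 := fun hbel =>
        hne (h6 b (by rwa [hr]) (by rw [hr]; exact hub')).symm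
      have hbc : M = (R.card + 1) / 2 ∧ (b.2 = 1 ∨ b.2 = N) := by
        rcases h.mem_eligible_or hb (by omega) with h5 | h5
        · exact absurd h5 hbel
        · exact h5
      have hs := asideCol_spec h4N ha'.2.1 ha'.2.2
      rw [balanceTarget_of_aligned (hD _ _) hua (Or.inl hA)] at hab
      rcases hrow b hb hub with ⟨h7, h8⟩ | ⟨h7, h8⟩
      · have hmem' : (b.1 + 1, b.2) ∈ upSet M N R (b.1 + 1) := by rw [h7]; simp
        have hE' := (mem_eligible.1 (upCandidates_subset _ _ _ _ (upSet_subset _ _ _ _ hmem'))).2.2.2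
        simp only [] at hE'
        omega
      · rw [h8] at hab
        have e := congrArg Prod.snd hab
        simp only [] at e
        omega
  by_cases hua : a ∈ upSet M N R a.1 <;> by_cases hub : b ∈ upSet M N R b.1
  · rw [balanceTarget_of_up (hD _ _) hua, balanceTarget_of_up (hD _ _) hub, Prod.mk.injEq] at hab
    exact hne (Prod.ext (by omega) hab.2)
  · exact key1 a ha b hb hua hub hab
  · exact key1 b hb a ha hub hua hab.symm
  · rcases hrow a ha hua with ⟨h1, h2⟩ | ⟨-, h2⟩
    · exact key2 a ha b hb hua hub hne h1 hab
    · rcases hrow b hb hub with ⟨h3, h4⟩ | ⟨-, h4⟩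
      · exact key2 b hb a ha hub hua hne.symm h3 hab.symm
      · exact hne (h2 ▸ h4 ▸ hab)

/-- Without a conflict, the lowest row with a missing surplus above it sends all its surplus
upward in one cycle. -/
theorem surplus_zero_step (h : Guarded M N R) (hP : ∀ i, surplus N R i ≤ 0)
    (hC : ¬ Conflict M N R) {j : ℤ} (hj : ∀ i ≥ j, surplus N R i = 0) :
    ∀ i ≥ j - 1, surplus N (R.image (balanceRows M N R)) i = 0 := by
  intro i hi
  rw [h.surplus_balanceRows, downSet_eq_empty (hP i)]
  rcases eq_or_lt_of_le (hP i) with h1 | h1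
  · rw [h.risingSet_eq_empty (by rw [add_sub_cancel_right]; omega), h1]
    simp
  · have h2 : surplus N R (i + 1) = 0 := hj _ (by omega)
    have h3 := surplus_succ N R (i + 1)
    rw [add_sub_cancel_right] at h3
    have h4 := h.row_of_surplus_neg h1
    have hrows := h.rows
    have h5 : (inRow R (i + 1) : ℤ) ≤
        (eligible M N R (i + 1)).card + inRow (target R.card N) (i + 1) := by
      rcases lt_or_ge (i + 1) (((R.card + 1) / 2 : ℕ) : ℤ) with h6 | h6
      · have := inRow_le_card_eligible M N R (i + 1)
        have := h.inRow_target_eq (by omega) h6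
        omega
      · have : (R.filter fun v => v.1 = i + 1) ⊆ eligible M N R (i + 1) := by
          intro v hv
          obtain ⟨hv, hvi⟩ := Finset.mem_filter.1 hv
          rcases h.mem_eligible_or hv (by omega) with h7 | ⟨h7, h8⟩
          · rwa [hvi] at h7
          · have hv' := mem_cells.1 (h.subset hv)
            have := congrArg Prod.fst (h.corner v (mem_corners.2 ⟨by omega, h8⟩) hv)
            simp only [] at this
            omega
        have := Finset.card_le_card this
        unfold inRow at *
        omega
    have h6 := card_upCandidates M N R (i + 1)
    rw [numUp_eq h.card, add_sub_cancel_right] at h6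
    have h7 : risingSet M N R (i + 1) = upCandidates M N R (i + 1) := by
      rw [risingSet, if_neg hC, upSet_eq, if_neg]
      rintro ⟨h8, h9⟩
      rw [h8] at h9
      obtain ⟨-, h10, h11, -⟩ := h.of_upCandidates_eq h9
      have h12 := h.inRow_target_eq (l := 2) (by norm_num) (by have := h.card; omega)
      rw [h8] at h2 h3
      rw [show i = 1 by omega] at h3
      omega
    rw [h7, h6]
    simp only [Finset.card_empty]
    omega

theorem surplus_eq_of_conflict (h : Guarded M N R) (hP : ∀ i, surplus N R i ≤ 0)
    (hC : Conflict M N R) (i : ℤ) :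
    surplus N (R.image (balanceRows M N R)) i = surplus N R i := by
  rw [h.surplus_balanceRows, downSet_eq_empty (hP i), risingSet, if_pos hC]
  simp

/-- No robot is stuck below the corner, now or later. -/
def Unstuck (M N : ℕ) (R : Finset Cell) : Prop :=
  surplus N R 1 = 0 ∨ ∃ v ∈ eligible M N R 2, v.2 ≠ 1

theorem Unstuck.not_conflict (h : Guarded M N R) (hP : ∀ i, surplus N R i ≤ 0)
    (hU : Unstuck M N R) : ¬ Conflict M N R := by
  intro hC
  obtain ⟨⟨h1, h2, h3⟩, -⟩ := h.stuck_of_conflict hP hC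
  rcases hU with h4 | ⟨v, hv, hv2⟩
  · rw [numUp_eq h.card] at h1
    norm_num [h4] at h1
  · rw [mem_eligible] at hv
    have := eq_of_inRow_eq_one (v := (2, 1)) h3 hv.1 h2 hv.2.1
    exact hv2 (by rw [this])

theorem Unstuck.step (h : Guarded M N R) (hP : ∀ i, surplus N R i ≤ 0)
    (hU : Unstuck M N R) : Unstuck M N (R.image (balanceRows M N R)) := by
  left
  have hC := hU.not_conflict h hP
  rw [h.surplus_balanceRows, downSet_eq_empty (hP 1)]
  by_cases h1 : surplus N R 1 = 0
  · rw [h.risingSet_eq_empty (by norm_num [h1]), h1]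
    simp
  · have h2 := hP 1
    have h3 := h.surplus_one
    have h4 := h.one_le_inRow_one
    have h5 := h.card_risingSet_le 2
    norm_num at h5
    rcases hU with h6 | ⟨v, hv, hv2⟩
    · exact absurd h6 h1
    · have h6 : risingSet M N R 2 = upCandidates M N R 2 := by
        rw [risingSet, if_neg hC, upSet_eq, if_neg]
        rintro ⟨-, h9⟩
        obtain ⟨h10, -, h11, -⟩ := h.of_upCandidates_eq h9
        rw [mem_eligible] at hv
        exact hv2 (by rw [eq_of_inRow_eq_one (v := (2, 1)) h11 hv.1 h10 hv.2.1])
      have h7 := card_upCandidates M N R 2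
      rw [numUp_eq h.card] at h7
      norm_num at h7
      have h8 : 0 < (eligible M N R 2).card := Finset.card_pos.2 ⟨v, hv⟩
      have h9 := card_eligible_le M N R 2
      norm_num
      rw [h6] at h5 ⊢
      omega

/-- A conflict resolves the situation that has caused it. -/
theorem Unstuck.of_conflict (h : Guarded M N R) (hP : ∀ i, surplus N R i ≤ 0)
    (hC : Conflict M N R) : Unstuck M N (R.image (balanceRows M N R)) := by
  obtain ⟨⟨h1, h2, h3⟩, hau⟩ := h.stuck_of_conflict hP hC
  obtain ⟨h4M, h4N⟩ := h.four_le
  right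
  have hd : (2, 1) ∉ downSet M N R 2 := by rw [downSet_eq_empty (hP 2)]; simp
  have hu : (2, 1) ∉ upSet M N R 2 := h.not_mem_upSet_corner
  have had : ¬ AlignedDown M N R (2, 1) := not_alignedDown_of_surplus_nonpos (hP _)
  have e : balanceRows M N R (2, 1) = (2, 2) := by
    rw [balanceRows_of_not_up (by tauto)]
    rcases balanceTarget_of_not_aligned h2 hd hu (by tauto) with ⟨h5, -⟩ | ⟨-, h5⟩
    · exact h5
    · exact absurd ⟨rfl, h1, h2, h3⟩ h5
  refine ⟨(2, 2), mem_eligible.2 ⟨Finset.mem_image.2 ⟨_, h2, e⟩, rfl, by simp, Or.inr ?_⟩, by simp⟩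
  simp only []
  omega

theorem rowsBalanced_iff (h : Guarded M N R) : RowsBalanced M N R ↔ ∀ l, surplus N R l = 0 := by
  constructor
  · intro hB l
    rcases lt_or_ge l 1 with h1 | h1
    · exact h.surplus_of_le_zero (by omega)
    · rcases lt_or_ge l M with h2 | h2
      · have h3 := (hB l (Finset.mem_Icc.2 ⟨h1, h2.le⟩)).1
        have h4 := (hB (l + 1) (Finset.mem_Icc.2 ⟨by omega, by omega⟩)).2
        rw [excessAbove_eq] at h3
        rw [excessBelow_eq h.card, add_sub_cancel_right] at h4
        omega
      · have h3 := h.surplus_nonneg_of_forall_le (l := l) fun v hv => by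
          have := mem_cells.1 (h.subset hv)
          omega
        have h4 := h.surplus_nonpos_of_ge (l := l) (by have := h.rows; omega)
        omega
  · intro hs l _
    rw [excessAbove_eq, excessBelow_eq h.card, hs, hs]
    simp

end Guarded

/-! ### Row-wise placement -/

/-- The column of the target of `v` when the rows are balanced. -/
noncomputable def goalCol (N : ℕ) (R : Finset Cell) (v : Cell) : ℤ :=
  N - ((R.card + 1) / 2 : ℕ) + if ∀ u ∈ R, u.1 = v.1 → u.2 ≤ v.2 then
    rightCol ((R.card + 1) / 2 : ℕ) v.1 else leftCol ((R.card + 1) / 2 : ℕ) v.1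

theorem sign_cases (x : ℤ) :
    (0 < x ∧ Int.sign x = 1) ∨ (x = 0 ∧ Int.sign x = 0) ∨ (x < 0 ∧ Int.sign x = -1) := by
  rcases lt_trichotomy x 0 with h | h | h
  · exact Or.inr (Or.inr ⟨h, Int.sign_eq_neg_one_of_neg h⟩)
  · exact Or.inr (Or.inl ⟨h, by simp [h]⟩)
  · exact Or.inl ⟨h, Int.sign_eq_one_of_pos h⟩

theorem max_unbotD_eq {s : Finset ℤ} {m d : ℤ} (hm : m ∈ s) (h : ∀ x ∈ s, x ≤ m) :
    s.max.unbotD d = m := by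
  have : s.max = m := le_antisymm (Finset.max_le fun a ha => WithBot.coe_le_coe.2 (h a ha))
    (Finset.le_max hm)
  rw [this]; rfl

theorem min_untopD_eq {s : Finset ℤ} {m d : ℤ} (hm : m ∈ s) (h : ∀ x ∈ s, m ≤ x) :
    s.min.untopD d = m := by
  have : s.min = m := le_antisymm (Finset.min_le hm)
    (Finset.le_min fun a ha => WithTop.coe_le_coe.2 (h a ha))
  rw [this]; rfl

theorem surplus_image_of_row {M N : ℕ} {R : Finset Cell} {f : Cell → Cell}
    (hf : SafeMove M N R f) (hr : ∀ v ∈ R, (f v).1 = v.1) (l : ℤ) :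
    surplus N (R.image f) l = surplus N R l := by
  rw [surplus, surplus, hf.card_image, Finset.filter_image,
    Finset.card_image_of_injOn (hf.injOn.mono (Finset.filter_subset _ _))]
  congr 3
  exact Finset.filter_congr fun v hv => by rw [hr v hv]

namespace Guarded

variable {M N : ℕ} {R : Finset Cell} {l : ℤ} {u v : Cell}

theorem inRow_eq_of_balanced (h : Guarded M N R) (hB : RowsBalanced M N R) (l : ℤ) :
    inRow R l = inRow (target R.card N) l := by
  rw [h.rowsBalanced_iff] at hB
  have := surplus_succ N R l
  rw [hB, hB] at this
  omega

theorem row_bounds_of_balanced (h : Guarded M N R) (hB : RowsBalanced M N R) (hv : v ∈ R) :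
    1 ≤ v.1 ∧ v.1 ≤ ((R.card + 1) / 2 : ℕ) := by
  have h1 := inRow_pos hv
  rw [h.inRow_eq_of_balanced hB, inRow_target h.card] at h1
  by_contra h2
  rw [if_neg h2] at h1
  exact lt_irrefl _ h1

theorem mem_target_row {n : ℕ} (hn : 7 ≤ n) {a b k : ℤ} (hk : k = ((n + 1) / 2 : ℕ)) :
    (a, b) ∈ target n N ↔ (1 ≤ a ∧ a ≤ k) ∧
      ((b = N - k + leftCol k a ∧ (a = k → Even n)) ∨ b = N - k + rightCol k a) := by
  rw [mem_target, ← hk, mem_pattern_iff_cols hn hk]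
  have e1 : b - N + k = leftCol k a ↔ b = N - k + leftCol k a := by constructor <;> intro <;> omega
  have e2 : b - N + k = rightCol k a ↔ b = N - k + rightCol k a := by
    constructor <;> intro <;> omega
  rw [e1, e2]

/-- A row with a robot that is not the rightmost one has two targets. -/
theorem even_of_not_rightmost (h : Guarded M N R) (hB : RowsBalanced M N R) (hv : v ∈ R)
    (hr : ¬ ∀ u ∈ R, u.1 = v.1 → u.2 ≤ v.2) :
    (v.1 = ((R.card + 1) / 2 : ℕ) → Even R.card) ∧ inRow R v.1 ≤ 2 := by
  push Not at hr
  obtain ⟨u, hu, hu1, hu2⟩ := hr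
  have h1 : 1 < inRow R v.1 := by
    apply Finset.one_lt_card.2
    exact ⟨u, Finset.mem_filter.2 ⟨hu, hu1⟩, v, Finset.mem_filter.2 ⟨hv, rfl⟩,
      fun e => by rw [e] at hu2; exact lt_irrefl _ hu2⟩
  have h2 := h.inRow_target_le v.1
  rw [h.inRow_eq_of_balanced hB] at h1 ⊢
  refine ⟨fun e => ?_, h2⟩
  by_contra hodd
  rw [inRow_target h.card] at h1
  split_ifs at h1 <;> first | omega | tauto

theorem placeInRows_eq (h : Guarded M N R) (hB : RowsBalanced M N R) (hv : v ∈ R) :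
    placeInRows M N R v = if v = (1, (N : ℤ)) then v else
      (v.1, v.2 + Int.sign (goalCol N R v - v.2)) := by
  obtain ⟨k, hk⟩ : ∃ k : ℤ, k = ((R.card + 1) / 2 : ℕ) := ⟨_, rfl⟩
  have hrow := h.row_bounds_of_balanced hB hv
  rw [← hk] at hrow
  have hcols : ∀ x, x ∈ ((target R.card N).filter fun u => u.1 = v.1).image Prod.snd ↔
      ((x = N - k + leftCol k v.1 ∧ (v.1 = k → Even R.card)) ∨ x = N - k + rightCol k v.1) := by
    intro x
    rw [Finset.mem_image]
    constructor
    · rintro ⟨⟨a, b⟩, hw, rfl⟩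
      obtain ⟨hw, rfl⟩ := Finset.mem_filter.1 hw
      exact ((mem_target_row h.card hk).1 hw).2
    · intro hx
      exact ⟨(v.1, x), Finset.mem_filter.2 ⟨(mem_target_row h.card hk).2 ⟨hrow, hx⟩, rfl⟩, rfl⟩
  have hlt := leftCol_lt_rightCol (k := k) (by have := h.card; omega) hrow.1 hrow.2
  rw [placeInRows]
  congr 3
  congr 1
  rw [goalCol, ← hk]
  split_ifs with hr
  · congr 1
    exact max_unbotD_eq ((hcols _).2 (Or.inr rfl)) fun x hx => by
      rcases (hcols x).1 hx with ⟨e, -⟩ | e <;> omega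
  · congr 1
    exact min_untopD_eq ((hcols _).2 (Or.inl ⟨rfl, by
      have := (h.even_of_not_rightmost hB hv hr).1; rwa [← hk] at this⟩)) fun x hx => by
      rcases (hcols x).1 hx with ⟨e, -⟩ | e <;> omega

theorem goalCol_lt (h : Guarded M N R) (hB : RowsBalanced M N R) (hu : u ∈ R) (hv : v ∈ R)
    (huv : u.1 = v.1) (hlt : u.2 < v.2) : goalCol N R u < goalCol N R v := by
  have hrow := h.row_bounds_of_balanced hB hu
  have hur : ¬ ∀ w ∈ R, w.1 = u.1 → w.2 ≤ u.2 := fun hr => by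
    have := hr v hv huv.symm
    omega
  have hvr : ∀ w ∈ R, w.1 = v.1 → w.2 ≤ v.2 := by
    intro w hw hwv
    by_contra hc
    have h1 := (h.even_of_not_rightmost hB hu hur).2
    have h2 : ({u, v, w} : Finset Cell) ⊆ R.filter fun x => x.1 = u.1 := by
      intro x hx
      simp only [Finset.mem_insert, Finset.mem_singleton] at hx
      rcases hx with rfl | rfl | rfl
      · exact Finset.mem_filter.2 ⟨hu, rfl⟩
      · exact Finset.mem_filter.2 ⟨hv, huv.symm⟩
      · exact Finset.mem_filter.2 ⟨hw, hwv.trans huv.symm⟩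
    have h3 := Finset.card_le_card h2
    rw [Finset.card_eq_three.2 ⟨u, v, w, fun e => by rw [e] at hlt; omega,
      fun e => by rw [e] at hlt; omega, fun e => by rw [e] at hc; omega, rfl⟩] at h3
    unfold inRow at h1
    omega
  rw [goalCol, goalCol, if_neg hur, if_pos hvr, ← huv]
  have := leftCol_lt_rightCol (k := ((R.card + 1) / 2 : ℕ)) (by have := h.card; omega) hrow.1 hrow.2
  omega

theorem goalCol_le (h : Guarded M N R) (hB : RowsBalanced M N R) (hv : v ∈ R) :
    (N : ℤ) - ((R.card + 1) / 2 : ℕ) + 1 ≤ goalCol N R v ∧ goalCol N R v ≤ N := by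
  have hrow := h.row_bounds_of_balanced hB hv
  have hk : (4 : ℤ) ≤ ((R.card + 1) / 2 : ℕ) := by have := h.card; omega
  have h1 := cols_bounds hk hrow.1 hrow.2
  have h2 := leftCol_lt_rightCol hk hrow.1 hrow.2
  unfold goalCol
  split_ifs <;> omega

/-- The order of the robots in a row does not change. -/
theorem placeInRows_lt (h : Guarded M N R) (hB : RowsBalanced M N R) (hu : u ∈ R) (hv : v ∈ R)
    (huv : u.1 = v.1) (hlt : u.2 < v.2) :
    (placeInRows M N R u).2 < (placeInRows M N R v).2 := by
  have h1 := h.goalCol_lt hB hu hv huv hlt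
  have h2 := (h.goalCol_le hB hv).2
  have h3 := mem_cells.1 (h.subset hv)
  rw [h.placeInRows_eq hB hu, h.placeInRows_eq hB hv,
    if_neg fun e => by rw [e] at hlt; simp only [] at hlt; omega]
  rcases sign_cases (goalCol N R u - u.2) with ⟨a1, a2⟩ | ⟨a1, a2⟩ | ⟨a1, a2⟩ <;>
    rcases sign_cases (goalCol N R v - v.2) with ⟨b1, b2⟩ | ⟨b1, b2⟩ | ⟨b1, b2⟩ <;>
    rw [a2, b2] <;> split_ifs with h4 <;> simp only [] <;>
    first | omega | (have := congrArg Prod.snd h4; simp only [] at this; omega)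

theorem placeInRows_row (h : Guarded M N R) (hB : RowsBalanced M N R) (hv : v ∈ R) :
    (placeInRows M N R v).1 = v.1 := by
  rw [h.placeInRows_eq hB hv]
  split_ifs <;> rfl

theorem placeInRows_guard (h : Guarded M N R) (hB : RowsBalanced M N R) :
    placeInRows M N R (1, (N : ℤ)) = (1, (N : ℤ)) := by
  rw [h.placeInRows_eq hB h.guard, if_pos rfl]

theorem goalCol_of_row_one (h : Guarded M N R) (hv : v ∈ R) (hrow : v.1 = 1)
    (hg : v ≠ (1, (N : ℤ))) : goalCol N R v = N - 2 := by
  have hv' := mem_cells.1 (h.subset hv)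
  have hr : ¬ ∀ u ∈ R, u.1 = v.1 → u.2 ≤ v.2 := fun hr => by
    have := hr _ h.guard hrow.symm
    simp only [] at this
    exact hg (Prod.ext hrow (by simp only []; omega))
  rw [goalCol, if_neg hr, hrow, leftCol, if_pos (by have := h.card; omega)]
  ring

theorem placeInRows_safe (h : Guarded M N R) (hB : RowsBalanced M N R) :
    SafeMove M N R (placeInRows M N R) := by
  constructor
  · intro a ha b hb hab
    have hr : a.1 = b.1 := by
      rw [← h.placeInRows_row hB ha, ← h.placeInRows_row hB hb, hab]
    rcases lt_trichotomy a.2 b.2 with h1 | h1 | h1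
    · have := h.placeInRows_lt hB ha hb hr h1
      rw [hab] at this
      exact absurd this (lt_irrefl _)
    · exact Prod.ext hr h1
    · have := h.placeInRows_lt hB hb ha hr.symm h1
      rw [hab] at this
      exact absurd this (lt_irrefl _)
  · intro v hv
    have hv' := mem_cells.1 (h.subset hv)
    have hg := h.goalCol_le hB hv
    have hk := h.cols
    rw [h.placeInRows_eq hB hv]
    split_ifs with h1
    · exact Or.inl rfl
    · rcases sign_cases (goalCol N R v - v.2) with ⟨a1, a2⟩ | ⟨a1, a2⟩ | ⟨a1, a2⟩ <;> rw [a2]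
      · right
        refine ⟨h.subset hv, mem_cells.2 ?_, by simp [cellDist]⟩
        simp only []
        omega
      · left
        exact Prod.ext rfl (add_zero _)
      · right
        refine ⟨h.subset hv, mem_cells.2 ?_, by simp [cellDist]⟩
        simp only []
        omega

theorem image_placeInRows (h : Guarded M N R) (hB : RowsBalanced M N R) :
    Guarded M N (R.image (placeInRows M N R)) := by
  refine h.of_safeMove (h.placeInRows_safe hB)
    (Finset.mem_image.2 ⟨_, h.guard, h.placeInRows_guard hB⟩) fun v hv hc => ?_
  by_cases hg : v = (1, (N : ℤ))
  · rw [hg, h.placeInRows_guard hB]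
  exfalso
  obtain ⟨h4M, h4N⟩ := h.four_le
  have hv' := mem_cells.1 (h.subset hv)
  have hnc : v ∉ corners M N := fun hvc => hg (h.corner v hvc hv)
  have hrow := h.row_bounds_of_balanced hB hv
  have hrows := h.rows
  have hcols := h.cols
  rw [h.placeInRows_eq hB hv, if_neg hg] at hc
  rw [mem_corners] at hnc hc
  simp only [] at hc
  have hgoal : 2 ≤ goalCol N R v ∧ goalCol N R v ≤ N - 1 := by
    rcases hc.1 with h1 | h1
    · rw [h.goalCol_of_row_one hv h1 hg]
      omega
    · have hk : v.1 = ((R.card + 1) / 2 : ℕ) := by omega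
      have hcard := h.card
      rw [goalCol, hk, leftCol, rightCol]
      split_ifs <;> omega
  rcases sign_cases (goalCol N R v - v.2) with ⟨a1, a2⟩ | ⟨a1, a2⟩ | ⟨a1, a2⟩ <;> rw [a2] at hc <;>
    omega

theorem goalCol_placeInRows (h : Guarded M N R) (hB : RowsBalanced M N R) (hv : v ∈ R) :
    goalCol N (R.image (placeInRows M N R)) (placeInRows M N R v) = goalCol N R v := by
  rw [goalCol, goalCol, (h.placeInRows_safe hB).card_image, h.placeInRows_row hB hv]
  congr 1
  refine if_congr ?_ rfl rfl
  rw [Finset.forall_mem_image]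
  refine forall₂_congr fun u hu => ?_
  rw [h.placeInRows_row hB hu]
  refine imp_congr_right fun huv => ?_
  rcases lt_trichotomy u.2 v.2 with h1 | h1 | h1
  · have := h.placeInRows_lt hB hu hv huv h1
    constructor <;> intro <;> omega
  · rw [show u = v from Prod.ext huv h1]
    simp
  · have := h.placeInRows_lt hB hv hu huv.symm h1
    constructor <;> intro <;> omega

/-- All robots but the guard are at distance at most `m` from their targets. -/
def Close (N : ℕ) (R : Finset Cell) (m : ℕ) : Prop :=
  ∀ v ∈ R, v ≠ (1, (N : ℤ)) → |goalCol N R v - v.2| ≤ m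

theorem close_placeInRows (h : Guarded M N R) (hB : RowsBalanced M N R) {m : ℕ}
    (hm : Close N R (m + 1)) : Close N (R.image (placeInRows M N R)) m := by
  unfold Close
  rw [Finset.forall_mem_image]
  intro v hv hg
  have hg' : v ≠ (1, (N : ℤ)) := by
    rintro rfl
    exact hg (h.placeInRows_guard hB)
  rw [h.goalCol_placeInRows hB hv, h.placeInRows_eq hB hv, if_neg hg']
  have := hm v hv hg'
  rw [Int.abs_eq_natAbs] at this ⊢
  rcases sign_cases (goalCol N R v - v.2) with ⟨a1, a2⟩ | ⟨a1, a2⟩ | ⟨a1, a2⟩ <;> rw [a2] <;>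
    simp only [] <;> omega

theorem target_guard (h : Guarded M N R) :
    (1, (N : ℤ) - 1) ∈ target R.card N ∧ (1, (N : ℤ)) ∉ target R.card N := by
  have hk := h.card
  rw [mem_target_row h.card rfl, mem_target_row h.card rfl]
  unfold leftCol rightCol
  split_ifs <;> omega

theorem placed_of_close (h : Guarded M N R) (hB : RowsBalanced M N R) (hm : Close N R 0) :
    AllButGuardPlaced N R := by
  apply Finset.eq_of_subset_of_card_le
  · intro v hv
    obtain ⟨hg, hv⟩ := Finset.mem_erase.1 hv
    have h1 := hm v hv hg
    rw [Int.abs_eq_natAbs] at h1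
    have h2 : v.2 = goalCol N R v := by omega
    have hrow := h.row_bounds_of_balanced hB hv
    rw [Finset.mem_erase]
    constructor
    · rintro rfl
      have := h.goalCol_of_row_one hv rfl hg
      simp only [] at h2
      omega
    · refine (mem_target_row h.card rfl).2 ⟨hrow, ?_⟩
      rw [h2, goalCol]
      split_ifs with hr
      · exact Or.inr rfl
      · exact Or.inl ⟨rfl, (h.even_of_not_rightmost hB hv hr).1⟩
  · rw [Finset.card_erase_of_mem h.guard, Finset.card_erase_of_mem h.target_guard.1,
      card_target h.card]

/-! ### From a guard to the pattern -/

theorem moveGuard_of_placed (h : Guarded M N R) (hA : AllButGuardPlaced N R) :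
    SafeMove M N R (moveGuard M N R) ∧ R.image (moveGuard M N R) = target R.card N := by
  obtain ⟨h4M, h4N⟩ := h.four_le
  have hnot : (1, (N : ℤ) - 1) ∉ R := by
    intro hm
    have : (1, (N : ℤ) - 1) ∈ R.erase (1, (N : ℤ)) := Finset.mem_erase.2 ⟨by simp, hm⟩
    rw [show _ = _ from hA] at this
    exact (Finset.mem_erase.1 this).1 rfl
  refine ⟨⟨?_, ?_⟩, ?_⟩
  · intro a ha b hb hab
    simp only [moveGuard] at hab
    split_ifs at hab with h1 h2 h2
    · rw [h1, h2]
    · exact absurd (hab ▸ hb) hnot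
    · exact absurd (hab ▸ ha) hnot
    · exact hab
  · intro v hv
    simp only [moveGuard]
    split_ifs with h1
    · right
      rw [h1]
      exact ⟨h.subset h.guard, mem_cells.2 (by simp only []; omega), by simp [cellDist]⟩
    · exact Or.inl rfl
  · rw [← Finset.insert_erase h.target_guard.1, ← show _ = _ from hA]
    rw [show R.image (moveGuard M N R) =
        (insert (1, (N : ℤ)) (R.erase (1, (N : ℤ)))).image (moveGuard M N R) by
      rw [Finset.insert_erase h.guard], Finset.image_insert, moveGuard, if_pos rfl]
    congr 1
    have : (R.erase (1, (N : ℤ))).image (moveGuard M N R) = (R.erase (1, (N : ℤ))).image id :=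
      Finset.image_congr fun v hv => if_neg (Finset.mem_erase.1 (Finset.mem_coe.1 hv)).1
    rw [this, Finset.image_id]

theorem balanced_of_placed (h : Guarded M N R) (hA : AllButGuardPlaced N R) :
    RowsBalanced M N R := by
  rw [h.rowsBalanced_iff]
  intro l
  obtain ⟨h1, h2⟩ := h.moveGuard_of_placed hA
  rw [← surplus_image_of_row h1 (fun v hv => by
    unfold moveGuard; split_ifs with h3 <;> simp [h3]), h2, surplus, card_target h.card, sub_self]

theorem guardedMove_of_not_balanced (h : Guarded M N R) (hB : ¬ RowsBalanced M N R) :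
    guardedMove M N R = balanceRows M N R := by
  funext v
  rw [guardedMove, if_neg fun hA => hB (h.balanced_of_placed hA), if_neg hB]

theorem guardedMove_safe (h : Guarded M N R) : SafeMove M N R (guardedMove M N R) := by
  by_cases hA : AllButGuardPlaced N R
  · rw [show guardedMove M N R = moveGuard M N R by funext v; rw [guardedMove, if_pos hA]]
    exact (h.moveGuard_of_placed hA).1
  by_cases hB : RowsBalanced M N R
  · rw [show guardedMove M N R = placeInRows M N R by
      funext v; rw [guardedMove, if_neg hA, if_pos hB]]
    exact h.placeInRows_safe hB
  · rw [h.guardedMove_of_not_balanced hB]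
    exact h.balanceRows_safe

end Guarded

/-- The configuration after one cycle. -/
noncomputable def guardedNext (M N : ℕ) (R : Finset Cell) : Finset Cell :=
  R.image (guardedMove M N R)

/-- Within `T` cycles that start with a guard, a configuration with property `P` is reached. -/
inductive ReachIn (M N : ℕ) (P : Finset Cell → Prop) : ℕ → Finset Cell → Prop
  | here {T : ℕ} {R : Finset Cell} : P R → ReachIn M N P T R
  | step {T : ℕ} {R : Finset Cell} : Guarded M N R → ReachIn M N P T (guardedNext M N R) →
      ReachIn M N P (T + 1) R

namespace ReachIn

variable {M N : ℕ} {P Q : Finset Cell → Prop} {T T' : ℕ} {R : Finset Cell}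

theorem mono (hP : ∀ S, P S → Q S) (h : ReachIn M N P T R) : ReachIn M N Q T R := by
  induction h with
  | here hR => exact here (hP _ hR)
  | step hG _ ih => exact step hG ih

theorem mono_time (h : ReachIn M N P T R) (hT : T ≤ T') : ReachIn M N P T' R := by
  induction h generalizing T' with
  | here hR => exact here hR
  | @step T R hG _ ih =>
    obtain ⟨S, rfl⟩ : ∃ S, T' = S + 1 := ⟨T' - 1, by omega⟩
    exact step hG (ih (by omega))

theorem trans (h : ReachIn M N P T R) (hPQ : ∀ S, P S → ReachIn M N Q T' S) :
    ReachIn M N Q (T + T') R := by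
  induction h with
  | here hR => exact (hPQ _ hR).mono_time (by omega)
  | @step T R hG _ ih => exact (step hG ih).mono_time (by omega)

end ReachIn

/-- All robots are in the first `H` rows and in the last columns. -/
def Within (N : ℕ) (H : ℕ) (R : Finset Cell) : Prop := ∀ v ∈ R, v.1 ≤ H ∧ (N : ℤ) - H ≤ v.2

theorem Within.mono {N H H' : ℕ} {R : Finset Cell} (h : Within N H R) (hH : H ≤ H') :
    Within N H' R := fun v hv => by
  have := h v hv
  omega

theorem Within.next {M N H : ℕ} {R : Finset Cell} (h : Within N H R) (hG : Guarded M N R) :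
    Within N (H + 1) (guardedNext M N R) := by
  unfold Within guardedNext
  rw [Finset.forall_mem_image]
  intro v hv
  have h1 := h v hv
  have h2 := hG.guardedMove_safe.mono_cellDist hv
  simp only [cellDist, Int.abs_eq_natAbs] at h2
  push_cast
  omega

theorem reachIn_surplus_nonpos {M N n : ℕ} : ∀ (m H : ℕ) (i : ℤ) (R : Finset Cell), Guarded M N R →
    R.card = n → (∀ x ≤ i, surplus N R x ≤ 0) → ((n + 1) / 2 : ℕ) ≤ i + m → Within N H R →
    ReachIn M N (fun S => Guarded M N S ∧ S.card = n ∧ (∀ x, surplus N S x ≤ 0) ∧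
      Within N (H + m) S) m R
  | 0, H, i, R, hG, hn, hi, hm, hW => .here ⟨hG, hn, fun x => by
      subst hn
      rcases le_or_gt x i with h1 | h1
      · exact hi x h1
      · exact hG.surplus_nonpos_of_ge (by push_cast at *; omega), hW⟩
  | m + 1, H, i, R, hG, hn, hi, hm, hW => by
    by_cases hB : RowsBalanced M N R
    · exact .here ⟨hG, hn, fun x => ((hG.rowsBalanced_iff.1 hB) x).le, hW.mono (by omega)⟩
    · have e : guardedNext M N R = R.image (balanceRows M N R) := by
        rw [guardedNext, hG.guardedMove_of_not_balanced hB]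
      refine .step hG ((reachIn_surplus_nonpos m (H + 1) (i + 1) _ ?_ ?_ ?_ (by push_cast at *; omega)
        (hW.next hG)).mono fun S hS => ⟨hS.1, hS.2.1, hS.2.2.1, hS.2.2.2.mono (by omega)⟩)
      · rw [e]; exact hG.image_balanceRows
      · rw [e, hG.balanceRows_safe.card_image, hn]
      · rw [e]; exact hG.surplus_nonpos_step hi

theorem reachIn_balanced_of_unstuck {M N n : ℕ} : ∀ (m H : ℕ) (R : Finset Cell), Guarded M N R →
    R.card = n → (∀ x, surplus N R x ≤ 0) → (∀ x ≥ (m : ℤ), surplus N R x = 0) → Within N H R →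
    Guarded.Unstuck M N R →
    ReachIn M N (fun S => Guarded M N S ∧ S.card = n ∧ RowsBalanced M N S ∧ Within N (H + m) S) m R
  | 0, H, R, hG, hn, hP, hm, hW, hU => .here ⟨hG, hn, hG.rowsBalanced_iff.2 fun x => by
      rcases le_or_gt x 0 with h1 | h1
      · exact hG.surplus_of_le_zero h1
      · exact hm x (by push_cast; omega), hW⟩
  | m + 1, H, R, hG, hn, hP, hm, hW, hU => by
    by_cases hB : RowsBalanced M N R
    · exact .here ⟨hG, hn, hB, hW.mono (by omega)⟩
    · have e : guardedNext M N R = R.image (balanceRows M N R) := by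
        rw [guardedNext, hG.guardedMove_of_not_balanced hB]
      refine .step hG ((reachIn_balanced_of_unstuck m (H + 1) _ ?_ ?_ ?_ ?_ (hW.next hG) ?_).mono
        fun S hS => ⟨hS.1, hS.2.1, hS.2.2.1, hS.2.2.2.mono (by omega)⟩)
      · rw [e]; exact hG.image_balanceRows
      · rw [e, hG.balanceRows_safe.card_image, hn]
      · rw [e]; exact fun x => hG.surplus_nonpos_step (j := x) (fun i _ => hP i) x (by omega)
      · rw [e]
        intro x hx
        exact hG.surplus_zero_step hP (hU.not_conflict hG hP) hm x (by push_cast; omega)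
      · rw [e]; exact hU.step hG hP

theorem reachIn_balanced {M N n : ℕ} : ∀ (m H : ℕ) (R : Finset Cell), Guarded M N R →
    R.card = n → (∀ x, surplus N R x ≤ 0) → (∀ x ≥ (m : ℤ), surplus N R x = 0) → Within N H R →
    ReachIn M N (fun S => Guarded M N S ∧ S.card = n ∧ RowsBalanced M N S ∧
      Within N (H + m + 1) S) (m + 1) R
  | 0, H, R, hG, hn, hP, hm, hW => .here ⟨hG, hn, hG.rowsBalanced_iff.2 fun x => by
      rcases le_or_gt x 0 with h1 | h1
      · exact hG.surplus_of_le_zero h1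
      · exact hm x (by push_cast; omega), hW.mono (by omega)⟩
  | m + 1, H, R, hG, hn, hP, hm, hW => by
    by_cases hB : RowsBalanced M N R
    · exact .here ⟨hG, hn, hB, hW.mono (by omega)⟩
    have e : guardedNext M N R = R.image (balanceRows M N R) := by
      rw [guardedNext, hG.guardedMove_of_not_balanced hB]
    have hG' : Guarded M N (guardedNext M N R) := by rw [e]; exact hG.image_balanceRows
    have hn' : (guardedNext M N R).card = n := by rw [e, hG.balanceRows_safe.card_image, hn]
    have hP' : ∀ x, surplus N (guardedNext M N R) x ≤ 0 := by
      rw [e]; exact fun x => hG.surplus_nonpos_step (j := x) (fun i _ => hP i) x (by omega)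
    by_cases hC : Conflict M N R
    · refine .step hG ((reachIn_balanced_of_unstuck (m + 1) (H + 1) _ hG' hn' hP' ?_ (hW.next hG)
        ?_).mono fun S hS => ⟨hS.1, hS.2.1, hS.2.2.1, hS.2.2.2.mono (by omega)⟩)
      · rw [e]
        exact fun x hx => (hG.surplus_eq_of_conflict hP hC x).trans (hm x hx)
      · rw [e]; exact Guarded.Unstuck.of_conflict hG hP hC
    · refine .step hG ((reachIn_balanced m (H + 1) _ hG' hn' hP' ?_ (hW.next hG)).mono
        fun S hS => ⟨hS.1, hS.2.1, hS.2.2.1, hS.2.2.2.mono (by omega)⟩)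
      rw [e]
      intro x hx
      exact hG.surplus_zero_step hP hC hm x (by push_cast; omega)

theorem reachIn_target {M N n : ℕ} : ∀ (m : ℕ) (R : Finset Cell), Guarded M N R →
    R.card = n → RowsBalanced M N R → Guarded.Close N R m →
    ReachIn M N (fun S => S = target n N) (m + 1) R := by
  have hlast : ∀ (m : ℕ) (R : Finset Cell), Guarded M N R → R.card = n →
      AllButGuardPlaced N R → ReachIn M N (fun S => S = target n N) (m + 1) R := by
    intro m R hG hn hA
    refine .step hG (.here ?_)
    rw [guardedNext, show guardedMove M N R = moveGuard M N R by
      funext v; rw [guardedMove, if_pos hA], (hG.moveGuard_of_placed hA).2, hn]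
  intro m
  induction m with
  | zero => exact fun R hG hn hB hC => hlast 0 R hG hn (hG.placed_of_close hB hC)
  | succ m ih =>
    intro R hG hn hB hC
    by_cases hA : AllButGuardPlaced N R
    · exact hlast _ R hG hn hA
    have e : guardedNext M N R = R.image (placeInRows M N R) := by
      rw [guardedNext, show guardedMove M N R = placeInRows M N R by
        funext v; rw [guardedMove, if_neg hA, if_pos hB]]
    have hG' : Guarded M N (guardedNext M N R) := by rw [e]; exact hG.image_placeInRows hB
    refine .step hG (ih _ hG' ?_ (hG'.rowsBalanced_iff.2 fun l => ?_) ?_)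
    · rw [e, (hG.placeInRows_safe hB).card_image, hn]
    · rw [e, surplus_image_of_row (hG.placeInRows_safe hB) fun v hv => hG.placeInRows_row hB hv]
      exact hG.rowsBalanced_iff.1 hB l
    · rw [e]; exact hG.close_placeInRows hB hC

/-- A guarded configuration that is within distance `H` of the corner of the guard reaches the
pattern in `O(H)` cycles. -/
theorem Guarded.reachIn_target {M N H : ℕ} {R : Finset Cell} (h : Guarded M N R)
    (hH : (R.card + 1) / 2 ≤ H) (hW : Within N H R) :
    ReachIn M N (fun S => S = target R.card N) (7 * H + 3) R := by
  set k := (R.card + 1) / 2 with hk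
  have h1 := reachIn_surplus_nonpos k H 0 R h rfl
    (fun x hx => (h.surplus_of_le_zero hx).le) (by omega) hW
  refine ((h1.trans (T' := (H + k) + 1 + ((2 * H + 2 * k + 1) + 1)) ?_)).mono_time (by omega)
  rintro S ⟨hG, hn, hP, hS⟩
  refine (reachIn_balanced (H + k) (H + k) S hG hn hP (fun x hx => le_antisymm (hP x)
    (hG.surplus_nonneg_of_forall_le fun v hv => ((hS v hv).1.trans hx))) hS).trans ?_
  rintro S' ⟨hG', hn', hB, hS'⟩
  refine GridRobots.reachIn_target _ S' hG' hn' hB fun v hv _ => ?_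
  have h2 := hS' v hv
  have h3 := hG'.goalCol_le hB hv
  have h4 := mem_cells.1 (hG'.subset hv)
  rw [hn'] at h3
  push_cast at h2 h3 ⊢
  rw [Int.abs_eq_natAbs]
  omega

/-! ### Special paths -/

/-- Trait `s` of the special path, in row `s + 1`. -/
def pathTrait (N s : ℕ) : List Cell :=
  (List.range (N - 2 * s - 1)).map fun c : ℕ =>
    if Even s then ((s : ℤ) + 1, (s : ℤ) + 1 + c) else ((s : ℤ) + 1, (N : ℤ) - s - c)

theorem specialPath_eq (M N : ℕ) :
    specialPath M N = (List.range (min M N / 2)).flatMap (pathTrait N) := by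
  have e : ∀ l : List ℕ, (do let a ← l; pure (a : ℤ)) = l.map fun a : ℕ => (a : ℤ) := by
    intro l
    simp [List.map_eq_flatMap]
  unfold specialPath
  congr 1
  funext s
  rw [e, List.map_map]
  rfl

theorem mem_pathTrait {N s : ℕ} {v : Cell} : v ∈ pathTrait N s ↔ v.1 = s + 1 ∧
    ((Even s ∧ s + 1 ≤ v.2 ∧ v.2 ≤ N - s - 1) ∨ (¬ Even s ∧ s + 2 ≤ v.2 ∧ v.2 ≤ N - s)) := by
  simp only [pathTrait, List.mem_map, List.mem_range]
  constructor
  · rintro ⟨c, hc, rfl⟩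
    by_cases hs : Even s <;> simp only [hs, if_true, if_false, true_and, not_true, false_and,
      or_false, false_or, not_false_eq_true] <;> omega
  · rintro ⟨h1, ⟨hs, h2, h3⟩ | ⟨hs, h2, h3⟩⟩
    · exact ⟨(v.2 - s - 1).toNat, by omega, by
        rw [if_pos hs]; exact Prod.ext h1.symm (by simp only []; omega)⟩
    · exact ⟨(N - s - v.2).toNat, by omega, by
        rw [if_neg hs]; exact Prod.ext h1.symm (by simp only []; omega)⟩

theorem mem_specialPath {M N : ℕ} {v : Cell} : v ∈ specialPath M N ↔
    ∃ s < min M N / 2, v.1 = s + 1 ∧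
      ((Even s ∧ s + 1 ≤ v.2 ∧ v.2 ≤ N - s - 1) ∨ (¬ Even s ∧ s + 2 ≤ v.2 ∧ v.2 ≤ N - s)) := by
  simp only [specialPath_eq, List.mem_flatMap, List.mem_range, mem_pathTrait]

theorem nodup_specialPath (M N : ℕ) : (specialPath M N).Nodup := by
  rw [specialPath_eq, List.nodup_flatMap]
  constructor
  · intro s _
    refine List.Nodup.map_on (fun a ha b hb hab => ?_) List.nodup_range
    split_ifs at hab <;> simp only [Prod.mk.injEq] at hab <;> omega
  · refine List.Pairwise.imp (fun {a b} hab v ha hb => ?_) List.pairwise_lt_range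
    rw [mem_pathTrait] at ha hb
    omega

theorem isChain_traits {N : ℕ} : ∀ m : ℕ, 2 * m ≤ N →
    List.IsChain (fun u v => cellDist u v = 1) ((List.range m).flatMap (pathTrait N)) ∧
      ∀ x ∈ ((List.range m).flatMap (pathTrait N)).getLast?, ∀ s, m = s + 1 →
        x = if Even s then ((s : ℤ) + 1, (N : ℤ) - s - 1) else ((s : ℤ) + 1, (s : ℤ) + 2)
  | 0, _ => by simp
  | m + 1, hm => by
    obtain ⟨h1, h2⟩ := isChain_traits (N := N) m (by omega)
    have hne : N - 2 * m - 1 ≠ 0 := by omega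
    have htr : List.IsChain (fun u v => cellDist u v = 1) (pathTrait N m) := by
      rw [pathTrait, List.isChain_map, List.isChain_range]
      intro c _
      split_ifs <;> simp [cellDist]
    rw [List.range_succ, List.flatMap_append, List.flatMap_singleton]
    constructor
    · rw [List.isChain_append]
      refine ⟨h1, htr, fun x hx y hy => ?_⟩
      rcases Nat.eq_zero_or_pos m with rfl | hpos
      · simp at hx
      · obtain ⟨s, rfl⟩ : ∃ s, m = s + 1 := ⟨m - 1, by omega⟩
        have hx' := h2 x hx s rfl
        rw [pathTrait, List.head?_map, List.head?_range, if_neg hne] at hy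
        simp only [Option.map_some, Option.mem_def, Option.some.injEq] at hy
        rw [hx', ← hy]
        by_cases hs : Even s
        · rw [if_pos hs, if_neg (by rw [Nat.even_add_one]; tauto)]
          push_cast
          simp only [cellDist, Int.abs_eq_natAbs]
          omega
        · rw [if_neg hs, if_pos (by rw [Nat.even_add_one]; tauto)]
          push_cast
          simp only [cellDist, Int.abs_eq_natAbs]
          omega
    · intro x hx s hs
      obtain rfl : m = s := by omega
      have hx' : (pathTrait N m).getLast? = some x := by
        have hnil : pathTrait N m ≠ [] := by simp [pathTrait, hne]
        rw [List.getLast?_append_of_ne_nil _ hnil] at hx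
        exact hx
      rw [pathTrait, List.getLast?_map, List.getLast?_range, if_neg hne] at hx'
      simp only [Option.map_some, Option.some.injEq] at hx'
      rw [← hx']
      split_ifs
      · exact Prod.ext rfl (by simp only []; omega)
      · exact Prod.ext rfl (by simp only []; omega)

theorem isChain_specialPath (M N : ℕ) :
    List.IsChain (fun u v => cellDist u v = 1) (specialPath M N) := by
  rw [specialPath_eq]
  exact (isChain_traits _ (by omega)).1

theorem specialPath_subset_cells {M N : ℕ} {v : Cell} (hv : v ∈ specialPath M N) :
    v ∈ cells M N := by
  obtain ⟨s, hs, h1, h2⟩ := mem_specialPath.1 hv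
  rw [mem_cells]
  omega

theorem getElem_length_takeWhile {α : Type*} (p : α → Bool) :
    ∀ (l : List α) (i : ℕ) (hi : i < l.length), i = (l.takeWhile p).length → p l[i] = false
  | [], _, hi, _ => absurd hi (by simp)
  | a :: l, i, hi, h => by
    by_cases ha : p a
    · rw [List.takeWhile_cons, if_pos ha, List.length_cons] at h
      subst h
      exact getElem_length_takeWhile p l _ _ rfl
    · rw [List.takeWhile_cons, if_neg ha] at h
      subst h
      simpa using ha

/-- The robots of the special subpath move onto cells that are free or vacated. -/
theorem advance_spec {M N : ℕ} {R : Finset Cell} {v : Cell} (hv : v ∈ specialSubpath M N R)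
    (hfull : ¬ ∀ u ∈ specialPath M N, u ∈ R) :
    v ∈ R ∧ v ∈ specialPath M N ∧
    ∃ i, ∃ hi : i + 1 < (specialPath M N).length, (specialPath M N)[i] = v ∧
      advance M N R v = (specialPath M N)[i + 1] ∧
      ((specialPath M N)[i + 1] ∈ specialSubpath M N R ∨ (specialPath M N)[i + 1] ∉ R) := by
  have hpre : specialSubpath M N R <+: specialPath M N := List.takeWhile_prefix _
  have hvP := hpre.subset hv
  have hvR : v ∈ R := by simpa using List.mem_takeWhile_imp hv
  refine ⟨hvR, hvP, ?_⟩
  obtain ⟨i, hi, e⟩ := List.getElem_of_mem hv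
  have hlen := hpre.length_le
  have hne : (specialSubpath M N R).length ≠ (specialPath M N).length := by
    intro hl
    have h1 := hpre.eq_of_length hl
    apply hfull
    intro u hu
    rw [← h1] at hu
    simpa using List.mem_takeWhile_imp hu
  have hi1 : i + 1 < (specialPath M N).length := by omega
  have e' : (specialPath M N)[i] = v := by rw [← e, hpre.getElem hi]
  refine ⟨i, hi1, e', ?_, ?_⟩
  · rw [advance, if_pos hv]
    have h2 : (specialPath M N).idxOf v = i := by
      rw [← e']
      exact (nodup_specialPath M N).idxOf_getElem i _
    rw [h2, List.getD_eq_getElem _ _ hi1]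
  · rcases lt_or_ge (i + 1) (specialSubpath M N R).length with h3 | h3
    · left
      rw [← hpre.getElem h3]
      exact List.getElem_mem _
    · right
      have h4 : i + 1 = (specialSubpath M N R).length := by omega
      have h5 := getElem_length_takeWhile (fun u => decide (u ∈ R)) (specialPath M N) (i + 1) hi1 h4
      simpa using h5

theorem exists_specialPath_eq_cons {M N : ℕ} (hM : 2 ≤ M) (hN : 2 ≤ N) :
    ∃ t, specialPath M N = (1, 1) :: t := by
  have h1 : min M N / 2 ≠ 0 := by omega
  have h2 : N - 1 ≠ 0 := by omega
  obtain ⟨a, ha⟩ := Nat.exists_eq_succ_of_ne_zero h1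
  obtain ⟨b, hb⟩ := Nat.exists_eq_succ_of_ne_zero h2
  rw [specialPath_eq, ha, List.range_succ_eq_map, List.flatMap_cons, pathTrait]
  simp only [Nat.mul_zero, Nat.sub_zero, hb, List.range_succ_eq_map, List.map_cons]
  exact ⟨_, rfl⟩

theorem mem_specialSubpath_of_corner {M N : ℕ} (hM : 2 ≤ M) (hN : 2 ≤ N) {R : Finset Cell}
    (h : (1, 1) ∈ R) : (1, 1) ∈ specialSubpath M N R := by
  obtain ⟨t, ht⟩ := exists_specialPath_eq_cons hM hN
  rw [specialSubpath, ht, List.takeWhile_cons, if_pos (by simpa using h)]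
  exact List.mem_cons_self

/-- The four special paths are disjoint. -/
theorem specialPath_disjoint {M N : ℕ} {q r : Fin 4} {v : Cell}
    (hq : rotCell M N q v ∈ specialPath (rotRows M N q) (rotCols M N q))
    (hr : rotCell M N r v ∈ specialPath (rotRows M N r) (rotCols M N r)) : q = r := by
  have key : ∀ (M N : ℕ) (d : Fin 4) (w : Cell), w ∈ specialPath M N →
      rotCell M N d w ∈ specialPath (rotRows M N d) (rotCols M N d) → d = 0 := by
    intro M N d w h1 h2
    obtain ⟨s, hs, h3, h4⟩ := mem_specialPath.1 h1
    obtain ⟨t, ht, h5, h6⟩ := mem_specialPath.1 h2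
    by_contra hd
    have hst : s = t := by
      clear h1 h2
      fin_cases d <;> simp [rotCell, rotRows, rotCols] at hd ht h5 h6 <;> omega
    subst hst
    clear h1 h2
    by_cases hs2 : Even s <;> fin_cases d <;>
      simp [rotCell, rotRows, rotCols, hs2] at hd ht h4 h5 h6 <;> omega
  have h1 := key _ _ (r - q) _ hq (by
    rw [rotCell_rotCell, rotRows_rotRows, rotCols_rotCols, add_sub_cancel]
    exact hr)
  rw [sub_eq_zero] at h1
  exact h1.symm

/-! ### Clearing the corners -/

section

/-- `v` is on the special subpath of the corner that `q` quarter turns bring to the upper left. -/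
def OnSubpath (M N : ℕ) (R : Finset Cell) (q : Fin 4) (v : Cell) : Prop :=
  rotCell M N q v ∈ specialSubpath (rotRows M N q) (rotCols M N q) (rotate M N q R)

/-- The number of fully occupied special paths. -/
def numFull (M N : ℕ) (R : Finset Cell) : ℕ :=
  (Finset.univ.filter fun q : Fin 4 => FullPath M N R q).card

variable {M N : ℕ} {R : Finset Cell} {q r : Fin 4} {v : Cell}

theorem OnSubpath.mem_path (h : OnSubpath M N R q v) :
    rotCell M N q v ∈ specialPath (rotRows M N q) (rotCols M N q) :=
  (List.takeWhile_prefix _).subset h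

theorem OnSubpath.unique (hq : OnSubpath M N R q v) (hr : OnSubpath M N R r v) : q = r :=
  specialPath_disjoint hq.mem_path hr.mem_path

theorem onSubpath_rotate :
    OnSubpath (rotRows M N r) (rotCols M N r) (rotate M N r R) q (rotCell M N r v) ↔
      OnSubpath M N R (r + q) v := by
  rw [OnSubpath, OnSubpath, rotCell_rotCell, rotate_rotate, rotRows_rotRows, rotCols_rotCols]

theorem fullPath_rotate :
    FullPath (rotRows M N r) (rotCols M N r) (rotate M N r R) q ↔ FullPath M N R (r + q) := by
  rw [FullPath, FullPath, rotate_rotate, rotRows_rotRows, rotCols_rotCols]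

theorem numFull_rotate :
    numFull (rotRows M N r) (rotCols M N r) (rotate M N r R) = numFull M N R := by
  refine Finset.card_equiv (Equiv.addLeft r) fun q => ?_
  simp only [Finset.mem_filter, Finset.mem_univ, true_and, Equiv.coe_addLeft]
  exact fullPath_rotate

@[simp] theorem rotCell_pathCorner : rotCell M N q (pathCorner M N q) = (1, 1) :=
  rotCell_rotCell_neg _ _ _ _

theorem rotCell_pathCorner_add :
    rotCell M N r (pathCorner M N (r + q)) = pathCorner (rotRows M N r) (rotCols M N r) q := by
  apply rotCell_injective (rotRows M N r) (rotCols M N r) q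
  rw [rotCell_rotCell, rotCell_pathCorner, rotCell_pathCorner]

theorem keptPath_rotate (hR : R.Nonempty) (hA : Asymmetric M N R) :
    KeptPath (rotRows M N r) (rotCols M N r) (rotate M N r R) q ↔ KeptPath M N R (r + q) := by
  have h1 : (∃ q', FullPath (rotRows M N r) (rotCols M N r) (rotate M N r R) q') ↔
      ∃ q', FullPath M N R q' := by
    constructor
    · rintro ⟨a, ha⟩
      exact ⟨_, fullPath_rotate.1 ha⟩
    · rintro ⟨a, ha⟩
      refine ⟨a - r, fullPath_rotate.2 ?_⟩
      rwa [add_sub_cancel]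
  unfold KeptPath
  by_cases h : ∃ q', FullPath M N R q'
  · rw [if_pos h, if_pos (h1.2 h), fullPath_rotate]
  · rw [if_neg h, if_neg (mt h1.1 h), occupiedCorners_rotate, minView_rotate hR (Or.inl hA),
      ← rotCell_pathCorner_add, rotCell_mem_rotate]

theorem clearCorners_of_onSubpath (hp : numFull M N R ≤ 1) (h : OnSubpath M N R q v) :
    clearCorners M N R v = if KeptPath M N R q then v else inFrame M N q advance R v := by
  have e : ((List.finRange 4).find? fun q =>
      rotCell M N q v ∈ specialSubpath (rotRows M N q) (rotCols M N q) (rotate M N q R)) =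
        some q := by
    cases he : ((List.finRange 4).find? fun q =>
      rotCell M N q v ∈ specialSubpath (rotRows M N q) (rotCols M N q) (rotate M N q R)) with
    | none =>
      rw [List.find?_eq_none] at he
      exact absurd h (by simpa [OnSubpath] using he q (List.mem_finRange q))
    | some a =>
      have ha : OnSubpath M N R a v := by simpa [OnSubpath] using List.find?_some he
      rw [ha.unique h]
  rw [clearCorners]
  rw [numFull] at hp
  rw [if_pos hp, e]

theorem clearCorners_of_forall_not (hp : numFull M N R ≤ 1) (h : ∀ q, ¬ OnSubpath M N R q v) :
    clearCorners M N R v = v := by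
  have e : ((List.finRange 4).find? fun q =>
      rotCell M N q v ∈ specialSubpath (rotRows M N q) (rotCols M N q) (rotate M N q R)) =
        none := by
    rw [List.find?_eq_none]
    intro q _
    simpa [OnSubpath] using h q
  rw [clearCorners]
  rw [numFull] at hp
  rw [if_pos hp, e]

theorem rotCell_inFrame_sub (A : Algorithm) :
    rotCell M N r (inFrame M N q A R v) =
      inFrame (rotRows M N r) (rotCols M N r) (q - r) A (rotate M N r R) (rotCell M N r v) := by
  have h := rotCell_neg_inFrame M N r (q - r) A R v
  rw [add_sub_cancel] at h
  rw [← h, rotCell_rotCell_neg]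

theorem clearCorners_inFrame (hR : R.Nonempty) (hA : Asymmetric M N R) (hp : numFull M N R ≤ 1)
    (r : Fin 4) (v : Cell) : inFrame M N r clearCorners R v = clearCorners M N R v := by
  apply rotCell_injective M N r
  rw [rotCell_inFrame]
  have hp' := (numFull_rotate (M := M) (N := N) (R := R) (r := r)).trans_le hp
  by_cases h : ∃ q, OnSubpath M N R q v
  · obtain ⟨q, hq⟩ := h
    have hq' : OnSubpath (rotRows M N r) (rotCols M N r) (rotate M N r R) (q - r)
        (rotCell M N r v) := by
      rw [onSubpath_rotate, add_sub_cancel]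
      exact hq
    have hk := keptPath_rotate (q := q - r) (r := r) hR hA
    rw [add_sub_cancel] at hk
    rw [clearCorners_of_onSubpath hp' hq', clearCorners_of_onSubpath hp hq]
    by_cases hk' : KeptPath M N R q
    · rw [if_pos hk', if_pos (hk.2 hk')]
    · rw [if_neg hk', if_neg (mt hk.1 hk'), rotCell_inFrame_sub]
  · push Not at h
    rw [clearCorners_of_forall_not hp h, clearCorners_of_forall_not hp']
    intro q hq
    exact h _ (onSubpath_rotate.1 hq)

theorem pathCorner_mem_corners : pathCorner M N q ∈ corners M N := by
  rw [← rotCell_mem_corners (q := q), rotCell_pathCorner, mem_corners]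
  exact ⟨Or.inl rfl, Or.inl rfl⟩

theorem exists_pathCorner_eq {c : Cell} (hc : c ∈ corners M N) : ∃ q, pathCorner M N q = c := by
  simp only [corners, Finset.mem_insert, Finset.mem_singleton] at hc
  rcases hc with rfl | rfl | rfl | rfl
  · exact ⟨0, by simp [pathCorner, rotCell]⟩
  · exact ⟨3, by
      rw [← rotCell_inj (M := M) (N := N) (q := 3), rotCell_pathCorner]; simp [rotCell]⟩
  · exact ⟨1, by
      rw [← rotCell_inj (M := M) (N := N) (q := 1), rotCell_pathCorner]; simp [rotCell]⟩
  · exact ⟨2, by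
      rw [← rotCell_inj (M := M) (N := N) (q := 2), rotCell_pathCorner]; simp [rotCell]⟩

theorem corner_mem_specialPath (hM : 2 ≤ M) (hN : 2 ≤ N) (q : Fin 4) :
    ((1, 1) : Cell) ∈ specialPath (rotRows M N q) (rotCols M N q) := by
  obtain ⟨t, ht⟩ := exists_specialPath_eq_cons (rotRows_le q hM hN) (rotCols_le q hM hN)
  rw [ht]
  exact List.mem_cons_self

theorem pathCorner_injective (hM : 2 ≤ M) (hN : 2 ≤ N)
    (h : pathCorner M N q = pathCorner M N r) : q = r := by
  apply specialPath_disjoint (M := M) (N := N) (v := pathCorner M N q)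
  · rw [rotCell_pathCorner]
    exact corner_mem_specialPath hM hN q
  · rw [h, rotCell_pathCorner]
    exact corner_mem_specialPath hM hN r

theorem onSubpath_pathCorner (hM : 2 ≤ M) (hN : 2 ≤ N) (h : pathCorner M N q ∈ R) :
    OnSubpath M N R q (pathCorner M N q) := by
  rw [OnSubpath, rotCell_pathCorner]
  apply mem_specialSubpath_of_corner (rotRows_le q hM hN) (rotCols_le q hM hN)
  rw [← rotCell_pathCorner (M := M) (N := N) (q := q), rotCell_mem_rotate]
  exact h

theorem exists_keptPath (hM : 2 ≤ M) (hN : 2 ≤ N) (hp : numFull M N R ≤ 1)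
    (hc : (occupiedCorners M N R).Nonempty) :
    ∃ q₀, (∀ q, KeptPath M N R q ↔ q = q₀) ∧ pathCorner M N q₀ ∈ R ∧
      ∀ q ≠ q₀, ¬ FullPath M N R q := by
  by_cases h : ∃ q', FullPath M N R q'
  · obtain ⟨q₀, h0⟩ := h
    have huniq : ∀ q, FullPath M N R q → q = q₀ := fun q hq =>
      Finset.card_le_one.1 hp q (by simpa using hq) q₀ (by simpa using h0)
    refine ⟨q₀, fun q => ?_, ?_, fun q hq hf => hq (huniq q hf)⟩
    · rw [KeptPath, if_pos ⟨q₀, h0⟩]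
      exact ⟨huniq q, fun e => e ▸ h0⟩
    · rw [← rotCell_mem_rotate (M := M) (N := N) (q := q₀), rotCell_pathCorner]
      exact h0 _ (corner_mem_specialPath hM hN q₀)
  · obtain ⟨g, hg, e⟩ := exists_minView_eq M N R hc
    have hg' := Finset.mem_filter.1 hg
    obtain ⟨q₀, h0⟩ := exists_pathCorner_eq hg'.1
    refine ⟨q₀, fun q => ?_, h0 ▸ hg'.2, fun q _ hf => h ⟨q, hf⟩⟩
    rw [KeptPath, if_neg h, e, Finset.mem_singleton, ← h0]
    exact ⟨fun h => pathCorner_injective hM hN h, fun e => e ▸ rfl⟩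

/-- With at most one fully occupied special path, everybody stays or moves along an edge without
collision, and a single corner remains occupied. -/
theorem clearCorners_safe_of_numFull (hM : 2 ≤ M) (hN : 2 ≤ N)
    (hp : numFull M N R ≤ 1) (hc : (occupiedCorners M N R).Nonempty) :
    SafeMove M N R (clearCorners M N R) ∧
      (occupiedCorners M N (R.image (clearCorners M N R))).card = 1 := by
  obtain ⟨q₀, hkept, h0, hfull⟩ := exists_keptPath hM hN hp hc
  set f := clearCorners M N R with hf
  have hstay : ∀ v, (∀ q ≠ q₀, ¬ OnSubpath M N R q v) → f v = v := by
    intro v hv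
    by_cases h : ∃ q, OnSubpath M N R q v
    · obtain ⟨q, hq⟩ := h
      have e : q = q₀ := by
        by_contra hne
        exact hv q hne hq
      rw [hf, clearCorners_of_onSubpath hp hq, if_pos ((hkept q).2 e)]
    · push Not at h
      exact clearCorners_of_forall_not hp h
  have hmove : ∀ v q, q ≠ q₀ → OnSubpath M N R q v →
      ∃ i, ∃ hi : i + 1 < (specialPath (rotRows M N q) (rotCols M N q)).length,
        (specialPath (rotRows M N q) (rotCols M N q))[i] = rotCell M N q v ∧
        rotCell M N q (f v) = (specialPath (rotRows M N q) (rotCols M N q))[i + 1] ∧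
        (f v ∈ R → OnSubpath M N R q (f v)) := by
    intro v q hq hv
    obtain ⟨-, -, i, hi, e1, e2, e3⟩ := advance_spec hv (hfull q hq)
    have e4 : rotCell M N q (f v) = (specialPath (rotRows M N q) (rotCols M N q))[i + 1] := by
      rw [hf, clearCorners_of_onSubpath hp hv, if_neg (fun h => hq ((hkept q).1 h)),
        rotCell_inFrame, e2]
    refine ⟨i, hi, e1, e4, fun h => ?_⟩
    rw [OnSubpath, e4]
    rcases e3 with e3 | e3
    · exact e3
    · rw [← e4, rotCell_mem_rotate] at e3
      exact absurd h e3
  have hne : ∀ v q, q ≠ q₀ → OnSubpath M N R q v → f v ≠ v := by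
    intro v q hq hv e
    obtain ⟨i, hi, e1, e2, -⟩ := hmove v q hq hv
    rw [e, ← e1] at e2
    have := ((nodup_specialPath _ _).getElem_inj_iff).1 e2
    omega
  have hmover : ∀ u v, u ∈ R → v ∈ R → f u = f v → f u ≠ u → u = v := by
    intro u v hu hv huv hmv
    obtain ⟨q, hq, hqu⟩ : ∃ q, q ≠ q₀ ∧ OnSubpath M N R q u := by
      by_contra! h
      exact hmv (hstay u h)
    obtain ⟨i, hi, e1, e2, e3⟩ := hmove u q hq hqu
    by_cases h : ∃ r, r ≠ q₀ ∧ OnSubpath M N R r v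
    · obtain ⟨r, hr, hrv⟩ := h
      obtain ⟨j, hj, d1, d2, -⟩ := hmove v r hr hrv
      obtain rfl : q = r := by
        apply specialPath_disjoint (M := M) (N := N) (v := f u)
        · rw [e2]; exact List.getElem_mem _
        · rw [huv, d2]; exact List.getElem_mem _
      rw [huv, d2] at e2
      have hij : i = j := by
        have := ((nodup_specialPath _ _).getElem_inj_iff).1 e2
        omega
      subst hij
      rw [e1] at d1
      exact rotCell_injective _ _ _ d1
    · push Not at h
      have hv' := hstay v h
      have := e3 (by rw [huv, hv']; exact hv)
      rw [huv, hv'] at this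
      exact absurd this (h q hq)
  refine ⟨⟨?_, ?_⟩, ?_⟩
  · intro u hu v hv huv
    by_cases h1 : f u = u
    · by_cases h2 : f v = v
      · rw [← h1, huv, h2]
      · exact (hmover v u hv hu huv.symm h2).symm
    · exact hmover u v hu hv huv h1
  · intro v hv
    by_cases h : ∃ q, q ≠ q₀ ∧ OnSubpath M N R q v
    · right
      obtain ⟨q, hq, hqv⟩ := h
      obtain ⟨i, hi, e1, e2, -⟩ := hmove v q hq hqv
      rw [← gridGraph_adj_rotCell (q := q), e2, ← e1]
      refine ⟨specialPath_subset_cells (List.getElem_mem _),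
        specialPath_subset_cells (List.getElem_mem _), ?_⟩
      exact List.isChain_iff_getElem.1 (isChain_specialPath _ _) i hi
    · push Not at h
      exact Or.inl (hstay v h)
  · rw [Finset.card_eq_one]
    refine ⟨pathCorner M N q₀, Finset.ext fun c => ?_⟩
    rw [occupiedCorners, Finset.mem_filter, Finset.mem_singleton]
    constructor
    · rintro ⟨hcc, hcR⟩
      obtain ⟨v, hv, hvc⟩ := Finset.mem_image.1 hcR
      obtain ⟨q, rfl⟩ := exists_pathCorner_eq hcc
      by_cases h : ∃ r, r ≠ q₀ ∧ OnSubpath M N R r v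
      · exfalso
        obtain ⟨r, hr, hrv⟩ := h
        obtain ⟨i, hi, e1, e2, -⟩ := hmove v r hr hrv
        obtain rfl : r = q := by
          apply specialPath_disjoint (M := M) (N := N) (v := pathCorner M N q)
          · rw [← hvc, e2]; exact List.getElem_mem _
          · rw [rotCell_pathCorner]
            exact corner_mem_specialPath hM hN q
        rw [hvc, rotCell_pathCorner] at e2
        obtain ⟨t, ht⟩ := exists_specialPath_eq_cons (rotRows_le r hM hN) (rotCols_le r hM hN)
        have h0 : (specialPath (rotRows M N r) (rotCols M N r))[0] = (1, 1) := by
          simp [ht]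
        rw [← h0] at e2
        have := ((nodup_specialPath _ _).getElem_inj_iff).1 e2
        omega
      · push Not at h
        rw [hstay v h] at hvc
        subst hvc
        by_contra hne
        exact h q (fun e => hne (e ▸ rfl)) (onSubpath_pathCorner hM hN hv)
    · rintro rfl
      refine ⟨pathCorner_mem_corners, Finset.mem_image.2 ⟨_, h0, hstay _ fun q hq h => hq ?_⟩⟩
      exact h.unique (onSubpath_pathCorner hM hN h0)

theorem length_specialPath (hM : 4 ≤ M) (hN : 4 ≤ N) :
    2 * N ≤ (specialPath M N).length + 4 := by
  have hl : ∀ s, (pathTrait N s).length = N - 2 * s - 1 := fun s => by simp [pathTrait]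
  obtain ⟨a, ha⟩ : ∃ a, min M N / 2 = a + 1 + 1 := ⟨min M N / 2 - 2, by omega⟩
  rw [specialPath_eq, ha, List.range_succ_eq_map, List.range_succ_eq_map]
  simp only [List.map_cons, List.flatMap_cons, List.length_append, hl]
  omega

/-- The cells of a special path, in the coordinate system of the grid. -/
noncomputable def pathCells (M N : ℕ) (q : Fin 4) : Finset Cell :=
  rotate (rotRows M N q) (rotCols M N q) (-q)
    (specialPath (rotRows M N q) (rotCols M N q)).toFinset

theorem mem_pathCells :
    v ∈ pathCells M N q ↔ rotCell M N q v ∈ specialPath (rotRows M N q) (rotCols M N q) := by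
  rw [pathCells, ← List.mem_toFinset]
  conv_lhs => rw [← rotCell_neg_rotCell M N q v]
  exact rotCell_mem_rotate

theorem card_pathCells :
    (pathCells M N q).card = (specialPath (rotRows M N q) (rotCols M N q)).length := by
  rw [pathCells, card_rotate, List.toFinset_card_of_nodup (nodup_specialPath _ _)]

theorem disjoint_pathCells (h : q ≠ r) : Disjoint (pathCells M N q) (pathCells M N r) := by
  rw [Finset.disjoint_left]
  intro v hq hr
  exact h (specialPath_disjoint (mem_pathCells.1 hq) (mem_pathCells.1 hr))

theorem pathCells_subset (h : FullPath M N R q) : pathCells M N q ⊆ R := by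
  intro v hv
  rw [← rotCell_mem_rotate (M := M) (N := N) (q := q)]
  exact h _ (mem_pathCells.1 hv)

theorem rotate_pathCells :
    rotate M N r (pathCells M N (r + q)) = pathCells (rotRows M N r) (rotCols M N r) q := by
  ext w
  rw [mem_rotate, mem_pathCells, mem_pathCells, rotRows_rotRows, rotCols_rotCols,
    ← rotCell_rotCell, rotCell_rotCell_neg]

/-- The robots of two consecutive special paths in the `4 × 4` grid. -/
def twoPaths : Finset Cell :=
  {(1, 1), (1, 2), (1, 3), (2, 3), (4, 1), (3, 1), (2, 1), (2, 2)}

/-- Two special paths are fully occupied only in the `4 × 4` grid, because a larger grid has too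
few robots; opposite paths are excluded by asymmetry. -/
theorem eq_rotate_twoPaths (hA : Asymmetric M N R) (h7 : 7 ≤ R.card)
    (hM : (R.card + 1) / 2 ≤ M) (hN : (R.card + 1) / 2 ≤ N) (hp : 1 < numFull M N R)
    (hn : R.card ≤ 2 * min M N) :
    M = 4 ∧ N = 4 ∧ ∃ j, R = rotate 4 4 j twoPaths := by
  obtain ⟨q, hq, r, hr, hqr⟩ := Finset.one_lt_card.1 hp
  replace hq := (Finset.mem_filter.1 hq).2
  replace hr := (Finset.mem_filter.1 hr).2
  have h4M : 4 ≤ M := by omega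
  have h4N : 4 ≤ N := by omega
  have hsub : pathCells M N q ∪ pathCells M N r ⊆ R :=
    Finset.union_subset (pathCells_subset hq) (pathCells_subset hr)
  have hcard := Finset.card_le_card hsub
  rw [Finset.card_union_of_disjoint (disjoint_pathCells hqr), card_pathCells,
    card_pathCells] at hcard
  -- Two disjoint special paths have at least `4 * min M N - 8` cells, but there are at most
  -- `2 * min M N` robots.
  have lq := length_specialPath (rotRows_le q h4M h4N) (rotCols_le q h4M h4N)
  have lr := length_specialPath (rotRows_le r h4M h4N) (rotCols_le r h4M h4N)
  have cq := rotCols_le q h4M h4N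
  have cr := rotCols_le r h4M h4N
  have mq : min M N ≤ rotCols M N q := rotCols_le q (min_le_left _ _) (min_le_right _ _)
  have mr : min M N ≤ rotCols M N r := rotCols_le r (min_le_left _ _) (min_le_right _ _)
  have hcq : rotCols M N q = 4 := by omega
  have hcr : rotCols M N r = 4 := by omega
  have hR : pathCells M N q ∪ pathCells M N r = R := by
    apply Finset.eq_of_subset_of_card_le hsub
    rw [Finset.card_union_of_disjoint (disjoint_pathCells hqr), card_pathCells, card_pathCells]
    omega
  have h2 : r ≠ q + 2 := by
    rintro rfl
    refine hA 2 (by decide) ⟨rfl, rfl, ?_⟩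
    have e1 := rotate_pathCells (M := M) (N := N) (r := 2) (q := q)
    have e2 := rotate_pathCells (M := M) (N := N) (r := 2) (q := q + 2)
    have e3 : ∀ x : Fin 4, 2 + (x + 2) = x := by decide
    rw [e3] at e2
    rw [add_comm] at e1
    rw [← hR, rotate_union, e1, e2, Finset.union_comm]
    rfl
  have hMN : M = 4 ∧ N = 4 := by
    clear hR hsub hcard lq lr hp hq hr mq mr cq cr
    revert hqr h2 hcq hcr
    fin_cases q <;> fin_cases r <;> simp [rotCols] <;> omega
  obtain ⟨rfl, rfl⟩ := hMN
  refine ⟨rfl, rfl, ?_⟩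
  rw [← hR]
  clear hR hsub hcard lq lr hp hq hr mq mr cq cr hcq hcr hn hM hN h7 hA
  revert q r
  set_option maxRecDepth 100000 in
  decide +kernel

set_option maxRecDepth 100000 in
theorem clearCorners_twoPaths_inFrame : ∀ j : Fin 4, ∀ v ∈ rotate 4 4 j twoPaths, ∀ r : Fin 4,
    inFrame 4 4 r clearCorners (rotate 4 4 j twoPaths) v =
      clearCorners 4 4 (rotate 4 4 j twoPaths) v := by
  decide +kernel

set_option maxRecDepth 100000 in
theorem clearCorners_twoPaths_adj : ∀ j : Fin 4, ∀ v ∈ rotate 4 4 j twoPaths,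
    clearCorners 4 4 (rotate 4 4 j twoPaths) v = v ∨
      (v ∈ cells 4 4 ∧ clearCorners 4 4 (rotate 4 4 j twoPaths) v ∈ cells 4 4 ∧
        cellDist v (clearCorners 4 4 (rotate 4 4 j twoPaths) v) = 1) := by
  decide +kernel

set_option maxRecDepth 100000 in
theorem clearCorners_twoPaths_image : ∀ j : Fin 4,
    (occupiedCorners 4 4
      ((rotate 4 4 j twoPaths).image (clearCorners 4 4 (rotate 4 4 j twoPaths)))).card = 1 ∧
    ((rotate 4 4 j twoPaths).image (clearCorners 4 4 (rotate 4 4 j twoPaths))).card =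
      (rotate 4 4 j twoPaths).card := by
  decide +kernel

/-- One cycle leaves a single robot on a corner, whatever the local coordinate systems. -/
theorem clearCorners_spec (hA : Asymmetric M N R) (h7 : 7 ≤ R.card)
    (hM : (R.card + 1) / 2 ≤ M) (hN : (R.card + 1) / 2 ≤ N)
    (hc : 1 < (occupiedCorners M N R).card) :
    (∀ r, ∀ v ∈ R, inFrame M N r clearCorners R v = clearCorners M N R v) ∧
      SafeMove M N R (clearCorners M N R) ∧
      (occupiedCorners M N (R.image (clearCorners M N R))).card = 1 := by
  have hne : R.Nonempty := Finset.card_pos.1 (by omega)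
  rcases le_or_gt (numFull M N R) 1 with hp | hp
  · exact ⟨fun r v _ => clearCorners_inFrame hne hA hp r v,
      clearCorners_safe_of_numFull (by omega) (by omega) hp (Finset.card_pos.1 (by omega))⟩
  · obtain ⟨rfl, rfl, j, rfl⟩ := eq_rotate_twoPaths hA h7 hM hN hp (by omega)
    have h1 := clearCorners_twoPaths_image j
    refine ⟨fun r v hv => clearCorners_twoPaths_inFrame j v hv r, ⟨?_, ?_⟩, h1.1⟩
    · exact Finset.card_image_iff.1 h1.2
    · exact clearCorners_twoPaths_adj j

end

/-! ### Moving the guard to a corner -/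

section

variable {M N : ℕ} {R : Finset Cell} {q : Fin 4} {v w : Cell}

/-- The robots among which the guard is chosen if there are robots on the sides. -/
noncomputable def sideCandidates (M N : ℕ) (R : Finset Cell) : Finset Cell :=
  R.filter fun u => OnSide M N u ∧ ∀ s ∈ R, OnSide M N s → cornerDist M N u ≤ cornerDist M N s

theorem sideCandidates_rotate :
    sideCandidates (rotRows M N q) (rotCols M N q) (rotate M N q R) =
      rotate M N q (sideCandidates M N R) := by
  symm
  apply rotate_filter
  intro v _
  rw [forall_mem_rotate, onSide_rotCell]
  simp only [onSide_rotCell, cornerDist_rotCell]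

/-- A robot that moves from `v` to `w` does not leave the sides of the grid it is on. -/
def KeepsSide (M N : ℕ) (v w : Cell) : Prop :=
  (v.1 = 1 ∨ v.1 = M → w.1 = v.1) ∧ (v.2 = 1 ∨ v.2 = N → w.2 = v.2)

theorem KeepsSide.trans {u : Cell} (h : KeepsSide M N u v) (h' : KeepsSide M N v w) :
    KeepsSide M N u w := by
  constructor
  · intro hu
    rw [h'.1 (by rwa [h.1 hu]), h.1 hu]
  · intro hu
    rw [h'.2 (by rwa [h.2 hu]), h.2 hu]

theorem keepsSide_rotCell :
    KeepsSide (rotRows M N q) (rotCols M N q) (rotCell M N q v) (rotCell M N q w) ↔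
      KeepsSide M N v w := by
  fin_cases q <;> simp [KeepsSide, rotRows, rotCols, rotCell] <;> omega

/-- The move from `v` to `w` follows a side and brings the robot closer to a corner. -/
structure TowardsCorner (M N : ℕ) (v w : Cell) : Prop where
  adj : (gridGraph M N).Adj v w
  onSide : OnSide M N w
  cornerDist : cornerDist M N w + 1 = cornerDist M N v
  keepsSide : KeepsSide M N v w

theorem towardsCorner_rotCell :
    TowardsCorner (rotRows M N q) (rotCols M N q) (rotCell M N q v) (rotCell M N q w) ↔
      TowardsCorner M N v w := by
  constructor
  · intro h
    exact ⟨gridGraph_adj_rotCell.1 h.adj, onSide_rotCell.1 h.onSide,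
      by simpa only [cornerDist_rotCell] using h.cornerDist, keepsSide_rotCell.1 h.keepsSide⟩
  · intro h
    exact ⟨gridGraph_adj_rotCell.2 h.adj, onSide_rotCell.2 h.onSide,
      by simpa only [cornerDist_rotCell] using h.cornerDist, keepsSide_rotCell.2 h.keepsSide⟩

theorem towardsCorner_of_step (hv : v ∈ cells M N) (hs : OnSide M N v) (hc : v ∉ corners M N) :
    TowardsCorner M N v
      (if v.1 = 1 ∨ v.1 = M then
        if v.2 - 1 < N - v.2 then v + (0, -1) else v + (0, 1)
      else if v.1 - 1 < M - v.1 then v + (-1, 0) else v + (1, 0)) := by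
  obtain ⟨a, b⟩ := v
  rw [mem_corners] at hc
  have hv' := mem_cells.1 hv
  simp only [OnSide] at hs hc hv'
  split_ifs with h1 h2 h2 <;>
  · refine ⟨⟨hv, mem_cells.2 ?_, ?_⟩, ?_, ?_, ?_⟩ <;>
    simp only [OnSide, KeepsSide, GridRobots.cornerDist, Prod.mk_add_mk, cellDist,
      Int.abs_eq_natAbs] at * <;> omega

theorem cornerDist_sub_le : cornerDist M N v - cornerDist M N w ≤ cellDist v w := by
  simp only [cornerDist, cellDist, Int.abs_eq_natAbs]
  omega

theorem cornerDist_nonneg (hv : v ∈ cells M N) : 0 ≤ cornerDist M N v := by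
  rw [mem_cells] at hv
  simp only [cornerDist]
  omega

/-- Only the selected robot moves, in whatever local coordinate systems. -/
theorem moveToCorner_inFrame {g : Cell} (hR : R ⊆ cells M N)
    (h : Asymmetric M N R ∨ ∃ g', sideCandidates M N R = {g'})
    (hc : ∀ c ∈ corners M N, c ∉ R) (hg : minView M N R (sideCandidates M N R) = {g})
    (q : Fin 4) :
    (∀ v, v ≠ g → inFrame M N q moveToCorner R v = v) ∧
      TowardsCorner M N g (inFrame M N q moveToCorner R g) := by
  have hgS : g ∈ sideCandidates M N R :=
    Finset.filter_subset _ _ (hg ▸ Finset.mem_singleton_self g)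
  have hgR := Finset.mem_filter.1 hgS
  have hmv : minView (rotRows M N q) (rotCols M N q) (rotate M N q R)
      (sideCandidates (rotRows M N q) (rotCols M N q) (rotate M N q R)) = {rotCell M N q g} := by
    rw [sideCandidates_rotate, minView_rotate ⟨g, hgR.1⟩ h, hg, rotate, Finset.image_singleton]
  have key : ∀ v, rotCell M N q v ∈ minView (rotRows M N q) (rotCols M N q) (rotate M N q R)
      (sideCandidates (rotRows M N q) (rotCols M N q) (rotate M N q R)) ↔ v = g := by
    intro v
    rw [hmv, Finset.mem_singleton, rotCell_inj]
  constructor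
  · intro v hv
    apply rotCell_injective M N q
    rw [rotCell_inFrame, moveToCorner]
    exact if_neg (mt (key v).1 hv)
  · rw [← towardsCorner_rotCell (q := q), rotCell_inFrame, moveToCorner]
    erw [if_pos ((key g).2 rfl)]
    apply towardsCorner_of_step
    · rw [rotCell_mem_cells]; exact hR hgR.1
    · rw [onSide_rotCell]; exact hgR.2.1
    · rw [rotCell_mem_corners]; exact fun h => hc g h hgR.1

/-! ### Executions -/

/-- The configurations `y 0, y 1, …` follow the algorithm, in some local coordinate systems. -/
def IsRun (M N : ℕ) {n : ℕ} (y : ℕ → Fin n → Cell) : Prop :=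
  ∀ t, ∃ o : Fin n → Fin 4, ∀ i,
    y (t + 1) i = inFrame M N (o i) algoAsym (occupied (y t)) (y t i)

theorem IsRun.shift {n : ℕ} {y : ℕ → Fin n → Cell} (h : IsRun M N y) (s : ℕ) :
    IsRun M N fun t => y (t + s) := by
  intro t
  obtain ⟨o, ho⟩ := h (t + s)
  refine ⟨o, fun i => ?_⟩
  rw [← ho i, Nat.add_right_comm]

/-- `n ≥ 7` robots on different vertices of a grid that has room for the pattern. -/
structure Placement (M N : ℕ) {n : ℕ} (x : Fin n → Cell) : Prop where
  injective : Function.Injective x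
  mem : ∀ i, x i ∈ cells M N
  seven_le : 7 ≤ n
  rows : (n + 1) / 2 ≤ M
  cols : (n + 1) / 2 ≤ N

/-- One cycle without collision in which the robots stay or move along an edge. -/
def GoodStep (M N : ℕ) {n : ℕ} (x x' : Fin n → Cell) : Prop :=
  Function.Injective x' ∧ ∀ i, x' i = x i ∨ (gridGraph M N).Adj (x i) (x' i)

section

variable {n : ℕ} {x x' : Fin n → Cell} {i : Fin n}

theorem mem_occupied : v ∈ occupied x ↔ ∃ i, x i = v := by simp [occupied]

theorem Placement.card (h : Placement M N x) : (occupied x).card = n := by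
  rw [occupied, Finset.card_image_of_injective _ h.injective, Finset.card_univ, Fintype.card_fin]

theorem Placement.subset (h : Placement M N x) : occupied x ⊆ cells M N := by
  intro v hv
  obtain ⟨i, rfl⟩ := mem_occupied.1 hv
  exact h.mem i

theorem Placement.step (h : Placement M N x) (hs : GoodStep M N x x') : Placement M N x' where
  injective := hs.1
  mem i := by
    rcases hs.2 i with e | e
    · rw [e]; exact h.mem i
    · exact e.2.1
  seven_le := h.seven_le
  rows := h.rows
  cols := h.cols

/-- A cycle in which only robot `i` moves, to a free neighbour. -/
theorem goodStep_of_single (h : Placement M N x) (hne : ∀ j, j ≠ i → x' j = x j)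
    (hadj : (gridGraph M N).Adj (x i) (x' i)) (hfree : x' i ∉ occupied x) :
    GoodStep M N x x' ∧ occupied x' = insert (x' i) ((occupied x).erase (x i)) := by
  have hf : ∀ j, j ≠ i → x' j ≠ x' i := by
    intro j hj e
    apply hfree
    rw [← e, hne j hj]
    exact mem_occupied.2 ⟨j, rfl⟩
  refine ⟨⟨fun a b hab => ?_, fun j => ?_⟩, Finset.ext fun v => ?_⟩
  · by_cases ha : a = i
    · subst ha
      by_contra hb
      exact hf b (Ne.symm hb) hab.symm
    · by_cases hb : b = i
      · subst hb
        exact absurd hab (hf a ha)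
      · rw [hne a ha, hne b hb] at hab
        exact h.injective hab
  · by_cases hj : j = i
    · exact Or.inr (hj ▸ hadj)
    · exact Or.inl (hne j hj)
  · rw [mem_occupied, Finset.mem_insert, Finset.mem_erase, mem_occupied]
    constructor
    · rintro ⟨j, rfl⟩
      by_cases hj : j = i
      · exact Or.inl (hj ▸ rfl)
      · rw [hne j hj]
        exact Or.inr ⟨fun e => hj (h.injective e), j, rfl⟩
    · rintro (rfl | ⟨hv, j, rfl⟩)
      · exact ⟨i, rfl⟩
      · exact ⟨j, hne j fun e => hv (e ▸ rfl)⟩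

end

theorem patternFormed_frame :
    PatternFormed (rotRows M N q) (rotCols M N q) (rotate M N q R) ↔ PatternFormed M N R :=
  patternFormed_rotate

theorem algoAsym_inFrame_of_patternFormed (h : PatternFormed M N R) :
    inFrame M N q algoAsym R v = v := by
  rw [inFrame, algoAsym, if_pos (patternFormed_frame.2 h), rotCell_neg_rotCell]

theorem card_occupiedCorners_frame :
    (occupiedCorners (rotRows M N q) (rotCols M N q) (rotate M N q R)).card =
      (occupiedCorners M N R).card := by
  rw [occupiedCorners_rotate, card_rotate]

theorem algoAsym_inFrame_of_one_lt (h : ¬ PatternFormed M N R)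
    (hc : 1 < (occupiedCorners M N R).card) :
    inFrame M N q algoAsym R v = inFrame M N q clearCorners R v := by
  rw [inFrame, inFrame, algoAsym, if_neg (mt patternFormed_frame.1 h), card_occupiedCorners_frame,
    if_neg hc.ne', if_pos hc]

theorem algoAsym_inFrame_of_onSide (h : ¬ PatternFormed M N R)
    (hc : (occupiedCorners M N R).card = 0) (hs : ∃ u ∈ R, OnSide M N u) :
    inFrame M N q algoAsym R v = inFrame M N q moveToCorner R v := by
  rw [inFrame, inFrame, algoAsym, if_neg (mt patternFormed_frame.1 h), card_occupiedCorners_frame,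
    hc, if_neg (by norm_num), if_neg (by norm_num), if_pos]
  rw [exists_mem_rotate]
  simpa only [onSide_rotCell] using hs

theorem algoAsym_inFrame_of_forall_not_onSide (h : ¬ PatternFormed M N R)
    (hc : (occupiedCorners M N R).card = 0) (hs : ∀ u ∈ R, ¬ OnSide M N u) :
    inFrame M N q algoAsym R v = inFrame M N q moveToSide R v := by
  rw [inFrame, inFrame, algoAsym, if_neg (mt patternFormed_frame.1 h), card_occupiedCorners_frame,
    hc, if_neg (by norm_num), if_neg (by norm_num), if_neg]
  rw [exists_mem_rotate]
  simp only [onSide_rotCell]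
  rintro ⟨u, hu, hu'⟩
  exact hs u hu hu'

theorem card_occupiedCorners_eq_zero :
    (occupiedCorners M N R).card = 0 ↔ ∀ c ∈ corners M N, c ∉ R := by
  rw [Finset.card_eq_zero, occupiedCorners, Finset.filter_eq_empty_iff]

/-- The guard walks along its side to a corner. In every cycle it comes closer to a corner, so it
stays the only robot closest to a corner, and all robots agree on it. -/
theorem reaches_corner {n : ℕ} : ∀ (m : ℕ) (y : ℕ → Fin n → Cell), IsRun M N y →
    Placement M N (y 0) → (∀ c ∈ corners M N, c ∉ occupied (y 0)) →
    (Asymmetric M N (occupied (y 0)) ∨ ∃ g, sideCandidates M N (occupied (y 0)) = {g}) →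
    ∀ i, minView M N (occupied (y 0)) (sideCandidates M N (occupied (y 0))) = {y 0 i} →
    cornerDist M N (y 0 i) = m →
    ∃ t₀ : ℕ, (∀ t < t₀, GoodStep M N (y t) (y (t + 1))) ∧
      (PatternFormed M N (occupied (y t₀)) ∨
        (occupiedCorners M N (occupied (y t₀))).card = 1 ∧ y t₀ i ∈ corners M N) ∧
      cornerDist M N (y t₀ i) + t₀ = cornerDist M N (y 0 i) ∧ KeepsSide M N (y 0 i) (y t₀ i)
  | m, y, hy, hp, hc, hA, i, hg, hm => by
    set R := occupied (y 0) with hRdef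
    by_cases hpat : PatternFormed M N R
    · exact ⟨0, by simp, Or.inl hpat, by simp, fun _ => rfl, fun _ => rfl⟩
    have hgS : y 0 i ∈ sideCandidates M N R :=
      Finset.filter_subset _ _ (hg ▸ Finset.mem_singleton_self _)
    obtain ⟨hiR, his, himin⟩ := Finset.mem_filter.1 hgS
    obtain ⟨o, ho⟩ := hy 0
    have hstep : ∀ j, y 1 j = inFrame M N (o j) moveToCorner R (y 0 j) := by
      intro j
      rw [← algoAsym_inFrame_of_onSide hpat (card_occupiedCorners_eq_zero.2 hc) ⟨_, hiR, his⟩]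
      exact ho j
    have hne : ∀ j, j ≠ i → y 1 j = y 0 j := by
      intro j hj
      rw [hstep j]
      exact (moveToCorner_inFrame hp.subset hA hc hg _).1 _ fun e => hj (hp.injective e)
    have hto : TowardsCorner M N (y 0 i) (y 1 i) := by
      rw [hstep i]
      exact (moveToCorner_inFrame hp.subset hA hc hg _).2
    have hd := hto.cornerDist
    have hfree : y 1 i ∉ R := by
      intro h
      have := himin _ h hto.onSide
      omega
    obtain ⟨hgood, hocc⟩ := goodStep_of_single hp hne hto.adj hfree
    have hp1 := hp.step hgood
    have h0 := cornerDist_nonneg (hp1.mem i)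
    by_cases hcor : y 1 i ∈ corners M N
    · refine ⟨1, ?_, Or.inr ⟨?_, hcor⟩, by push_cast; omega, hto.keepsSide⟩
      · intro t ht
        obtain rfl : t = 0 := by omega
        exact hgood
      · rw [Finset.card_eq_one]
        refine ⟨y 1 i, Finset.ext fun c => ?_⟩
        rw [occupiedCorners, Finset.mem_filter, hocc, Finset.mem_insert, Finset.mem_singleton]
        constructor
        · rintro ⟨h1, h2 | h2⟩
          · exact h2
          · exact absurd (Finset.mem_of_mem_erase h2) (hc c h1)
        · rintro rfl
          exact ⟨hcor, Or.inl rfl⟩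
    · have hc1 : ∀ c ∈ corners M N, c ∉ occupied (y 1) := by
        intro c h1 h2
        rw [hocc, Finset.mem_insert] at h2
        rcases h2 with rfl | h2
        · exact hcor h1
        · exact hc c h1 (Finset.mem_of_mem_erase h2)
      have hS : sideCandidates M N (occupied (y 1)) = {y 1 i} := by
        have hlt : ∀ s ∈ R.erase (y 0 i), OnSide M N s →
            cornerDist M N (y 1 i) < cornerDist M N s := by
          intro s hs hs'
          have := himin s (Finset.mem_of_mem_erase hs) hs'
          omega
        ext u
        rw [sideCandidates, Finset.mem_filter, hocc, Finset.mem_insert, Finset.mem_singleton]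
        constructor
        · rintro ⟨rfl | h1, h2, h3⟩
          · rfl
          · have h4 := h3 _ (Finset.mem_insert_self _ _) hto.onSide
            have h5 := hlt u h1 h2
            omega
        · rintro rfl
          refine ⟨Or.inl rfl, hto.onSide, fun s hs hs' => ?_⟩
          rcases Finset.mem_insert.1 hs with rfl | hs
          · exact le_rfl
          · exact (hlt s hs hs').le
      obtain ⟨m, rfl⟩ : ∃ m', m = m' + 1 := ⟨m - 1, by omega⟩
      obtain ⟨t₀, h1, h2, h3, h4⟩ := reaches_corner m (fun t => y (t + 1)) (hy.shift 1) hp1 hc1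
        (Or.inr ⟨_, hS⟩) i (by
          show minView M N (occupied (y 1)) (sideCandidates M N (occupied (y 1))) = _
          rw [hS, minView_singleton]) (by
          show cornerDist M N (y 1 i) = _
          push_cast at hm
          omega)
      refine ⟨t₀ + 1, fun t ht => ?_, h2, ?_, hto.keepsSide.trans h4⟩
      · rcases Nat.eq_zero_or_pos t with rfl | hpos
        · exact hgood
        · have := h1 (t - 1) (by omega)
          simp only [Nat.sub_add_cancel hpos] at this
          exact this
      · simp only [Nat.zero_add] at h3
        push_cast
        omega

end

/-! ### Moving the guard to a side -/

section

variable {M N : ℕ} {R T : Finset Cell} {q : Fin 4} {v w d d' : Cell}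

/-- The robots among which the guard is chosen if there is no robot on a side. -/
noncomputable def farthest (R : Finset Cell) : Finset Cell :=
  R.filter fun u => ∀ s ∈ R, sumDist R s ≤ sumDist R u

/-- `q` clockwise quarter turns of a vector. -/
def rotDir (q : Fin 4) (d : Cell) : Cell :=
  match q with
  | 0 => d
  | 1 => (d.2, -d.1)
  | 2 => (-d.1, -d.2)
  | 3 => (-d.2, d.1)

theorem rotCell_add : rotCell M N q (v + d) = rotCell M N q v + rotDir q d := by
  fin_cases q <;> refine Prod.ext ?_ ?_ <;> simp [rotCell, rotDir] <;> ring

theorem rotDir_mem_directions : ∀ q, ∀ d ∈ directions, rotDir q d ∈ directions := by decide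

theorem exists_rotDir_eq : ∀ q, ∀ d ∈ directions, ∃ d' ∈ directions, rotDir q d' = d := by decide

theorem mem_directions : d ∈ directions ↔ d = (-1, 0) ∨ d = (0, 1) ∨ d = (1, 0) ∨ d = (0, -1) := by
  simp [directions]

theorem sideDist_rotDir (hd : d ∈ directions) :
    sideDist (rotRows M N q) (rotCols M N q) (rotCell M N q v) (rotDir q d) =
      sideDist M N v d := by
  rcases mem_directions.1 hd with rfl | rfl | rfl | rfl <;> fin_cases q <;>
    simp [sideDist, rotCell, rotDir, rotRows, rotCols, Prod.ext_iff] <;> ring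

/-- The value that the guard minimizes when it chooses its direction `d`. -/
noncomputable def outKey (M N : ℕ) (T : Finset Cell) (v d : Cell) : ℤ ×ₗ ℤ :=
  toLex (-sumDist T (v + d), sideDist M N v d)

theorem outKey_rotate (hd : d ∈ directions) :
    outKey (rotRows M N q) (rotCols M N q) (rotate M N q T) (rotCell M N q v) (rotDir q d) =
      outKey M N T v d := by
  rw [outKey, outKey, sideDist_rotDir hd, ← rotCell_add, sumDist_rotate]

theorem outKey_lt_iff : outKey M N T v d < outKey M N T v d' ↔
    sumDist T (v + d') < sumDist T (v + d) ∨
      sumDist T (v + d') = sumDist T (v + d) ∧ sideDist M N v d < sideDist M N v d' := by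
  rw [outKey, outKey, Prod.Lex.toLex_lt_toLex]
  simp only [neg_lt_neg_iff, neg_inj, eq_comm]

theorem outKey_le_iff : outKey M N T v d ≤ outKey M N T v d' ↔
    sumDist T (v + d') < sumDist T (v + d) ∨
      sumDist T (v + d') = sumDist T (v + d) ∧ sideDist M N v d ≤ sideDist M N v d' := by
  rw [outKey, outKey, Prod.Lex.toLex_le_toLex]
  simp only [neg_lt_neg_iff, neg_inj, eq_comm]

/-- `d` is a best direction for a guard at `v`, where `T` are the other robots. -/
def IsBest (M N : ℕ) (T : Finset Cell) (v d : Cell) : Prop :=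
  d ∈ directions ∧ ∀ d' ∈ directions, outKey M N T v d ≤ outKey M N T v d'

theorem isBest_outward : IsBest M N (R.erase v) v (outward M N R v) := by
  cases h : List.argmin (fun d : Cell =>
      toLex (-sumDist (R.erase v) (v + d), sideDist M N v d)) directions with
  | none => simp [List.argmin_eq_none, directions] at h
  | some d =>
    rw [outward, h, Option.getD_some]
    exact ⟨List.argmin_mem h, fun d' hd' => List.le_of_mem_argmin hd' h⟩

theorem farthest_rotate : farthest (rotate M N q R) = rotate M N q (farthest R) := by
  symm
  apply rotate_filter
  intro v _
  rw [forall_mem_rotate]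
  simp only [sumDist_rotate]

/-- Only the selected robot moves, in whatever local coordinate systems, and it moves in a best
direction. -/
theorem moveToSide_inFrame {g : Cell} (h : Asymmetric M N R ∨ ∃ g', farthest R = {g'})
    (hg : minView M N R (farthest R) = {g}) (q : Fin 4) :
    (∀ v, v ≠ g → inFrame M N q moveToSide R v = v) ∧
      ∃ d, IsBest M N (R.erase g) g d ∧ inFrame M N q moveToSide R g = g + d := by
  have hgS : g ∈ farthest R := Finset.filter_subset _ _ (hg ▸ Finset.mem_singleton_self g)
  have hgR := Finset.mem_filter.1 hgS
  have hmv : minView (rotRows M N q) (rotCols M N q) (rotate M N q R)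
      (farthest (rotate M N q R)) = {rotCell M N q g} := by
    rw [farthest_rotate, minView_rotate ⟨g, hgR.1⟩ h, hg, rotate, Finset.image_singleton]
  have key : ∀ v, rotCell M N q v ∈ minView (rotRows M N q) (rotCols M N q) (rotate M N q R)
      (farthest (rotate M N q R)) ↔ v = g := by
    intro v
    rw [hmv, Finset.mem_singleton, rotCell_inj]
  constructor
  · intro v hv
    apply rotCell_injective M N q
    rw [rotCell_inFrame, moveToSide]
    exact if_neg (mt (key v).1 hv)
  · obtain ⟨h1, h2⟩ := isBest_outward (M := rotRows M N q) (N := rotCols M N q)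
      (R := rotate M N q R) (v := rotCell M N q g)
    obtain ⟨d, hd, e⟩ := exists_rotDir_eq q _ h1
    rw [← rotate_erase, ← e, outKey_rotate hd] at h2
    refine ⟨d, ⟨hd, fun d' hd' => ?_⟩, ?_⟩
    · have := h2 _ (rotDir_mem_directions q d' hd')
      rwa [outKey_rotate hd'] at this
    · apply rotCell_injective M N q
      rw [rotCell_inFrame, moveToSide, rotCell_add, e]
      exact if_pos ((key g).2 rfl)

/-! ### The sum of distances -/

theorem sumDist_eq_erase {g : Cell} (hg : g ∈ R) (u : Cell) :
    sumDist R u = sumDist (R.erase g) u + cellDist u g :=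
  (Finset.sum_erase_add _ _ hg).symm

theorem sumDist_insert (hw : w ∉ T) (u : Cell) :
    sumDist (insert w T) u = sumDist T u + cellDist u w := by
  rw [sumDist, Finset.sum_insert hw, add_comm, sumDist]

theorem cellDist_add_of_mem_directions (hd : d ∈ directions) : cellDist v (v + d) = 1 := by
  rcases mem_directions.1 hd with rfl | rfl | rfl | rfl <;> simp [cellDist]

/-- The sum of distances is convex along lines. -/
theorem sumDist_convex (hd : d ∈ directions) :
    2 * sumDist T (v + d) ≤ sumDist T v + sumDist T (v + d + d) := by
  rw [sumDist, sumDist, sumDist, ← Finset.sum_add_distrib, Finset.mul_sum]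
  refine Finset.sum_le_sum fun s _ => ?_
  rcases mem_directions.1 hd with rfl | rfl | rfl | rfl <;>
    simp only [cellDist, Prod.fst_add, Prod.snd_add, Int.abs_eq_natAbs] <;> omega

/-- Steps in perpendicular directions contribute independently. -/
theorem sumDist_perp (hd : d ∈ directions) (hd' : d' ∈ directions) (h1 : d' ≠ d) (h2 : d' ≠ -d) :
    sumDist T (v + d + d') + sumDist T v = sumDist T (v + d) + sumDist T (v + d') := by
  simp only [sumDist, ← Finset.sum_add_distrib]
  refine Finset.sum_congr rfl fun s _ => ?_
  rcases mem_directions.1 hd with rfl | rfl | rfl | rfl <;>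
    rcases mem_directions.1 hd' with rfl | rfl | rfl | rfl <;>
    first
    | exact absurd rfl h1
    | exact absurd (by decide) h2
    | (simp only [cellDist, Prod.fst_add, Prod.snd_add, add_zero]; ring)

theorem sumDist_up_add_down :
    sumDist T (v + (-1, 0)) + sumDist T (v + (1, 0)) =
      2 * sumDist T v + 2 * (T.filter fun s => s.1 = v.1).card := by
  rw [Finset.card_filter]
  push_cast
  simp only [sumDist, Finset.mul_sum, ← Finset.sum_add_distrib]
  refine Finset.sum_congr rfl fun s _ => ?_
  simp only [cellDist, Prod.fst_add, Prod.snd_add, Int.abs_eq_natAbs]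
  split_ifs <;> omega

theorem mul_sub_le_abs (a b c e : ℤ) (he : e = 1 ∨ e = -1) (h : 0 ≤ (b - a) * e) :
    |b - a| * (|a + e - c| - |a - c|) ≤ |b - c| - |a - c| := by
  rcases he with rfl | rfl
  · have h0 : a ≤ b := by linarith
    rcases le_or_gt c a with hc | hc
    · have h1 : |a + 1 - c| - |a - c| = 1 := by rw [abs_of_nonneg, abs_of_nonneg] <;> omega
      rw [h1]
      simp only [Int.abs_eq_natAbs]
      omega
    · have h1 : |a + 1 - c| - |a - c| = -1 := by rw [abs_of_nonpos, abs_of_nonpos] <;> omega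
      rw [h1]
      simp only [Int.abs_eq_natAbs]
      omega
  · have h0 : b ≤ a := by linarith
    rcases le_or_gt a c with hc | hc
    · have h1 : |a + -1 - c| - |a - c| = 1 := by rw [abs_of_nonpos, abs_of_nonpos] <;> omega
      rw [h1]
      simp only [Int.abs_eq_natAbs]
      omega
    · have h1 : |a + -1 - c| - |a - c| = -1 := by rw [abs_of_nonneg, abs_of_nonneg] <;> omega
      rw [h1]
      simp only [Int.abs_eq_natAbs]
      omega

/-- The growth in the first step towards `u` is a subgradient of the sum of distances. -/
theorem sumDist_subgradient (u v : Cell) {a b : ℤ} (ha : a = 1 ∨ a = -1)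
    (hb : b = 1 ∨ b = -1) (hau : 0 ≤ (u.1 - v.1) * a) (hbu : 0 ≤ (u.2 - v.2) * b) :
    |u.1 - v.1| * (sumDist T (v + (a, 0)) - sumDist T v) +
      |u.2 - v.2| * (sumDist T (v + (0, b)) - sumDist T v) ≤ sumDist T u - sumDist T v := by
  simp only [sumDist, ← Finset.sum_sub_distrib, Finset.mul_sum, ← Finset.sum_add_distrib]
  refine Finset.sum_le_sum fun s _ => ?_
  have h1 := mul_sub_le_abs v.1 u.1 s.1 a ha hau
  have h2 := mul_sub_le_abs v.2 u.2 s.2 b hb hbu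
  have e1 : cellDist (v + (a, 0)) s - cellDist v s = |v.1 + a - s.1| - |v.1 - s.1| := by
    simp [cellDist]
  have e2 : cellDist (v + (0, b)) s - cellDist v s = |v.2 + b - s.2| - |v.2 - s.2| := by
    simp [cellDist]
  rw [e1, e2]
  simp only [cellDist]
  linarith

/-- A robot with the largest sum of distances can increase it by `2` in one step: otherwise it
would be a median of the other robots in both coordinates, where the sum is smallest. -/
theorem exists_growth (hv : v ∈ farthest R) (h3 : 3 ≤ R.card) :
    ∃ d ∈ directions, sumDist (R.erase v) v + 2 ≤ sumDist (R.erase v) (v + d) := by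
  obtain ⟨hvR, hmax⟩ := Finset.mem_filter.1 hv
  set T := R.erase v with hT
  have hcard : T.card + 1 = R.card := Finset.card_erase_add_one hvR
  by_contra! hno
  have hsmall : ∀ d ∈ directions, sumDist T (v + d) ≤ sumDist T v + 1 := fun d hd => by
    have := hno d hd
    omega
  have hlow : ∀ d ∈ directions, sumDist T v - 1 ≤ sumDist T (v + d) := by
    intro d hd
    have hd' : -d ∈ directions := by revert d; decide
    have h1 := sumDist_convex (T := T) (v := v + -d) hd
    have h2 := hsmall _ hd'
    simp only [neg_add_cancel_right] at h1
    omega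
  have hu : ∀ u ∈ T, sumDist T u + cellDist u v ≤ sumDist T v := by
    intro u hu
    have h1 := hmax u (Finset.mem_of_mem_erase hu)
    rw [sumDist_eq_erase hvR u, sumDist_eq_erase hvR v, cellDist_self, add_zero] at h1
    exact h1
  -- a robot in another row forces the sum to decrease in the direction of this row
  have hrow : ∀ u ∈ T, ∀ a : ℤ, a = 1 ∨ a = -1 → 0 < (u.1 - v.1) * a →
      sumDist T (v + (a, 0)) = sumDist T v - 1 := by
    intro u huT a ha hau
    obtain ⟨b, hb, hbu⟩ : ∃ b : ℤ, (b = 1 ∨ b = -1) ∧ 0 ≤ (u.2 - v.2) * b := by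
      rcases le_total 0 (u.2 - v.2) with h | h
      · exact ⟨1, Or.inl rfl, by linarith⟩
      · exact ⟨-1, Or.inr rfl, by linarith⟩
    have h1 := sumDist_subgradient (T := T) u v ha hb hau.le hbu
    have h2 := hu u huT
    have ha' : (a, (0 : ℤ)) ∈ directions := by rcases ha with rfl | rfl <;> decide
    have hb' : ((0 : ℤ), b) ∈ directions := by rcases hb with rfl | rfl <;> decide
    have h3 := hlow _ ha'
    have h4 := hlow _ hb'
    have h5 : 1 ≤ |u.1 - v.1| := by
      apply Int.one_le_abs
      rintro e
      rw [e, zero_mul] at hau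
      exact lt_irrefl _ hau
    have h6 := abs_nonneg (u.2 - v.2)
    rw [cellDist] at h2
    have h7 : 0 ≤ |u.2 - v.2| * (sumDist T (v + (0, b)) - sumDist T v + 1) :=
      mul_nonneg h6 (by omega)
    have h8 : |u.1 - v.1| * (sumDist T (v + (a, 0)) - sumDist T v + 1) ≤ 0 := by nlinarith
    by_contra hne
    have h9 : 1 ≤ sumDist T (v + (a, 0)) - sumDist T v + 1 := by omega
    nlinarith
  have hsum := sumDist_up_add_down (T := T) (v := v)
  have hup := hsmall (-1, 0) (by decide)
  have hdown := hsmall (1, 0) (by decide)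
  obtain ⟨u, huT, hne⟩ : ∃ u ∈ T, u.1 ≠ v.1 := by
    by_contra! h
    rw [Finset.filter_true_of_mem h] at hsum
    omega
  obtain ⟨a, ha, hau⟩ : ∃ a : ℤ, (a = 1 ∨ a = -1) ∧ 0 < (u.1 - v.1) * a := by
    rcases lt_or_gt_of_ne hne with h | h
    · exact ⟨-1, Or.inr rfl, by linarith⟩
    · exact ⟨1, Or.inl rfl, by linarith⟩
  have h1 := hrow u huT a ha hau
  have hall : ∀ s ∈ T, 0 < (s.1 - v.1) * a := by
    intro s hs
    by_contra hneg
    rcases lt_or_eq_of_le (not_lt.1 hneg) with h | h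
    · have h2 := hrow s hs (-a) (by omega) (by linarith)
      rcases ha with rfl | rfl
      · omega
      · rw [neg_neg] at h2
        omega
    · have h4 : 0 < (T.filter fun s => s.1 = v.1).card := by
        refine Finset.card_pos.2 ⟨s, Finset.mem_filter.2 ⟨hs, ?_⟩⟩
        rcases ha with rfl | rfl <;> linarith
      rcases ha with rfl | rfl <;> omega
  have h5 : sumDist T (v + (a, 0)) = sumDist T v - T.card := by
    rw [sumDist, sumDist, Finset.card_eq_sum_ones]
    push_cast
    rw [← Finset.sum_sub_distrib]
    refine Finset.sum_congr rfl fun s hs => ?_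
    have := hall s hs
    rcases ha with rfl | rfl <;>
      simp only [cellDist, Prod.fst_add, Prod.snd_add, Int.abs_eq_natAbs] <;> omega
  omega

/-- After a step that increases its sum of distances, the guard is the only candidate. -/
theorem farthest_insert (hv : v ∈ farthest R) (hw : cellDist v w = 1)
    (hgrow : sumDist (R.erase v) v + 2 ≤ sumDist (R.erase v) w) :
    w ∉ R ∧ farthest (insert w (R.erase v)) = {w} := by
  obtain ⟨hvR, hmax⟩ := Finset.mem_filter.1 hv
  have e := fun u => sumDist_eq_erase hvR u
  have hvv := e v
  rw [cellDist_self] at hvv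
  have hwR : w ∉ R := by
    intro h
    have h1 := hmax w h
    rw [e w, cellDist_comm w v, hw] at h1
    omega
  have hwT : w ∉ R.erase v := fun h => hwR (Finset.mem_of_mem_erase h)
  refine ⟨hwR, ?_⟩
  have hlt : ∀ s ∈ R.erase v,
      sumDist (insert w (R.erase v)) s < sumDist (insert w (R.erase v)) w := by
    intro s hs
    rw [sumDist_insert hwT, sumDist_insert hwT, cellDist_self]
    have h1 := hmax s (Finset.mem_of_mem_erase hs)
    have h2 := cellDist_triangle s v w
    have h3 := e s
    omega
  ext u
  rw [farthest, Finset.mem_filter, Finset.mem_insert, Finset.mem_singleton]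
  constructor
  · rintro ⟨rfl | h1, h2⟩
    · rfl
    · exact absurd (h2 w (Finset.mem_insert_self _ _)) (not_le.2 (hlt u h1))
  · rintro rfl
    refine ⟨Or.inl rfl, fun s hs => ?_⟩
    rcases Finset.mem_insert.1 hs with rfl | hs
    · exact le_rfl
    · exact (hlt s hs).le

/-- After a step in a best direction, this direction is the only best one. -/
theorem IsBest.strict_of_growth (h : IsBest M N T v d)
    (hgrow : sumDist T v + 2 ≤ sumDist T (v + d)) :
    sumDist T (v + d) + 2 ≤ sumDist T (v + d + d) ∧
      ∀ d' ∈ directions, d' ≠ d → outKey M N T (v + d) d < outKey M N T (v + d) d' := by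
  obtain ⟨hd, hbest⟩ := h
  have hc := sumDist_convex (T := T) (v := v) hd
  refine ⟨by omega, fun d' hd' hne => ?_⟩
  rw [outKey_lt_iff]
  by_cases hop : d' = -d
  · left
    rw [hop, add_neg_cancel_right]
    omega
  · have hp := sumDist_perp (T := T) (v := v) hd hd' hne hop
    rcases outKey_le_iff.1 (hbest d' hd') with h1 | ⟨h1, h2⟩
    · left
      omega
    · rcases lt_or_ge (sumDist T (v + d + d')) (sumDist T (v + d + d)) with h3 | h3
      · exact Or.inl h3
      · refine Or.inr ⟨by omega, ?_⟩
        rcases mem_directions.1 hd with rfl | rfl | rfl | rfl <;>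
          rcases mem_directions.1 hd' with rfl | rfl | rfl | rfl <;>
          simp [sideDist, Prod.ext_iff] at hne hop h2 ⊢ <;> omega

end

/-! ### Guard placement -/

section

variable {M N n : ℕ} {v d : Cell} {i : Fin n} {y : ℕ → Fin n → Cell}

theorem sideDist_add (hd : d ∈ directions) : sideDist M N (v + d) d = sideDist M N v d - 1 := by
  rcases mem_directions.1 hd with rfl | rfl | rfl | rfl <;>
    simp [sideDist, Prod.ext_iff] <;> ring

theorem sideDist_nonneg (hd : d ∈ directions) (hv : v ∈ cells M N) : 0 ≤ sideDist M N v d := by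
  rw [mem_cells] at hv
  rcases mem_directions.1 hd with rfl | rfl | rfl | rfl <;>
    simp [sideDist, Prod.ext_iff] <;> omega

theorem adj_add_of_not_onSide (hv : v ∈ cells M N) (hs : ¬ OnSide M N v) (hd : d ∈ directions) :
    (gridGraph M N).Adj v (v + d) := by
  refine ⟨hv, ?_, cellDist_add_of_mem_directions hd⟩
  rw [mem_cells] at hv ⊢
  unfold OnSide at hs
  rcases mem_directions.1 hd with rfl | rfl | rfl | rfl <;>
    simp only [Prod.fst_add, Prod.snd_add] <;> omega

theorem corner_notMem_of_not_onSide {R : Finset Cell} (h : ∀ u ∈ R, ¬ OnSide M N u) :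
    ∀ c ∈ corners M N, c ∉ R := by
  intro c hc hcR
  rw [mem_corners] at hc
  apply h c hcR
  unfold OnSide
  tauto

/-- One step of the guard towards a side. -/
theorem step_to_side (hy : IsRun M N y) (hp : Placement M N (y 0))
    (hs : ∀ u ∈ occupied (y 0), ¬ OnSide M N u) (hpat : ¬ PatternFormed M N (occupied (y 0)))
    (hA : Asymmetric M N (occupied (y 0)) ∨ ∃ g, farthest (occupied (y 0)) = {g})
    (hg : minView M N (occupied (y 0)) (farthest (occupied (y 0))) = {y 0 i}) :
    ∃ d, IsBest M N ((occupied (y 0)).erase (y 0 i)) (y 0 i) d ∧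
      sumDist ((occupied (y 0)).erase (y 0 i)) (y 0 i) + 2 ≤
        sumDist ((occupied (y 0)).erase (y 0 i)) (y 0 i + d) ∧
      y 1 i = y 0 i + d ∧ (∀ j, j ≠ i → y 1 j = y 0 j) ∧ GoodStep M N (y 0) (y 1) ∧
      farthest (occupied (y 1)) = {y 1 i} ∧
      (occupied (y 1)).erase (y 1 i) = (occupied (y 0)).erase (y 0 i) := by
  set R := occupied (y 0) with hR
  have hgS : y 0 i ∈ farthest R :=
    Finset.filter_subset _ _ (hg ▸ Finset.mem_singleton_self _)
  have hiR := (Finset.mem_filter.1 hgS).1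
  obtain ⟨o, ho⟩ := hy 0
  have hstep : ∀ j, y 1 j = inFrame M N (o j) moveToSide R (y 0 j) := by
    intro j
    rw [← algoAsym_inFrame_of_forall_not_onSide hpat (card_occupiedCorners_eq_zero.2
      (corner_notMem_of_not_onSide hs)) hs]
    exact ho j
  have hne : ∀ j, j ≠ i → y 1 j = y 0 j := by
    intro j hj
    rw [hstep j]
    exact (moveToSide_inFrame hA hg _).1 _ fun e => hj (hp.injective e)
  obtain ⟨d, hd, he⟩ := (moveToSide_inFrame hA hg (o i)).2
  rw [← hstep i] at he
  have hc := hp.card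
  have h7 := hp.seven_le
  rw [← hR] at hc
  obtain ⟨d', hd', hg'⟩ := exists_growth hgS (by omega)
  have hgrow : sumDist (R.erase (y 0 i)) (y 0 i) + 2 ≤ sumDist (R.erase (y 0 i)) (y 0 i + d) := by
    have := outKey_le_iff.1 (hd.2 d' hd')
    omega
  obtain ⟨hfree, hfar⟩ := farthest_insert hgS (cellDist_add_of_mem_directions hd.1) hgrow
  rw [← he] at hfree hfar
  have hadj : (gridGraph M N).Adj (y 0 i) (y 1 i) := by
    rw [he]
    exact adj_add_of_not_onSide (hp.mem i) (hs _ hiR) hd.1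
  obtain ⟨hgood, hocc⟩ := goodStep_of_single hp hne hadj hfree
  refine ⟨d, hd, hgrow, he, hne, hgood, by rw [hocc, hfar], ?_⟩
  rw [hocc, Finset.erase_insert fun h => hfree (Finset.mem_of_mem_erase h)]

theorem goodStep_shift {t₀ : ℕ} (h0 : GoodStep M N (y 0) (y 1))
    (h : ∀ t < t₀, GoodStep M N (y (t + 1)) (y (t + 1 + 1))) :
    ∀ t < t₀ + 1, GoodStep M N (y t) (y (t + 1)) := by
  intro t ht
  rcases Nat.eq_zero_or_pos t with rfl | hpos
  · exact h0
  · have := h (t - 1) (by omega)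
    rwa [Nat.sub_add_cancel hpos] at this

/-- A guard with a unique best direction walks straight to the side. -/
theorem reaches_side_of_strict (hd : d ∈ directions) : ∀ (m : ℕ) (y : ℕ → Fin n → Cell),
    IsRun M N y → Placement M N (y 0) → (∀ j, j ≠ i → ¬ OnSide M N (y 0 j)) →
    farthest (occupied (y 0)) = {y 0 i} →
    (∀ d' ∈ directions, d' ≠ d → outKey M N ((occupied (y 0)).erase (y 0 i)) (y 0 i) d <
      outKey M N ((occupied (y 0)).erase (y 0 i)) (y 0 i) d') →
    sideDist M N (y 0 i) d = m →
    ∃ t₀ : ℕ, (∀ t < t₀, GoodStep M N (y t) (y (t + 1))) ∧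
      (PatternFormed M N (occupied (y t₀)) ∨
        OnSide M N (y t₀ i) ∧ ∀ j, j ≠ i → ¬ OnSide M N (y t₀ j)) ∧
      y t₀ i = y 0 i + (t₀ * d.1, t₀ * d.2)
  | m, y, hy, hp, hs, hfar, hstrict, hm => by
    by_cases hpat : PatternFormed M N (occupied (y 0))
    · exact ⟨0, by simp, Or.inl hpat, by simp⟩
    by_cases hside : OnSide M N (y 0 i)
    · exact ⟨0, by simp, Or.inr ⟨hside, hs⟩, by simp⟩
    have hs' : ∀ u ∈ occupied (y 0), ¬ OnSide M N u := by
      intro u hu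
      obtain ⟨j, rfl⟩ := mem_occupied.1 hu
      by_cases hj : j = i
      · exact hj ▸ hside
      · exact hs j hj
    obtain ⟨d', hbest, hgrow, he, hne, hgood, hfar1, herase⟩ :=
      step_to_side (i := i) hy hp hs' hpat (Or.inr ⟨_, hfar⟩) (by rw [hfar, minView_singleton])
    obtain rfl : d = d' := by
      by_contra hdd
      exact absurd (hbest.2 d hd) (not_le.2 (hstrict d' hbest.1 (Ne.symm hdd)))
    have hm1 := sideDist_add (M := M) (N := N) (v := y 0 i) hd
    rw [← he] at hm1
    have hnn := sideDist_nonneg hd ((hp.step hgood).mem i)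
    obtain ⟨m, rfl⟩ : ∃ m', m = m' + 1 := ⟨m - 1, by omega⟩
    have hnext := (hbest.strict_of_growth hgrow).2
    rw [← he, ← herase] at hnext
    obtain ⟨t₀, h1, h2, h3⟩ := reaches_side_of_strict hd m (fun t => y (t + 1)) (hy.shift 1)
      (hp.step hgood) (fun j hj => by
        show ¬ OnSide M N (y 1 j)
        rw [hne j hj]
        exact hs j hj) hfar1 hnext (by
        show sideDist M N (y 1 i) d = m
        push_cast at hm
        omega)
    refine ⟨t₀ + 1, goodStep_shift hgood h1, h2, ?_⟩
    rw [h3]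
    show y 1 i + _ = _
    rw [he, add_assoc]
    congr 1
    ext <;> simp <;> ring

/-- The guard is selected, walks straight to a side, and is then the only robot on a side. -/
theorem reaches_side (hy : IsRun M N y) (hp : Placement M N (y 0))
    (hA : Asymmetric M N (occupied (y 0))) (hs : ∀ u ∈ occupied (y 0), ¬ OnSide M N u) :
    ∃ t₀ : ℕ, ∃ i, ∃ d ∈ directions, (∀ t < t₀, GoodStep M N (y t) (y (t + 1))) ∧
      (PatternFormed M N (occupied (y t₀)) ∨
        OnSide M N (y t₀ i) ∧ ∀ j, j ≠ i → ¬ OnSide M N (y t₀ j)) ∧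
      y t₀ i = y 0 i + (t₀ * d.1, t₀ * d.2) := by
  have hc := hp.card
  have h7 := hp.seven_le
  have hne : (farthest (occupied (y 0))).Nonempty := by
    obtain ⟨u, hu, hmax⟩ := Finset.exists_max_image (occupied (y 0)) (sumDist (occupied (y 0)))
      (Finset.card_pos.1 (by omega))
    exact ⟨u, Finset.mem_filter.2 ⟨hu, hmax⟩⟩
  obtain ⟨g, hgS, hg⟩ := exists_minView_eq M N (occupied (y 0)) hne
  obtain ⟨i, rfl⟩ := mem_occupied.1 (Finset.mem_filter.1 hgS).1
  by_cases hpat : PatternFormed M N (occupied (y 0))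
  · exact ⟨0, i, (-1, 0), by decide, by simp, Or.inl hpat, by simp⟩
  obtain ⟨d, hbest, hgrow, he, hne, hgood, hfar1, herase⟩ :=
    step_to_side hy hp hs hpat (Or.inl hA) hg
  have hnext := (hbest.strict_of_growth hgrow).2
  rw [← he, ← herase] at hnext
  obtain ⟨m, hm⟩ := Int.eq_ofNat_of_zero_le
    (sideDist_nonneg hbest.1 ((hp.step hgood).mem i))
  obtain ⟨t₀, h1, h2, h3⟩ := reaches_side_of_strict hbest.1 m (fun t => y (t + 1)) (hy.shift 1)
    (hp.step hgood) (fun j hj => by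
      show ¬ OnSide M N (y 1 j)
      rw [hne j hj]
      exact hs _ (mem_occupied.2 ⟨j, rfl⟩)) hfar1 hnext hm
  refine ⟨t₀ + 1, i, d, hbest.1, goodStep_shift hgood h1, h2, ?_⟩
  rw [h3]
  show y 1 i + _ = _
  rw [he, add_assoc]
  congr 1
  ext <;> simp <;> ring

/-- The configuration `x'`, reached from `x` in `t` cycles, has a single robot on a corner, or the
pattern is formed by chance. A robot whose distance from its start is at least `t` bounds the time,
and it is the guard unless the pattern is formed. A single cycle (when several corners are cleared)
needs no such bound. -/
def GuardPlaced (M N : ℕ) (x x' : Fin n → Cell) (t : ℕ) : Prop :=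
  (PatternFormed M N (occupied x') ∨ (occupiedCorners M N (occupied x')).card = 1) ∧
    (t ≤ 1 ∨ ∃ i, (t : ℤ) ≤ cellDist (x i) (x' i) ∧
      (¬ PatternFormed M N (occupied x') → x' i ∈ corners M N))

/-- From a position on a side without occupied corner. -/
theorem reaches_corner_of_onSide (hy : IsRun M N y) (hp : Placement M N (y 0))
    (hA : Asymmetric M N (occupied (y 0)) ∨
      ∃ g, sideCandidates M N (occupied (y 0)) = {g})
    (hc : ∀ c ∈ corners M N, c ∉ occupied (y 0)) (hs : ∃ u ∈ occupied (y 0), OnSide M N u) :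
    ∃ t₀ : ℕ, ∃ i, OnSide M N (y 0 i) ∧ (∀ t < t₀, GoodStep M N (y t) (y (t + 1))) ∧
      (PatternFormed M N (occupied (y t₀)) ∨
        (occupiedCorners M N (occupied (y t₀))).card = 1 ∧ y t₀ i ∈ corners M N) ∧
      cornerDist M N (y t₀ i) + t₀ = cornerDist M N (y 0 i) ∧
      KeepsSide M N (y 0 i) (y t₀ i) := by
  have hne : (sideCandidates M N (occupied (y 0))).Nonempty := by
    obtain ⟨u, hu, hmin⟩ := Finset.exists_min_image
      ((occupied (y 0)).filter fun u => OnSide M N u) (cornerDist M N) (by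
        obtain ⟨u, hu, hu'⟩ := hs
        exact ⟨u, Finset.mem_filter.2 ⟨hu, hu'⟩⟩)
    obtain ⟨h1, h2⟩ := Finset.mem_filter.1 hu
    exact ⟨u, Finset.mem_filter.2 ⟨h1, h2, fun s hs hs' =>
      hmin s (Finset.mem_filter.2 ⟨hs, hs'⟩)⟩⟩
  obtain ⟨g, hgS, hg⟩ := exists_minView_eq M N (occupied (y 0)) hne
  obtain ⟨h1, h2, -⟩ := Finset.mem_filter.1 hgS
  obtain ⟨i, rfl⟩ := mem_occupied.1 h1
  obtain ⟨m, hm⟩ := Int.eq_ofNat_of_zero_le (cornerDist_nonneg (hp.mem i))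
  obtain ⟨t₀, h⟩ := reaches_corner m y hy hp hc hA i hg hm
  exact ⟨t₀, i, h2, h⟩

theorem Placement.of_goodSteps (hp : Placement M N (y 0)) {t₀ : ℕ}
    (h : ∀ t < t₀, GoodStep M N (y t) (y (t + 1))) : ∀ t ≤ t₀, Placement M N (y t) := by
  intro t ht
  induction t with
  | zero => exact hp
  | succ t ih => exact (ih (by omega)).step (h t (by omega))

theorem guard_placement_of_not_onSide (hy : IsRun M N y) (hp : Placement M N (y 0))
    (hA : Asymmetric M N (occupied (y 0))) (hs : ∀ u ∈ occupied (y 0), ¬ OnSide M N u) :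
    ∃ t₀ : ℕ, (∀ t < t₀, GoodStep M N (y t) (y (t + 1))) ∧ GuardPlaced M N (y 0) (y t₀) t₀ := by
  obtain ⟨t₁, i, d, hd, hgood, h1, h2⟩ := reaches_side hy hp hA hs
  have hi := hs _ (mem_occupied.2 ⟨i, rfl⟩)
  have hdist : cellDist (y 0 i) (y t₁ i) = t₁ := by
    rw [h2]
    rcases mem_directions.1 hd with rfl | rfl | rfl | rfl <;> simp [cellDist]
  by_cases hpat : PatternFormed M N (occupied (y t₁))
  · exact ⟨t₁, hgood, Or.inl hpat, Or.inr ⟨i, hdist.ge, fun h => absurd hpat h⟩⟩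
  obtain ⟨hside, hothers⟩ := h1.resolve_left hpat
  have hp1 := hp.of_goodSteps hgood t₁ le_rfl
  have huniq : ∀ u ∈ occupied (y t₁), OnSide M N u → u = y t₁ i := by
    intro u hu hus
    obtain ⟨j, rfl⟩ := mem_occupied.1 hu
    by_contra hne
    exact hothers j (fun e => hne (e ▸ rfl)) hus
  have hin : y t₁ i ∈ occupied (y t₁) := mem_occupied.2 ⟨i, rfl⟩
  -- the guard has moved in one coordinate only, and hence is not on a corner
  have hcoord : (y t₁ i).1 = (y 0 i).1 ∧ d.1 = 0 ∨ (y t₁ i).2 = (y 0 i).2 ∧ d.2 = 0 := by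
    rw [h2]
    rcases mem_directions.1 hd with rfl | rfl | rfl | rfl <;> simp
  have hnc : ∀ c ∈ corners M N, c ∉ occupied (y t₁) := by
    intro c hc hcR
    have hcs : OnSide M N c := by
      rw [mem_corners] at hc
      unfold OnSide
      tauto
    rw [huniq c hcR hcs, mem_corners] at hc
    unfold OnSide at hi
    omega
  have hsing : sideCandidates M N (occupied (y t₁)) = {y t₁ i} := by
    ext u
    rw [sideCandidates, Finset.mem_filter, Finset.mem_singleton]
    constructor
    · rintro ⟨h3, h4, -⟩
      exact huniq u h3 h4
    · rintro rfl
      exact ⟨hin, hside, fun s hs hs' => by rw [huniq s hs hs']⟩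
  obtain ⟨t₂, j, hj, hgood2, h3, h4, h5⟩ := reaches_corner_of_onSide (hy.shift t₁)
    (by simp only [Nat.zero_add]; exact hp1)
    (by simp only [Nat.zero_add]; exact Or.inr ⟨_, hsing⟩)
    (by simp only [Nat.zero_add]; exact hnc)
    (by simp only [Nat.zero_add]; exact ⟨_, hin, hside⟩)
  simp only [Nat.zero_add] at hj h4 h5
  have hji : j = i := by
    by_contra hne
    exact hothers j hne hj
  subst hji
  refine ⟨t₂ + t₁, fun t ht => ?_, ?_, Or.inr ⟨j, ?_, fun h => (h3.resolve_left h).2⟩⟩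
  · rcases lt_or_ge t t₁ with h | h
    · exact hgood t h
    · have := hgood2 (t - t₁) (by omega)
      rw [Nat.sub_add_cancel h, Nat.add_right_comm, Nat.sub_add_cancel h] at this
      exact this
  · exact h3.imp_right And.left
  · have h6 := cornerDist_sub_le (M := M) (N := N) (v := y t₁ j) (w := y (t₂ + t₁) j)
    have h7 : cellDist (y 0 j) (y (t₂ + t₁) j) =
        cellDist (y 0 j) (y t₁ j) + cellDist (y t₁ j) (y (t₂ + t₁) j) := by
      obtain ⟨k1, k2⟩ := h5
      unfold OnSide at hi hj
      simp only [cellDist]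
      rcases hcoord with ⟨e, -⟩ | ⟨e, -⟩
      · rw [k2 (by omega), e]
        simp
        ring
      · rw [k1 (by omega), e]
        simp
    push_cast
    omega

/-- From every asymmetric configuration, the guard is placed. -/
theorem guard_placement (hy : IsRun M N y) (hp : Placement M N (y 0))
    (hA : Asymmetric M N (occupied (y 0))) :
    ∃ t₀ : ℕ, (∀ t < t₀, GoodStep M N (y t) (y (t + 1))) ∧ GuardPlaced M N (y 0) (y t₀) t₀ := by
  by_cases hpat : PatternFormed M N (occupied (y 0))
  · exact ⟨0, by simp, Or.inl hpat, Or.inl (by norm_num)⟩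
  have hcard := hp.card
  rcases lt_trichotomy (occupiedCorners M N (occupied (y 0))).card 1 with h | h | h
  · have h0 : (occupiedCorners M N (occupied (y 0))).card = 0 := by omega
    have hc := card_occupiedCorners_eq_zero.1 h0
    by_cases hs : ∃ u ∈ occupied (y 0), OnSide M N u
    · obtain ⟨t₀, i, -, h1, h2, h3, -⟩ := reaches_corner_of_onSide hy hp (Or.inl hA) hc hs
      refine ⟨t₀, h1, h2.imp_right And.left, Or.inr ⟨i, ?_, fun h => (h2.resolve_left h).2⟩⟩
      have := cornerDist_sub_le (M := M) (N := N) (v := y 0 i) (w := y t₀ i)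
      omega
    · exact guard_placement_of_not_onSide hy hp hA fun u hu h => hs ⟨u, hu, h⟩
  · exact ⟨0, by simp, Or.inr h, Or.inl (by norm_num)⟩
  · obtain ⟨hfr, hsafe, hone⟩ := clearCorners_spec hA (by rw [hcard]; exact hp.seven_le)
      (by rw [hcard]; exact hp.rows) (by rw [hcard]; exact hp.cols) h
    obtain ⟨o, ho⟩ := hy 0
    have hstep : ∀ j, y 1 j = clearCorners M N (occupied (y 0)) (y 0 j) := by
      intro j
      rw [← hfr (o j) _ (mem_occupied.2 ⟨j, rfl⟩), ← algoAsym_inFrame_of_one_lt hpat h]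
      exact ho j
    have hocc : occupied (y 1) =
        (occupied (y 0)).image (clearCorners M N (occupied (y 0))) := by
      rw [occupied, occupied, Finset.image_image]
      exact Finset.image_congr fun j _ => hstep j
    refine ⟨1, fun t ht => ?_, Or.inr (by rw [hocc]; exact hone), Or.inl le_rfl⟩
    obtain rfl : t = 0 := by omega
    refine ⟨fun a b hab => ?_, fun j => ?_⟩
    · rw [Nat.zero_add, hstep a, hstep b] at hab
      exact hp.injective (hsafe.injOn (mem_occupied.2 ⟨a, rfl⟩) (mem_occupied.2 ⟨b, rfl⟩) hab)
    · rw [Nat.zero_add, hstep j]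
      exact hsafe.adj _ (mem_occupied.2 ⟨j, rfl⟩)

end

/-! ### The guarded stage in an execution -/

section

variable {M N n : ℕ} {R : Finset Cell} {a q : Fin 4} {v : Cell}

/-- The turn `guardFrame` is the only one that brings the guard to the upper right. -/
theorem guardFrame_eq (h : Guarded (rotRows M N a) (rotCols M N a) (rotate M N a R)) :
    guardFrame M N R = a := by
  obtain ⟨h1, h2⟩ := h.four_le
  have hg := mem_rotate.1 h.guard
  have hc : ∀ c ∈ corners M N, c ∈ R → rotCell M N a c = (1, (rotCols M N a : ℤ)) :=
    fun c hc hcR => h.corner _ (rotCell_mem_corners.2 hc) (rotCell_mem_rotate.2 hcR)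
  have e1 := hc (1, (N : ℤ)) (by simp [corners])
  have e2 := hc (1, 1) (by simp [corners])
  have e3 := hc ((M : ℤ), 1) (by simp [corners])
  rw [guardFrame]
  fin_cases a <;>
    simp [rotRows, rotCols, rotCell, show -(1 : Fin 4) = 3 from rfl,
      show -(2 : Fin 4) = 2 from rfl, show -(3 : Fin 4) = 1 from rfl] at h1 h2 hg e1 e2 e3 ⊢ <;>
    split_ifs <;> simp_all
  all_goals omega

theorem Guarded.card_occupiedCorners (h : Guarded M N R) : (occupiedCorners M N R).card = 1 := by
  rw [Finset.card_eq_one]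
  refine ⟨(1, (N : ℤ)), Finset.ext fun c => ?_⟩
  rw [occupiedCorners, Finset.mem_filter, Finset.mem_singleton]
  constructor
  · rintro ⟨h1, h2⟩
    exact h.corner c h1 h2
  · rintro rfl
    exact ⟨by simp [corners], h.guard⟩

theorem Guarded.not_patternFormed (h : Guarded M N R) : ¬ PatternFormed M N R :=
  not_patternFormed_of_corner h.card h.subset (by simp [corners]) h.guard

/-- In every local coordinate system, the robots follow the rules of the frame in which the guard
is on the upper right. -/
theorem algoAsym_inFrame_of_guarded
    (h : Guarded (rotRows M N a) (rotCols M N a) (rotate M N a R)) :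
    inFrame M N q algoAsym R v = inFrame M N a guardedMove R v := by
  have hpat : ¬ PatternFormed M N R := fun hp => h.not_patternFormed (patternFormed_rotate.2 hp)
  have hcard : (occupiedCorners M N R).card = 1 := by
    rw [← card_occupiedCorners_frame (q := a)]
    exact h.card_occupiedCorners
  have hframe : guardFrame (rotRows M N q) (rotCols M N q) (rotate M N q R) = a - q := by
    apply guardFrame_eq
    rw [rotRows_rotRows, rotCols_rotCols, rotate_rotate, add_sub_cancel]
    exact h
  have e := rotCell_neg_inFrame M N q (a - q) guardedMove R v
  rw [add_sub_cancel] at e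
  rw [← e, inFrame, algoAsym, if_neg (mt patternFormed_frame.1 hpat), card_occupiedCorners_frame,
    if_pos hcard, hframe]

theorem exists_guarded (hR : R ⊆ cells M N) (h7 : 7 ≤ R.card) (hM : (R.card + 1) / 2 ≤ M)
    (hN : (R.card + 1) / 2 ≤ N) (hc : (occupiedCorners M N R).card = 1) :
    ∃ a, Guarded (rotRows M N a) (rotCols M N a) (rotate M N a R) := by
  obtain ⟨c, hc⟩ := Finset.card_eq_one.1 hc
  obtain ⟨hcc, hcR⟩ := Finset.mem_filter.1
    (show c ∈ occupiedCorners M N R from hc ▸ Finset.mem_singleton_self c)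
  obtain ⟨a, ha⟩ : ∃ a, rotCell M N a c = (1, (rotCols M N a : ℤ)) := by
    simp only [corners, Finset.mem_insert, Finset.mem_singleton] at hcc
    rcases hcc with rfl | rfl | rfl | rfl
    · exact ⟨1, by simp [rotCell, rotCols]⟩
    · exact ⟨0, by simp [rotCell, rotCols]⟩
    · exact ⟨2, by simp [rotCell, rotCols]⟩
    · exact ⟨3, by simp [rotCell, rotCols]⟩
  refine ⟨a, rotate_subset_cells.2 hR, ?_, ?_, by rwa [card_rotate], ?_, ?_⟩
  · rw [← ha]
    exact rotCell_mem_rotate.2 hcR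
  · intro c' h1 h2
    have h3 : c' ∈ occupiedCorners (rotRows M N a) (rotCols M N a) (rotate M N a R) :=
      Finset.mem_filter.2 ⟨h1, h2⟩
    rw [occupiedCorners_rotate, hc, rotate, Finset.image_singleton, Finset.mem_singleton] at h3
    rw [h3, ha]
  · rw [card_rotate]
    exact rotRows_le a hM hN
  · rw [card_rotate]
    exact rotCols_le a hM hN

theorem step_of_guarded {x x' : Fin n → Cell} (hp : Placement M N x)
    (hG : Guarded (rotRows M N a) (rotCols M N a) (rotate M N a (occupied x)))
    (hx : ∃ o : Fin n → Fin 4, ∀ i, x' i = inFrame M N (o i) algoAsym (occupied x) (x i)) :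
    GoodStep M N x x' ∧ rotate M N a (occupied x') =
      guardedNext (rotRows M N a) (rotCols M N a) (rotate M N a (occupied x)) := by
  obtain ⟨o, ho⟩ := hx
  have hmove : ∀ i, rotCell M N a (x' i) = guardedMove (rotRows M N a) (rotCols M N a)
      (rotate M N a (occupied x)) (rotCell M N a (x i)) := by
    intro i
    rw [ho i, algoAsym_inFrame_of_guarded hG, rotCell_inFrame]
  have hmem : ∀ i, rotCell M N a (x i) ∈ rotate M N a (occupied x) := fun i =>
    rotCell_mem_rotate.2 (mem_occupied.2 ⟨i, rfl⟩)
  have hsafe := hG.guardedMove_safe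
  refine ⟨⟨fun i j hij => ?_, fun i => ?_⟩, ?_⟩
  · apply hp.injective
    apply rotCell_injective M N a
    apply hsafe.injOn (hmem i) (hmem j)
    rw [← hmove i, ← hmove j, hij]
  · rcases hsafe.adj _ (hmem i) with h | h
    · rw [← hmove i, rotCell_inj] at h
      exact Or.inl h
    · rw [← hmove i, gridGraph_adj_rotCell] at h
      exact Or.inr h
  · rw [guardedNext, rotate, rotate, occupied, occupied, Finset.image_image, Finset.image_image,
      Finset.image_image]
    exact Finset.image_congr fun i _ => hmove i

theorem ReachIn.exists_time {P : Finset Cell → Prop} {T : ℕ} {S : Finset Cell}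
    (h : ReachIn (rotRows M N a) (rotCols M N a) P T S) :
    ∀ y : ℕ → Fin n → Cell, IsRun M N y → Placement M N (y 0) →
      rotate M N a (occupied (y 0)) = S →
      ∃ t ≤ T, (∀ s < t, GoodStep M N (y s) (y (s + 1))) ∧ P (rotate M N a (occupied (y t))) := by
  induction h with
  | here hS => exact fun y _ _ e => ⟨0, Nat.zero_le _, by simp, e ▸ hS⟩
  | @step T S hG _ ih =>
    rintro y hy hp rfl
    obtain ⟨h1, h2⟩ := step_of_guarded hp hG (hy 0)
    obtain ⟨t, ht, h3, h4⟩ := ih (fun t => y (t + 1)) (hy.shift 1) (hp.step h1) h2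
    exact ⟨t + 1, by omega, goodStep_shift h1 h3, h4⟩

theorem corner_sides_mem_pattern {n : ℕ} (hn : 7 ≤ n) :
    (1, (((n + 1) / 2 : ℕ) : ℤ) - 1) ∈ pattern n ∧
      ((((n + 1) / 2 : ℕ) : ℤ) - 1, (1 : ℤ)) ∈ pattern n := by
  constructor <;> rw [mem_pattern_iff_cols hn rfl] <;> unfold leftCol rightCol <;>
    split_ifs <;> omega

theorem normalize_image_pattern {n : ℕ} (hn : 7 ≤ n) (b : ℤ) :
    normalize ((pattern n).image fun v => (v.1, v.2 + b)) = pattern n := by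
  obtain ⟨h1, h2⟩ := corner_sides_mem_pattern hn
  have e1 : minRow ((pattern n).image fun v => (v.1, v.2 + b)) = 1 := by
    refine minRow_eq ⟨_, Finset.mem_image_of_mem _ h1, rfl⟩ fun v hv => ?_
    obtain ⟨u, hu, rfl⟩ := Finset.mem_image.1 hv
    exact (pattern_bounds hu).1.1
  have e2 : minCol ((pattern n).image fun v => (v.1, v.2 + b)) = 1 + b := by
    refine minCol_eq ⟨_, Finset.mem_image_of_mem _ h2, rfl⟩ fun v hv => ?_
    obtain ⟨u, hu, rfl⟩ := Finset.mem_image.1 hv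
    have := (pattern_bounds hu).2.1
    simp only
    omega
  rw [normalize, e1, e2, Finset.image_image]
  conv_rhs => rw [← Finset.image_id (s := pattern n)]
  refine Finset.image_congr fun v _ => Prod.ext ?_ ?_ <;> simp

theorem patternFormed_target (hn : 7 ≤ n) (M N N' : ℕ) : PatternFormed M N (target n N') := by
  refine ⟨0, ?_⟩
  rw [rotate_zero, card_target hn]
  have := normalize_image_pattern hn ((N' : ℤ) - ((n + 1) / 2 : ℕ))
  simpa only [target, add_sub_assoc] using this

/-! ### The upper bound -/

theorem cellDist_le_of_goodSteps {y : ℕ → Fin n → Cell} {t₀ : ℕ}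
    (h : ∀ t < t₀, GoodStep M N (y t) (y (t + 1))) (i : Fin n) :
    ∀ t ≤ t₀, cellDist (y 0 i) (y t i) ≤ t := by
  intro t ht
  induction t with
  | zero => simp
  | succ t ih =>
    have h1 := ih (by omega)
    have h2 := cellDist_triangle (y 0 i) (y t i) (y (t + 1) i)
    have h3 : cellDist (y t i) (y (t + 1) i) ≤ 1 := by
      rcases (h t (by omega)).2 i with e | e
      · rw [e, cellDist_self]; norm_num
      · exact e.2.2.le
    push_cast
    omega

theorem card_le_squareSide {S : Finset Cell} (R : Finset Cell) (hn : 7 ≤ S.card)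
    (h : PatternFormed M N S) : (S.card + 1) / 2 ≤ squareSide R S + 1 := by
  obtain ⟨u, hu, v, hv, huv⟩ := exists_rowSpan (Finset.card_pos.1 (by omega : 0 < S.card))
  have h1 := (abs_le_squareSide (R := R) (Finset.mem_union_right _ hu)
    (Finset.mem_union_right _ hv)).1
  have h2 := (patternFormed_spans hn h).1
  have h3 := le_abs_self (u.1 - v.1)
  omega

/-- From the moment the guard is placed, the pattern is formed in time linear in the side of the
square around the initial and the final configuration. -/
theorem exists_time_patternFormed {y : ℕ → Fin n → Cell} (hy : IsRun M N y)
    (hp : Placement M N (y 0)) (hA : Asymmetric M N (occupied (y 0))) :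
    ∃ T : ℕ, (∀ t < T, GoodStep M N (y t) (y (t + 1))) ∧ PatternFormed M N (occupied (y T)) ∧
      T ≤ 29 * squareSide (occupied (y 0)) (occupied (y T)) := by
  obtain ⟨t₀, hgood, h1, h2⟩ := guard_placement hy hp hA
  have h7 := hp.seven_le
  have hp0 := hp.of_goodSteps hgood t₀ le_rfl
  by_cases hpat : PatternFormed M N (occupied (y t₀))
  · refine ⟨t₀, hgood, hpat, ?_⟩
    have h3 := card_le_squareSide (occupied (y 0)) (by rwa [hp0.card]) hpat
    rw [hp0.card] at h3
    rcases h2 with h2 | ⟨i, h2, -⟩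
    · omega
    · have h4 := abs_le_squareSide (R := occupied (y 0)) (S := occupied (y t₀))
        (Finset.mem_union_left _ (mem_occupied.2 ⟨i, rfl⟩))
        (Finset.mem_union_right _ (mem_occupied.2 ⟨i, rfl⟩))
      rw [cellDist] at h2
      omega
  have hcard := hp0.card
  obtain ⟨a, hG⟩ := exists_guarded hp0.subset (by rwa [hcard]) (by rw [hcard]; exact hp.rows)
    (by rw [hcard]; exact hp.cols) (h1.resolve_left hpat)
  set N' := rotCols M N a with hN'
  set L := squareSide (rotate M N a (occupied (y 0))) (target n N') with hL
  have hk : (n + 1) / 2 ≤ L + 1 := by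
    have := card_le_squareSide (M := M) (N := N) (rotate M N a (occupied (y 0)))
      (by rwa [card_target h7]) (patternFormed_target h7 M N N')
    rwa [card_target h7] at this
  have htgt : (1, (N' : ℤ) - 1) ∈ target n N' := by
    have := hG.target_guard.1
    rwa [card_rotate, hcard] at this
  have hstart : ∀ j, |(rotCell M N a (y 0 j)).1 - 1| ≤ L ∧
      |(rotCell M N a (y 0 j)).2 - (N' - 1)| ≤ L := fun j =>
    abs_le_squareSide
      (Finset.mem_union_left _ (rotCell_mem_rotate.2 (mem_occupied.2 ⟨j, rfl⟩)))
      (Finset.mem_union_right _ htgt)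
  -- The walking robot ends on the corner next to the target `(1, N' - 1)`.
  have ht₀ : t₀ ≤ 2 * L + 1 := by
    rcases h2 with h2 | ⟨i, h2, h3⟩
    · omega
    · have h4 : rotCell M N a (y t₀ i) = (1, (N' : ℤ)) :=
        hG.corner _ (rotCell_mem_corners.2 (h3 hpat))
          (rotCell_mem_rotate.2 (mem_occupied.2 ⟨i, rfl⟩))
      rw [← cellDist_rotCell M N a, h4] at h2
      have h5 := hstart i
      simp only [cellDist, Int.abs_eq_natAbs] at h2 h5
      omega
  have hW : Within N' (3 * L + 2) (rotate M N a (occupied (y t₀))) := by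
    intro v hv
    obtain ⟨u, hu, rfl⟩ := Finset.mem_image.1 hv
    obtain ⟨j, rfl⟩ := mem_occupied.1 hu
    have h3 := cellDist_le_of_goodSteps hgood j t₀ le_rfl
    rw [← cellDist_rotCell M N a] at h3
    have h5 := hstart j
    simp only [cellDist, Int.abs_eq_natAbs] at h3 h5
    push_cast
    omega
  have hreach := hG.reachIn_target (H := 3 * L + 2) (by rw [card_rotate, hcard]; omega) hW
  rw [card_rotate, hcard] at hreach
  obtain ⟨t, ht, h3, h4⟩ := hreach.exists_time (fun t => y (t + t₀)) (hy.shift t₀)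
    (by simp only [Nat.zero_add]; exact hp0) (by simp only [Nat.zero_add])
  refine ⟨t + t₀, fun s hs => ?_, ?_, ?_⟩
  · rcases lt_or_ge s t₀ with h | h
    · exact hgood s h
    · have := h3 (s - t₀) (by omega)
      rw [Nat.sub_add_cancel h, Nat.add_right_comm, Nat.sub_add_cancel h] at this
      exact this
  · rw [← patternFormed_rotate (q := a), h4]
    exact patternFormed_target h7 _ _ _
  · rw [← squareSide_rotate M N a, h4]
    omega

theorem constant_of_patternFormed {y : ℕ → Fin n → Cell} (hy : IsRun M N y) {T : ℕ}
    (h : PatternFormed M N (occupied (y T))) : ∀ t, T ≤ t → y t = y T := by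
  intro t ht
  induction t, ht using Nat.le_induction with
  | base => rfl
  | succ t _ ih =>
    funext i
    obtain ⟨o, ho⟩ := hy t
    rw [ho i, ih, algoAsym_inFrame_of_patternFormed h]

theorem run_solves (p : Fin n → Cell) (hp : Placement M N p)
    (hA : Asymmetric M N (occupied p)) (o : ℕ → Fin n → Fin 4) :
    ValidRun M N (run algoAsym M N o p) ∧
      ∃ T : ℕ, SolvesGMVArea M N (occupied (run algoAsym M N o p T)) ∧
        (∀ t, T ≤ t → run algoAsym M N o p t = run algoAsym M N o p T) ∧
        T ≤ 29 * squareSide (occupied p) (occupied (run algoAsym M N o p T)) := by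
  have hy : IsRun M N (run algoAsym M N o p) := fun t => ⟨o t, fun i => rfl⟩
  obtain ⟨T, hgood, hpat, hT⟩ := exists_time_patternFormed hy hp hA
  have hconst := constant_of_patternFormed hy hpat
  have hpl := Placement.of_goodSteps (y := run algoAsym M N o p) hp hgood
  have hpT := hpl T le_rfl
  refine ⟨⟨fun t => ?_, fun t i => ?_⟩, T, ?_, hconst, hT⟩
  · rcases le_total t T with h | h
    · exact (hpl t h).injective
    · rw [hconst t h]
      exact hpT.injective
  · rcases lt_or_ge t T with h | h
    · exact (hgood t h).2 i
    · rw [hconst t h, hconst (t + 1) (by omega)]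
      exact Or.inl rfl
  · exact solvesGMVArea_of_patternFormed hpT.subset (by rw [hpT.card]; exact hp.seven_le) hpat

end

/-! ### The lower bound -/

section

variable {M N n : ℕ}

/-- The spans of every solution are those of the pattern. -/
theorem spans_of_solves {R : Finset Cell} (hR : R ⊆ cells M N) (h7 : 7 ≤ R.card)
    (hM : (R.card + 1) / 2 ≤ M) (hN : (R.card + 1) / 2 ≤ N) (h : SolvesGMVArea M N R) :
    rowSpan R + 1 = (R.card + 1) / 2 ∧ colSpan R + 1 = (R.card + 1) / 2 := by
  obtain ⟨hG, hmin⟩ := h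
  have hsub : pattern R.card ⊆ cells M N := by
    intro v hv
    have := pattern_bounds hv
    rw [mem_cells]
    omega
  have hcard := card_pattern h7
  have hform : PatternFormed M N (pattern R.card) := by
    refine ⟨0, ?_⟩
    rw [rotate_zero, hcard]
    have := normalize_image_pattern h7 0
    simpa using this
  have h1 := hmin _ hsub hcard (solvesGMVArea_of_patternFormed hsub (by rwa [hcard]) hform).1
  obtain ⟨h2, h3⟩ := pattern_spans h7
  rw [mbrArea, mbrArea, h2, h3] at h1
  obtain ⟨h4, h5⟩ := card_le_two_mul_rowSpan hR hG (Finset.card_pos.1 (by omega))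
  obtain ⟨k, hk⟩ : ∃ k, (R.card + 1) / 2 = k + 1 := ⟨(R.card + 1) / 2 - 1, by omega⟩
  rw [hk] at h1 ⊢
  simp only [Nat.add_sub_cancel] at h1
  have h6 : k ≤ rowSpan R := by omega
  have h7' : k ≤ colSpan R := by omega
  have h8 : 0 < k := by omega
  constructor
  · by_contra hne
    have : k + 1 ≤ rowSpan R := by omega
    have := Nat.mul_le_mul this h7'
    nlinarith
  · by_contra hne
    have : k + 1 ≤ colSpan R := by omega
    have := Nat.mul_le_mul h6 this
    nlinarith

/-- Two robots at distance `N - 1` in the coordinate `f` have to come together, and robots that are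
close together in the coordinate `g` have to spread out. -/
theorem le_seven_mul {x : ℕ → Fin n → Cell} {f g : Cell → ℤ} {N k T : ℕ}
    (hf : ∀ u v, f u - f v ≤ cellDist u v) (hg : ∀ u v, g u - g v ≤ cellDist u v)
    (hx : ∀ t i, cellDist (x t i) (x (t + 1) i) ≤ 1) (hk : 4 ≤ k) {i j : Fin n}
    (hij : (N : ℤ) - 1 ≤ f (x 0 i) - f (x 0 j)) (hflat : ∀ i j, g (x 0 i) - g (x 0 j) ≤ 2)
    (hT : ∀ i j, f (x T i) - f (x T j) ≤ k - 1)
    (hT' : ∃ i j, g (x T i) - g (x T j) = k - 1) : N ≤ 7 * T := by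
  have hd : ∀ t i, cellDist (x 0 i) (x t i) ≤ t := by
    intro t i
    induction t with
    | zero => simp
    | succ t ih =>
      have h1 := cellDist_triangle (x 0 i) (x t i) (x (t + 1) i)
      have h2 := hx t i
      push_cast
      omega
  obtain ⟨a, b, hab⟩ := hT'
  have h1 := hf (x 0 i) (x T i)
  have h2 := hf (x T j) (x 0 j)
  have h3 := hg (x T a) (x 0 a)
  have h4 := hg (x 0 b) (x T b)
  have h5 := hd T i
  have h6 := hd T j
  have h7 := hd T a
  have h8 := hd T b
  rw [cellDist_comm] at h2 h3
  have h9 := hT i j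
  have h10 := hflat a b
  omega

/-- A flat asymmetric configuration whose width is that of the grid. The robots are in the first
row, and in the third row if there is not enough room, except for one in the second row and the
last column. Only the upper left corner is occupied. -/
def flatPlacement (N n : ℕ) (i : Fin n) : Cell :=
  if i.val = 0 then (1, 1)
  else if i.val = 1 then (2, (N : ℤ))
  else if i.val < N then (1, (i.val : ℤ))
  else (3, (i.val : ℤ) - N + 1)

theorem flatPlacement_injective : Function.Injective (flatPlacement N n) := by
  intro i j h
  simp only [flatPlacement] at h
  apply Fin.ext
  split_ifs at h <;> simp only [Prod.mk.injEq] at h <;> omega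

theorem flatPlacement_bounds (h7 : 7 ≤ n) (hN : (n + 1) / 2 ≤ N) (i : Fin n) :
    (1 ≤ (flatPlacement N n i).1 ∧ (flatPlacement N n i).1 ≤ 3) ∧
      (1 ≤ (flatPlacement N n i).2 ∧ (flatPlacement N n i).2 ≤ N) ∧
      ((flatPlacement N n i).1 = 1 → (flatPlacement N n i).2 ≠ N) := by
  have := i.isLt
  simp only [flatPlacement]
  split_ifs <;> simp only [] <;> omega

theorem card_occupiedCorners_eq_one {R : Finset Cell} (h1 : (1, 1) ∈ R) (h2 : (1, (N : ℤ)) ∉ R)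
    (h3 : ((M : ℤ), 1) ∉ R) (h4 : ((M : ℤ), (N : ℤ)) ∉ R) :
    (occupiedCorners M N R).card = 1 := by
  rw [Finset.card_eq_one]
  refine ⟨(1, 1), Finset.ext fun c => ?_⟩
  rw [occupiedCorners, Finset.mem_filter, Finset.mem_singleton]
  constructor
  · rintro ⟨hc, hcR⟩
    simp only [corners, Finset.mem_insert, Finset.mem_singleton] at hc
    rcases hc with rfl | rfl | rfl | rfl
    · rfl
    · exact absurd hcR h2
    · exact absurd hcR h3
    · exact absurd hcR h4
  · rintro rfl
    exact ⟨by simp [corners], h1⟩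

theorem ValidRun.cellDist_le {x : ℕ → Fin n → Cell} (h : ValidRun M N x) (t : ℕ) (i : Fin n) :
    cellDist (x t i) (x (t + 1) i) ≤ 1 := by
  rcases h.2 t i with e | e
  · rw [e, cellDist_self]; norm_num
  · exact e.2.2.le

theorem ValidRun.placement {x : ℕ → Fin n → Cell} (h : ValidRun M N x)
    (h0 : Placement M N (x 0)) (t : ℕ) : Placement M N (x t) :=
  h0.of_goodSteps (t₀ := t) (fun s _ => ⟨h.1 (s + 1), h.2 s⟩) t le_rfl

/-- If the grid is higher than wide, the flat configuration is transposed. -/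
theorem exists_slow_placement (h7 : 7 ≤ n) (hM : (n + 1) / 2 ≤ M) (hN : (n + 1) / 2 ≤ N) :
    ∃ p : Fin n → Cell, (∀ i, p i ∈ cells M N) ∧ Function.Injective p ∧
      Asymmetric M N (occupied p) ∧
      ∀ (A : Algorithm) (o : ℕ → Fin n → Fin 4), ValidRun M N (run A M N o p) →
        ∀ T : ℕ, SolvesGMVArea M N (occupied (run A M N o p T)) → max M N ≤ 7 * T := by
  have hf1 : ∀ u v : Cell, u.1 - v.1 ≤ cellDist u v := fun u v => by
    simp only [cellDist, Int.abs_eq_natAbs]; omega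
  have hf2 : ∀ u v : Cell, u.2 - v.2 ≤ cellDist u v := fun u v => by
    simp only [cellDist, Int.abs_eq_natAbs]; omega
  have hspans : ∀ x : ℕ → Fin n → Cell, ValidRun M N x → Placement M N (x 0) → ∀ T,
      SolvesGMVArea M N (occupied (x T)) →
      (∀ i j, (x T i).1 - (x T j).1 ≤ ((n + 1) / 2 : ℕ) - 1) ∧
      (∀ i j, (x T i).2 - (x T j).2 ≤ ((n + 1) / 2 : ℕ) - 1) ∧
      (∃ i j, (x T i).1 - (x T j).1 = ((n + 1) / 2 : ℕ) - 1) ∧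
      ∃ i j, (x T i).2 - (x T j).2 = ((n + 1) / 2 : ℕ) - 1 := by
    intro x hx h0 T hT
    have hp := hx.placement h0 T
    have hc := hp.card
    obtain ⟨h1, h2⟩ := spans_of_solves hp.subset (by rwa [hc]) (by rwa [hc]) (by rwa [hc]) hT
    rw [hc] at h1 h2
    have hne : (occupied (x T)).Nonempty := Finset.card_pos.1 (by omega)
    refine ⟨fun i j => ?_, fun i j => ?_, ?_, ?_⟩
    · have := (le_abs_self _).trans (abs_row_le_rowSpan (mem_occupied.2 ⟨i, rfl⟩ : x T i ∈ _)
        (mem_occupied.2 ⟨j, rfl⟩ : x T j ∈ occupied (x T)))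
      omega
    · have := (le_abs_self _).trans (abs_col_le_colSpan (mem_occupied.2 ⟨i, rfl⟩ : x T i ∈ _)
        (mem_occupied.2 ⟨j, rfl⟩ : x T j ∈ occupied (x T)))
      omega
    · obtain ⟨u, hu, v, hv, huv⟩ := exists_rowSpan hne
      obtain ⟨i, rfl⟩ := mem_occupied.1 hu
      obtain ⟨j, rfl⟩ := mem_occupied.1 hv
      exact ⟨i, j, by omega⟩
    · obtain ⟨u, hu, v, hv, huv⟩ := exists_colSpan hne
      obtain ⟨i, rfl⟩ := mem_occupied.1 hu
      obtain ⟨j, rfl⟩ := mem_occupied.1 hv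
      exact ⟨i, j, by omega⟩
  have hk : 4 ≤ (n + 1) / 2 := by omega
  rcases le_total M N with hMN | hMN
  · have hb := flatPlacement_bounds h7 hN
    have hcell : ∀ i, flatPlacement N n i ∈ cells M N := fun i => by
      have := hb i
      rw [mem_cells]
      omega
    refine ⟨flatPlacement N n, hcell, flatPlacement_injective, ?_, ?_⟩
    · refine asymmetric_of_card_occupiedCorners (by omega) (card_occupiedCorners_eq_one
        (mem_occupied.2 ⟨⟨0, by omega⟩, by simp [flatPlacement]⟩) ?_ ?_ ?_) <;>
      · intro h
        obtain ⟨i, hi⟩ := mem_occupied.1 h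
        obtain ⟨⟨-, h5⟩, -, h6⟩ := hb i
        rw [hi] at h5 h6
        first
        | exact h6 rfl rfl
        | (simp only at h5; omega)
    · intro A o hv T hT
      have h0 : Placement M N (run A M N o (flatPlacement N n) 0) :=
        ⟨flatPlacement_injective, hcell, h7, hM, hN⟩
      obtain ⟨-, h2, h3, -⟩ := hspans _ hv h0 T hT
      rw [max_eq_right hMN]
      refine le_seven_mul (g := Prod.fst) (f := Prod.snd) hf2 hf1 hv.cellDist_le hk
        (i := ⟨1, by omega⟩) (j := ⟨0, by omega⟩) ?_ (fun i j => ?_) h2 h3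
      · simp [run, flatPlacement]
      · have h4 := hb i
        have h5 := hb j
        simp only [run]
        omega
  · have hb := flatPlacement_bounds h7 hM
    have hcell : ∀ i, (flatPlacement M n i).swap ∈ cells M N := fun i => by
      have := hb i
      rw [mem_cells]
      simp only [Prod.fst_swap, Prod.snd_swap]
      omega
    have hinj : Function.Injective fun i => (flatPlacement M n i).swap :=
      Prod.swap_injective.comp flatPlacement_injective
    refine ⟨fun i => (flatPlacement M n i).swap, hcell, hinj, ?_, ?_⟩
    · refine asymmetric_of_card_occupiedCorners (by omega) (card_occupiedCorners_eq_one
        (mem_occupied.2 ⟨⟨0, by omega⟩, by simp [flatPlacement]⟩) ?_ ?_ ?_) <;>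
      · intro h
        obtain ⟨i, hi⟩ := mem_occupied.1 h
        obtain ⟨⟨-, h5⟩, -, h6⟩ := hb i
        rw [Prod.swap_eq_iff_eq_swap] at hi
        rw [hi] at h5 h6
        first
        | exact h6 rfl rfl
        | (simp only [Prod.swap_prod_mk] at h5; omega)
    · intro A o hv T hT
      have h0 : Placement M N (run A M N o (fun i => (flatPlacement M n i).swap) 0) :=
        ⟨hinj, hcell, h7, hM, hN⟩
      obtain ⟨h1, -, -, h4⟩ := hspans _ hv h0 T hT
      rw [max_eq_left hMN]
      refine le_seven_mul (g := Prod.snd) (f := Prod.fst) hf1 hf2 hv.cellDist_le hk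
        (i := ⟨1, by omega⟩) (j := ⟨0, by omega⟩) ?_ (fun i j => ?_) h1 h4
      · simp [run, flatPlacement]
      · have h4 := hb i
        have h5 := hb j
        simp only [run, Prod.snd_swap]
        omega

end

end GridRobots

theorem theorem1 :
    (∃ K : ℕ, ∀ n M N : ℕ, 7 ≤ n → (n + 1) / 2 ≤ M → (n + 1) / 2 ≤ N →
      ∀ p : Fin n → Cell, (∀ i, p i ∈ cells M N) → Function.Injective p →
        Asymmetric M N (occupied p) →
      ∀ o : ℕ → Fin n → Fin 4,
        ValidRun M N (run algoAsym M N o p) ∧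
        ∃ T : ℕ,
          SolvesGMVArea M N (occupied (run algoAsym M N o p T)) ∧
          (∀ t, T ≤ t → run algoAsym M N o p t = run algoAsym M N o p T) ∧
          T ≤ K * squareSide (occupied p) (occupied (run algoAsym M N o p T))) ∧
    (∃ c : ℕ, ∀ n M N : ℕ, 7 ≤ n → (n + 1) / 2 ≤ M → (n + 1) / 2 ≤ N →
      ∃ p : Fin n → Cell, (∀ i, p i ∈ cells M N) ∧ Function.Injective p ∧
        Asymmetric M N (occupied p) ∧
        ∀ (A : Algorithm) (o : ℕ → Fin n → Fin 4), ValidRun M N (run A M N o p) →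
          ∀ T : ℕ, SolvesGMVArea M N (occupied (run A M N o p T)) → max M N ≤ c * T) := by
  refine ⟨⟨29, ?_⟩, 7, ?_⟩
  · intro n M N h7 hM hN p hp hinj hA o
    exact run_solves p ⟨hinj, hp, h7, hM, hN⟩ hA o
  · intro n M N h7 hM hN
    exact exists_slow_placement h7 hM hN
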